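/- Let $\tau\in\mathbb C$ with $\operatorname{Im}\tau>0$, let $\Gamma=\mathbb Z+\mathbb Z\tau$ and $\mathcal E=\mathbb C/\Gamma$, and let $\eta\in\mathbb C$ with $3\eta\notin\Gamma$ (so that $\tau$ is arbitrary and only finitely many points $\eta\in\mathcal E$ are excluded). For $n\in\mathbb Z_{\ge0}$ and $c\in\mathbb C$ let $\Theta_{n,c}(\Gamma)$ be the space of entire functions $f$ with $f(z+1)=f(z)$ and $f(z+\tau)=(-1)^n e^{-2\pi i(nz-c)}f(z)$. Put $$\theta(z)=\sum_{a\in\mathbb Z}(-1)^a e^{2\pi i\left(az+\frac{a(a-1)}2\tau\right)},\qquad \theta_a(z)=\theta\left(z+\tfrac a3\tau\right)\theta\left(z+\tfrac13+\tfrac a3\tau\right)\theta\left(z+\tfrac23+\tfrac a3\tau\right)e^{2\pi i\left(az+\frac{a(a-3)}6\tau+\frac a6\right)}\quad(a\in\mathbb Z/3\mathbb Z),$$ and, with $\omega=e^{2\pi i/3}$, $p=-\omega\,\theta_0(\eta)/\theta_2(\eta)$ and $q=-\omega^2\,\theta_1(\eta)/\theta_2(\eta)$. Let $Q_3(\mathcal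 E,\eta)=A_{p,q}$ be the associative unital $\mathbb C$-algebra with generators $x_0,x_1,x_2$ and defining relations $x_ix_{i+1}-q\,x_{i+1}x_i=p\,x_{i+2}^2$ $(i\in\mathbb Z/3\mathbb Z)$, and let $F_\alpha$ be the linear span of the monomials of degree $\alpha$ in $x_0,x_1,x_2$. Then: 1. There is a nonzero central element $C\in F_3$ of $Q_3(\mathcal E,\eta)$ such that the quotient $Q_3(\mathcal E,\eta)/(C)$ by the two-sided ideal generated by $C$ is isomorphic, as a $\mathbb C$-algebra, to $\bigoplus_{\alpha\ge0}\Theta_{3\alpha,\frac{\alpha(\alpha-1)}2 3\eta}(\Gamma)$, where the product of $f$ in the component of degree $\alpha$ and $g$ in the component of degree $\beta$ is the element $f*g(u)=f(u)\,g(u-\alpha\eta)$ of the component of degree $\alpha+\beta$. The isomorphism can be chosen to take the class of $x_i$ to $\theta_i$ in the component of degree $1$ for $i=0,1,2$; in particular it is graded. 2. $\dim F_\alpha=\frac{(\alpha+1)(\alpha+2)}2$ for every $\alpha\ge0$. -/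

import Mathlib

noncomputable section

namespace EllipticAlgebra

/-! ### Theta functions of one variable, for the lattice `Γ = ℤ + ℤ τ` -/

/-- The order one theta function
`θ(z) = ∑_{a ∈ ℤ} (-1)^a exp (2πi (a z + a (a - 1) / 2 * τ))`. -/
def theta (τ z : ℂ) : ℂ :=
  ∑' a : ℤ, (-1 : ℂ) ^ a *
    Complex.exp (2 * Real.pi * Complex.I * (a * z + (a : ℂ) * ((a : ℂ) - 1) / 2 * τ))

/-- The space `Θ_{n,c}(Γ)` of entire functions `f` with `f (z + 1) = f z` and
`f (z + τ) = (-1)^n exp (-2πi (n z - c)) f z`. -/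
def Theta (τ : ℂ) (n : ℕ) (c : ℂ) : Submodule ℂ (ℂ → ℂ) where
  carrier := {f | Differentiable ℂ f ∧ (∀ z, f (z + 1) = f z) ∧
    ∀ z, f (z + τ) = (-1) ^ n * Complex.exp (-(2 * Real.pi * Complex.I * (n * z - c))) * f z}
  add_mem' := by
    rintro f g ⟨hf, hf1, hf2⟩ ⟨hg, hg1, hg2⟩
    refine ⟨hf.add hg, fun z => ?_, fun z => ?_⟩
    · simp only [Pi.add_apply, hf1, hg1]
    · simp only [Pi.add_apply, hf2, hg2]; ring
  zero_mem' := ⟨differentiable_const 0, fun z => by simp, fun z => by simp⟩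
  smul_mem' := by
    rintro a f ⟨hf, hf1, hf2⟩
    refine ⟨hf.const_smul a, fun z => ?_, fun z => ?_⟩
    · simp only [Pi.smul_apply, hf1]
    · simp only [Pi.smul_apply, smul_eq_mul, hf2]; ring

/-- The theta functions `θ_0, θ_1, θ_2` of order three:
`θ_a(z) = θ(z + aτ/3) θ(z + 1/3 + aτ/3) θ(z + 2/3 + aτ/3) exp (2πi (a z + a (a - 3) / 6 * τ + a / 6))`
(the right-hand side depends only on `a` modulo 3). -/
def theta3 (τ : ℂ) (i : ZMod 3) (z : ℂ) : ℂ :=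
  let a : ℂ := (i.val : ℂ)
  theta τ (z + a / 3 * τ) * theta τ (z + 1 / 3 + a / 3 * τ) * theta τ (z + 2 / 3 + a / 3 * τ) *
    Complex.exp (2 * Real.pi * Complex.I * (a * z + a * (a - 3) / 6 * τ + a / 6))

/-! ### The three-generator algebra -/

/-- The defining relations `x_i x_{i+1} - q x_{i+1} x_i = p x_{i+2}^2`, `i ∈ ℤ/3ℤ`. -/
inductive Rel (p q : ℂ) : FreeAlgebra ℂ (ZMod 3) → FreeAlgebra ℂ (ZMod 3) → Prop
  | mk (i : ZMod 3) : Rel p q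
      (FreeAlgebra.ι ℂ i * FreeAlgebra.ι ℂ (i + 1) -
        q • (FreeAlgebra.ι ℂ (i + 1) * FreeAlgebra.ι ℂ i))
      (p • FreeAlgebra.ι ℂ (i + 2) ^ 2)

/-- The algebra `A_{p,q}` with generators `x_0, x_1, x_2` and the above relations. -/
abbrev A (p q : ℂ) : Type := RingQuot (Rel p q)

/-- The generator `x_i` of `A_{p,q}`. -/
def gen (p q : ℂ) (i : ZMod 3) : A p q :=
  RingQuot.mkAlgHom ℂ (Rel p q) (FreeAlgebra.ι ℂ i)

/-- The graded component `F_α` of `A_{p,q}`: the linear span of the non-commutative monomials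
of degree `α` in the generators. -/
def F (p q : ℂ) (α : ℕ) : Submodule ℂ (A p q) :=
  Submodule.span ℂ (Set.range fun w : Fin α → ZMod 3 => (List.ofFn fun k => gen p q (w k)).prod)

/-- The primitive cube root of unity `ω = exp (2πi / 3)`. -/
def zeta3 : ℂ := Complex.exp (2 * Real.pi * Complex.I / 3)

/-- The parameter `p = -ω θ_0(η) / θ_2(η) = -θ_1(η) θ_0(-η) / (θ_2(η) θ_2(-η))`. The factor `ω`
belongs to the chosen basis, in which `θ_a(-z) = -ω^a exp (-6πi z) θ_{-a}(z)`. -/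
def paramP (τ η : ℂ) : ℂ := -(zeta3 * theta3 τ 0 η / theta3 τ 2 η)

/-- The parameter `q = -ω² θ_1(η) / θ_2(η) = -θ_1(η) θ_0(-η) / (θ_0(η) θ_1(-η))`. -/
def paramQ (τ η : ℂ) : ℂ := -(zeta3 ^ 2 * theta3 τ 1 η / theta3 τ 2 η)

/-- The algebra `Q_3(E, η)`, for `E = ℂ / (ℤ + ℤ τ)`. -/
abbrev Q3 (τ η : ℂ) : Type := A (paramP τ η) (paramQ τ η)

/-- The quotient of a `ℂ`-algebra by the two-sided ideal generated by one element. -/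
abbrev QuotBy {R : Type} [Ring R] [Algebra ℂ R] (C : R) : Type :=
  (TwoSidedIdeal.span {C}).ringCon.Quotient

/-! ### The twisted theta-function algebra -/

/-- The component `Θ_{3α, α(α-1)/2 · 3η}(Γ)` of degree `α`. -/
def TwistedTheta (τ η : ℂ) (α : ℕ) : Submodule ℂ (ℂ → ℂ) :=
  Theta τ (3 * α) ((α : ℂ) * ((α : ℂ) - 1) / 2 * (3 * η))

/-- The product `(f * g)(u) = f(u) g(u - αη)` of a function `f` of degree `α` and a function `g`. -/
def twistedMul (η : ℂ) (α : ℕ) (f g : ℂ → ℂ) : ℂ → ℂ := fun u => f u * g (u - α * η)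

theorem twistedMul_mem {τ η : ℂ} {α β : ℕ} {f g : ℂ → ℂ}
    (hf : f ∈ TwistedTheta τ η α) (hg : g ∈ TwistedTheta τ η β) :
    twistedMul η α f g ∈ TwistedTheta τ η (α + β) := by
  obtain ⟨hf, hf1, hf2⟩ := hf
  obtain ⟨hg, hg1, hg2⟩ := hg
  refine ⟨hf.mul (hg.comp (differentiable_id.sub_const _)), fun z => ?_, fun z => ?_⟩
  · have h : z + 1 - α * η = z - α * η + 1 := by ring
    simp only [twistedMul, h, hf1, hg1]
  · have h : z + τ - α * η = z - α * η + τ := by ring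
    simp only [twistedMul, h, hf2, hg2]
    have e : -(2 * (Real.pi : ℂ) * Complex.I * (((3 * (α + β) : ℕ) : ℂ) * z -
          ((α + β : ℕ) : ℂ) * (((α + β : ℕ) : ℂ) - 1) / 2 * (3 * η))) =
        -(2 * (Real.pi : ℂ) * Complex.I * (((3 * α : ℕ) : ℂ) * z -
          (α : ℂ) * ((α : ℂ) - 1) / 2 * (3 * η))) +
        -(2 * (Real.pi : ℂ) * Complex.I * (((3 * β : ℕ) : ℂ) * (z - α * η) -
          (β : ℂ) * ((β : ℂ) - 1) / 2 * (3 * η))) := by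
      push_cast; ring
    rw [e, Complex.exp_add, Nat.mul_add, pow_add]
    ring

theorem const_mem (τ η c : ℂ) : (fun _ => c) ∈ TwistedTheta τ η 0 :=
  ⟨differentiable_const c, fun z => rfl, fun z => by simp⟩

theorem twisted_ext {τ η : ℂ} (a b : GradedMonoid fun α => TwistedTheta τ η α)
    (h : a.1 = b.1) (h' : (a.2 : ℂ → ℂ) = b.2) : a = b := by
  obtain ⟨i, a⟩ := a
  obtain ⟨j, b⟩ := b
  obtain rfl : i = j := h
  exact congrArg _ (Subtype.ext h')

instance instGMul (τ η : ℂ) : GradedMonoid.GMul fun α => TwistedTheta τ η α where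
  mul {α _β} f g := ⟨twistedMul η α f g, twistedMul_mem f.2 g.2⟩

instance instGOne (τ η : ℂ) : GradedMonoid.GOne fun α => TwistedTheta τ η α where
  one := ⟨fun _ => 1, const_mem τ η 1⟩

instance instGSemiring (τ η : ℂ) : DirectSum.GSemiring fun α => TwistedTheta τ η α where
  __ := instGMul τ η
  __ := instGOne τ η
  mul_zero a := Subtype.ext (by funext u; simp [GradedMonoid.GMul.mul, twistedMul])
  zero_mul a := Subtype.ext (by funext u; simp [GradedMonoid.GMul.mul, twistedMul])
  mul_add a b c := Subtype.ext (by funext u; simp [GradedMonoid.GMul.mul, twistedMul, _root_.mul_add])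
  add_mul a b c := Subtype.ext (by funext u; simp [GradedMonoid.GMul.mul, twistedMul, _root_.add_mul])
  one_mul a := twisted_ext _ _ (zero_add _) (by
    funext u
    change 1 * (a.2 : ℂ → ℂ) (u - (0 : ℕ) * η) = (a.2 : ℂ → ℂ) u
    simp)
  mul_one a := twisted_ext _ _ (add_zero _) (by
    funext u
    change (a.2 : ℂ → ℂ) u * 1 = (a.2 : ℂ → ℂ) u
    simp)
  mul_assoc a b c := twisted_ext _ _ (add_assoc _ _ _) (by
    funext u
    change (a.2 : ℂ → ℂ) u * (b.2 : ℂ → ℂ) (u - a.1 * η) *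
        (c.2 : ℂ → ℂ) (u - ((a.1 + b.1 : ℕ) : ℂ) * η) =
      (a.2 : ℂ → ℂ) u * ((b.2 : ℂ → ℂ) (u - a.1 * η) *
        (c.2 : ℂ → ℂ) (u - a.1 * η - b.1 * η))
    rw [show u - ((a.1 + b.1 : ℕ) : ℂ) * η = u - a.1 * η - b.1 * η by push_cast; ring]
    ring)
  natCast n := ⟨fun _ => n, const_mem τ η n⟩
  natCast_zero := Subtype.ext (by funext u; simp)
  natCast_succ n := Subtype.ext (by funext u; simp [GradedMonoid.GOne.one])

instance instGAlgebra (τ η : ℂ) : DirectSum.GAlgebra ℂ fun α => TwistedTheta τ η α where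
  toFun :=
    { toFun := fun c => ⟨fun _ => c, const_mem τ η c⟩
      map_zero' := rfl
      map_add' := fun _ _ => rfl }
  map_one := rfl
  map_mul r s := twisted_ext _ _ rfl rfl
  commutes r x := twisted_ext _ _ ((zero_add _).trans (add_zero _).symm) (by
    funext u
    change r * (x.2 : ℂ → ℂ) (u - (0 : ℕ) * η) = (x.2 : ℂ → ℂ) u * r
    simp [mul_comm])
  smul_def r x := twisted_ext _ _ (zero_add _).symm (by
    funext u
    change r * (x.2 : ℂ → ℂ) u = r * (x.2 : ℂ → ℂ) (u - (0 : ℕ) * η)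
    simp)

/-- The algebra `⨁_α Θ_{3α, α(α-1)/2 · 3η}(Γ)` with the product `(f * g)(u) = f(u) g(u - αη)`
for `f` of degree `α`. -/
abbrev ThetaAlgebra (τ η : ℂ) : Type := DirectSum ℕ fun α => TwistedTheta τ η α

end EllipticAlgebra

end

noncomputable section

namespace EllipticAlgebra

open Filter Topology

/-! ### Entire functions -/

/-! Write A for the algebra, B for the algebra of theta functions and φ : A → B for x_i ↦ θ_i.
Everything is read off from the complex A → A³ → A³ → A of left multiplications, a ↦ (x_{k+2} a)_k,
then (g_k) ↦ (∑_k M_{kj} g_k)_j, then (d_j) ↦ ∑_j x_j d_j, and from its analogue for B. Here M is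
the matrix of linear forms that encodes the relations.

For B this is function theory. The function θ is compared with an infinite product whose simple
zeros are exactly the lattice points (`isSigma_theta`). Dividing by zeros, with Liouville's theorem
in order zero, gives dim Θ_{n,c} = n for n > 0 (`Theta_finrank`). The θ_i satisfy the relations
because each relation has order six, vanishes at six known points and transforms wrongly under u ↦ u
+ 1/3 (`theta3_relation`). The functions θ_0, θ_1 have no common zero, so they already generate B
from degree one on (`sumMap_shiftMul_surjective`). The matrix M has generic rank two with a known
null vector, which bounds its kernel. Counting dimensions, the complex for B is exact at the second
cube except for at most one extra syzygy, contributing in degree three (`relMap_range_eq`,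
`finrank_relMap_range_one`).

For A the exactness at that place is formal (`exists_relMap_eq`). Lifting syzygies from B to A
therefore shows that ker φ is zero in degrees at most two, at most one-dimensional in degree three,
and generated by its degree three part. The explicit cubic C is central by an identity in the free
algebra and nonzero by a cyclic functional on words. Its image c satisfies θ_i(u) c(u - η) = c(u)
θ_i(u - 3η) for all i, which forces c = 0 because 3η is not a period. Hence ker φ = A C.

For the dimensions, ker φ = A C gives dim A_{m+3} ≤ dim A_m + 3(m + 3), with equality exactly when C
is regular on A_m. The complex for A gives the reverse bound as soon as no nonzero element of A_m is
killed by all generators. This condition and the dimension formula are proved by one induction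
(`eq_zero_of_genMul_eq_zero`, `two_mul_finrank_F`). -/

theorem entire_eventually_ne_zero {g : ℂ → ℂ} (hg : Differentiable ℂ g) (h : ∃ w, g w ≠ 0) (z : ℂ) :
    ∀ᶠ w in 𝓝[≠] z, g w ≠ 0 := by
  rcases (hg.analyticAt z).eventually_eq_zero_or_eventually_ne_zero with h0 | h0
  · obtain ⟨w, hw⟩ := h
    have := AnalyticOnNhd.eqOn_zero_of_preconnected_of_eventuallyEq_zero
      (fun x _ => hg.analyticAt x : AnalyticOnNhd ℂ g Set.univ) isPreconnected_univ
      (Set.mem_univ z) h0 (Set.mem_univ w)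
    exact absurd this hw
  · exact h0

theorem entire_mul_eq_zero {f g : ℂ → ℂ} (hf : Differentiable ℂ f) (hg : Differentiable ℂ g)
    (h : ∀ z, f z * g z = 0) : (∀ z, f z = 0) ∨ ∀ z, g z = 0 := by
  by_contra! hc
  obtain ⟨hc1, hc2⟩ := hc
  obtain ⟨w, hw⟩ := ((entire_eventually_ne_zero hf hc1 0).and
    (entire_eventually_ne_zero hg hc2 0)).exists
  exact mul_ne_zero hw.1 hw.2 (h w)

theorem entire_mul_right_cancel {a b g : ℂ → ℂ} (ha : Differentiable ℂ a) (hb : Differentiable ℂ b)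
    (hg : Differentiable ℂ g) (h0 : ∃ w, g w ≠ 0) (h : ∀ z, a z * g z = b z * g z) (z : ℂ) :
    a z = b z := by
  rcases entire_mul_eq_zero (ha.sub hb) hg (fun z => by simp [sub_mul, h z]) with h | h
  · exact sub_eq_zero.1 (h z)
  · exact absurd (h _) h0.choose_spec

/-- An entire function that is locally divisible by an entire function is divisible by it. -/
theorem entire_div_of_local {f g : ℂ → ℂ} (hg : Differentiable ℂ g) (h0 : ∃ w, g w ≠ 0)
    (hloc : ∀ z, ∃ k : ℂ → ℂ, DifferentiableAt ℂ k z ∧ ∀ᶠ w in 𝓝 z, f w = k w * g w) :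
    ∃ h : ℂ → ℂ, Differentiable ℂ h ∧ ∀ z, f z = h z * g z := by
  choose k hk1 hk2 using hloc
  refine ⟨fun z => k z z, fun z => ?_, fun z => (hk2 z).self_of_nhds⟩
  refine (hk1 z).congr_of_eventuallyEq ?_
  have h1 : ∀ᶠ w in 𝓝[≠] z, k w w = k z w := by
    filter_upwards [entire_eventually_ne_zero hg h0 z, (hk2 z).filter_mono nhdsWithin_le_nhds]
      with w hw1 hw2
    exact mul_right_cancel₀ hw1 ((hk2 w).self_of_nhds.symm.trans hw2)
  rw [eventually_nhdsWithin_iff] at h1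
  filter_upwards [h1] with w hw
  by_cases hwz : w = z
  · rw [hwz]
  · exact hw hwz

/-- Two proportional pairs of entire functions, the first without common zeros. -/
theorem entire_proportional {f₀ f₁ g₀ g₁ : ℂ → ℂ} (hf₀ : Differentiable ℂ f₀)
    (hf₁ : Differentiable ℂ f₁) (hg₀ : Differentiable ℂ g₀) (hg₁ : Differentiable ℂ g₁)
    (hne : ∃ w, f₀ w ≠ 0) (hcop : ∀ z, f₀ z = 0 → f₁ z ≠ 0) (h : ∀ z, g₀ z * f₁ z = g₁ z * f₀ z) :
    ∃ k : ℂ → ℂ, Differentiable ℂ k ∧ (∀ z, g₀ z = k z * f₀ z) ∧ ∀ z, g₁ z = k z * f₁ z := by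
  obtain ⟨k, hk, hk'⟩ := entire_div_of_local (f := g₀) hf₀ hne (fun z => by
    by_cases hz : f₀ z = 0
    · refine ⟨fun w => g₁ w / f₁ w, (hg₁ z).div (hf₁ z) (hcop z hz), ?_⟩
      filter_upwards [(hf₁ z).continuousAt.eventually_ne (hcop z hz)] with w hw
      rw [div_mul_eq_mul_div, ← h w, mul_div_cancel_right₀ _ hw]
    · refine ⟨fun w => g₀ w / f₀ w, (hg₀ z).div (hf₀ z) hz, ?_⟩
      filter_upwards [(hf₀ z).continuousAt.eventually_ne hz] with w hw
      rw [div_mul_cancel₀ _ hw])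
  refine ⟨k, hk, hk', fun z => ?_⟩
  refine entire_mul_right_cancel hg₁ (hk.mul hf₁) hf₀ hne (fun z => ?_) z
  simp only [Pi.mul_apply]
  rw [← h z, hk' z]; ring

/-- At a simple zero of `g` the difference quotients of `f` and `g` are both holomorphic and that of
`g` does not vanish, so their ratio is the local factor required by `entire_div_of_local`. -/
theorem entire_div_sub {f g : ℂ → ℂ} (hf : Differentiable ℂ f) (hg : Differentiable ℂ g) {z : ℂ}
    (hfz : f z = 0) (hgz : g z = 0) (hg' : deriv g z ≠ 0) :
    ∃ k : ℂ → ℂ, DifferentiableAt ℂ k z ∧ ∀ᶠ w in 𝓝 z, f w = k w * g w := by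
  have hd : ∀ {f : ℂ → ℂ}, Differentiable ℂ f → DifferentiableAt ℂ (dslope f z) z := fun hf =>
    ((Complex.differentiableOn_dslope Filter.univ_mem).2 hf.differentiableOn).differentiableAt
      Filter.univ_mem
  have hne : dslope g z z ≠ 0 := by rwa [dslope_same]
  refine ⟨fun w => dslope f z w / dslope g z w, (hd hf).div (hd hg) hne, ?_⟩
  filter_upwards [(hd hg).continuousAt.eventually_ne hne] with w hw
  have e1 := sub_smul_dslope f z w
  have e2 := sub_smul_dslope g z w
  rw [hfz, sub_zero, smul_eq_mul] at e1
  rw [hgz, sub_zero, smul_eq_mul] at e2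
  rw [← e1, ← e2]
  field_simp

/-! ### The exponential `exp (2πiz)` and the lattice -/

/-- `exp (2πiz)`. -/
def expTwoPi (z : ℂ) : ℂ := Complex.exp (2 * Real.pi * Complex.I * z)

theorem expTwoPi_add (z w : ℂ) : expTwoPi (z + w) = expTwoPi z * expTwoPi w := by
  rw [expTwoPi, mul_add, Complex.exp_add]; rfl

theorem expTwoPi_ne_zero (z : ℂ) : expTwoPi z ≠ 0 := Complex.exp_ne_zero _

theorem expTwoPi_zero : expTwoPi 0 = 1 := by simp [expTwoPi]

theorem expTwoPi_neg (z : ℂ) : expTwoPi (-z) = (expTwoPi z)⁻¹ := by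
  rw [expTwoPi, mul_neg, Complex.exp_neg]; rfl

theorem expTwoPi_sub (z w : ℂ) : expTwoPi (z - w) = expTwoPi z / expTwoPi w := by
  rw [sub_eq_add_neg, expTwoPi_add, expTwoPi_neg, div_eq_mul_inv]

theorem expTwoPi_nat_mul (n : ℕ) (z : ℂ) : expTwoPi (n * z) = expTwoPi z ^ n := by
  rw [expTwoPi, expTwoPi, ← Complex.exp_nat_mul]; ring_nf

theorem expTwoPi_eq_one_iff {z : ℂ} : expTwoPi z = 1 ↔ ∃ n : ℤ, z = n := by
  rw [expTwoPi, Complex.exp_eq_one_iff]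
  refine exists_congr fun n => ?_
  rw [mul_comm, mul_left_inj' Complex.two_pi_I_ne_zero]

theorem expTwoPi_int (n : ℤ) : expTwoPi n = 1 := expTwoPi_eq_one_iff.2 ⟨n, rfl⟩

theorem expTwoPi_one : expTwoPi 1 = 1 := by simpa using expTwoPi_int 1

theorem expTwoPi_half : expTwoPi (1 / 2) = -1 := by
  rw [expTwoPi, ← Complex.exp_pi_mul_I]; ring_nf

theorem differentiable_expTwoPi : Differentiable ℂ expTwoPi := by
  unfold expTwoPi; fun_prop

theorem deriv_expTwoPi_zero : HasDerivAt expTwoPi (2 * Real.pi * Complex.I) 0 := by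
  have := ((hasDerivAt_id (0 : ℂ)).const_mul (2 * Real.pi * Complex.I)).cexp
  simp only [id, mul_zero, Complex.exp_zero, one_mul, mul_one] at this
  exact this

theorem norm_expTwoPi (z : ℂ) : ‖expTwoPi z‖ = Real.exp (-(2 * Real.pi * z.im)) := by
  rw [expTwoPi, Complex.norm_exp]; congr 1; simp

/-- Membership in the lattice `ℤ + ℤ τ`. -/
def IsPeriod (τ z : ℂ) : Prop := ∃ a b : ℤ, z = a + b * τ

theorem IsPeriod.neg {τ z : ℂ} (hz : IsPeriod τ z) : IsPeriod τ (-z) := by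
  obtain ⟨a, b, rfl⟩ := hz
  exact ⟨-a, -b, by push_cast; ring⟩

/-- A property stable under translation by `1` and `τ` holds at all periods if it holds at `0`. -/
theorem IsPeriod.induction {τ : ℂ} {p : ℂ → Prop} (h0 : p 0) (h1 : ∀ z, p (z + 1) ↔ p z)
    (hτ : ∀ z, p (z + τ) ↔ p z) {z : ℂ} (hz : IsPeriod τ z) : p z := by
  obtain ⟨a, b, rfl⟩ := hz
  have ha : ∀ a : ℤ, p (a : ℂ) := fun a => by
    induction a using Int.induction_on with
    | zero => simpa using h0
    | succ n ih => simpa using (h1 _).2 ih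
    | pred n ih =>
      refine (h1 _).1 ?_
      have e : (((-(n : ℤ) - 1 : ℤ) : ℂ) + 1) = ((-(n : ℤ) : ℤ) : ℂ) := by push_cast; ring
      rwa [e]
  induction b using Int.induction_on with
  | zero => simpa using ha a
  | succ n ih =>
    have e : (a : ℂ) + (((n : ℤ) + 1 : ℤ) : ℂ) * τ = a + ((n : ℤ) : ℂ) * τ + τ := by
      push_cast; ring
    rw [e]; exact (hτ _).2 ih
  | pred n ih =>
    refine (hτ _).1 ?_
    have e : (a : ℂ) + ((-(n : ℤ) - 1 : ℤ) : ℂ) * τ + τ = a + ((-(n : ℤ) : ℤ) : ℂ) * τ := by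
      push_cast; ring
    rwa [e]

/-! ### The spaces `Θ_{n,c}` -/

theorem mem_Theta_iff {τ c : ℂ} {n : ℕ} {f : ℂ → ℂ} :
    f ∈ Theta τ n c ↔ Differentiable ℂ f ∧ (∀ z, f (z + 1) = f z) ∧
      ∀ z, f (z + τ) = (-1) ^ n * expTwoPi (c - n * z) * f z := by
  have e : ∀ z, Complex.exp (-(2 * Real.pi * Complex.I * (n * z - c))) = expTwoPi (c - n * z) :=
    fun z => by rw [expTwoPi]; ring_nf
  simp only [← e]; rfl

theorem Theta_mul_mem {τ c d : ℂ} {n m : ℕ} {f g : ℂ → ℂ} (hf : f ∈ Theta τ n c)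
    (hg : g ∈ Theta τ m d) : (fun z => f z * g z) ∈ Theta τ (n + m) (c + d) := by
  rw [mem_Theta_iff] at *
  obtain ⟨hf0, hf1, hf2⟩ := hf
  obtain ⟨hg0, hg1, hg2⟩ := hg
  refine ⟨hf0.mul hg0, fun z => by simp only [hf1, hg1], fun z => ?_⟩
  simp only [hf2, hg2]
  rw [show c + d - ((n + m : ℕ) : ℂ) * z = (c - n * z) + (d - m * z) by push_cast; ring,
    expTwoPi_add, pow_add]
  ring

theorem Theta_comp_sub_mem {τ c : ℂ} {n : ℕ} {f : ℂ → ℂ} (hf : f ∈ Theta τ n c) (a : ℂ) :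
    (fun z => f (z - a)) ∈ Theta τ n (c + n * a) := by
  rw [mem_Theta_iff] at *
  obtain ⟨hf0, hf1, hf2⟩ := hf
  refine ⟨hf0.comp (differentiable_id.sub_const a), fun z => ?_, fun z => ?_⟩
  · rw [show z + 1 - a = z - a + 1 by ring, hf1]
  · rw [show z + τ - a = z - a + τ by ring, hf2]; ring_nf

/-- A quotient of theta functions that is entire is a theta function. -/
theorem Theta_of_mul_mem {τ c d : ℂ} {n m : ℕ} {h g : ℂ → ℂ} (hh : Differentiable ℂ h)
    (hg : g ∈ Theta τ m d) (h0 : ∃ w, g w ≠ 0) (hf : (fun z => h z * g z) ∈ Theta τ (n + m) (c + d)) :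
    h ∈ Theta τ n c := by
  rw [mem_Theta_iff] at *
  obtain ⟨hf0, hf1, hf2⟩ := hf
  obtain ⟨hg0, hg1, hg2⟩ := hg
  have hadd : ∀ a : ℂ, Differentiable ℂ fun z => h (z + a) := fun a =>
    hh.comp (differentiable_id.add_const a)
  refine ⟨hh, fun z => ?_, fun z => ?_⟩
  · refine entire_mul_right_cancel (hadd 1) hh hg0 h0 (fun z => ?_) z
    rw [← hf1, hg1]
  · refine entire_mul_right_cancel (hadd τ) (b := fun z => (-1) ^ n * expTwoPi (c - n * z) * h z) ?_
      hg0 h0 (fun z => ?_) z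
    · exact ((differentiable_const _).mul (differentiable_expTwoPi.comp (by fun_prop))).mul hh
    · have := hf2 z
      rw [hg2, show c + d - ((n + m : ℕ) : ℂ) * z = (c - n * z) + (d - m * z) by push_cast; ring,
        expTwoPi_add, pow_add] at this
      have hne : (-1 : ℂ) ^ m * expTwoPi (d - m * z) ≠ 0 :=
        mul_ne_zero (pow_ne_zero _ (by norm_num)) (expTwoPi_ne_zero _)
      refine mul_left_cancel₀ hne ?_
      linear_combination this

theorem Theta_congr {τ c c' : ℂ} {n : ℕ} (h : c = c') {f : ℂ → ℂ} (hf : f ∈ Theta τ n c) :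
    f ∈ Theta τ n c' := h ▸ hf

/-- The vanishing of a theta function depends only on the point modulo the lattice. -/
theorem Theta_eq_zero_of_isPeriod {τ c : ℂ} {n : ℕ} {f : ℂ → ℂ} (hf : f ∈ Theta τ n c) {z w : ℂ}
    (hz : f z = 0) (hw : IsPeriod τ (w - z)) : f w = 0 := by
  rw [mem_Theta_iff] at hf
  obtain ⟨hf0, hf1, hf2⟩ := hf
  have := IsPeriod.induction (τ := τ) (p := fun x => f (z + x) = 0) (by simpa using hz)
    (fun x => by rw [← add_assoc, hf1])
    (fun x => by
      rw [← add_assoc, hf2, mul_eq_zero, or_iff_right]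
      exact mul_ne_zero (pow_ne_zero _ (by norm_num)) (expTwoPi_ne_zero _)) hw
  simpa using this

/-! ### A product with prescribed zeros -/

/-- The product `∏_{n ≥ 0} (1 - Q^n w)`. -/
def qProduct (Q w : ℂ) : ℂ := ∏' n : ℕ, (1 + -(Q ^ n * w))

theorem summable_qProduct {Q : ℂ} (hQ : ‖Q‖ < 1) (w : ℂ) :
    Summable fun n : ℕ => ‖-(Q ^ n * w)‖ := by
  simp only [norm_neg, norm_mul, norm_pow]
  exact (summable_geometric_of_lt_one (norm_nonneg _) hQ).mul_right _

theorem differentiable_qProduct {Q : ℂ} (hQ : ‖Q‖ < 1) : Differentiable ℂ (qProduct Q) := by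
  intro w
  have h := Summable.hasProdLocallyUniformlyOn_nat_one_add
    (f := fun (n : ℕ) (w : ℂ) => -(Q ^ n * w)) (K := Metric.ball (0 : ℂ) (‖w‖ + 1))
    Metric.isOpen_ball ((summable_geometric_of_lt_one (norm_nonneg Q) hQ).mul_right (‖w‖ + 1))
    (Eventually.of_forall fun n x hx => by
      rw [norm_neg, norm_mul, norm_pow]
      rw [Metric.mem_ball, dist_zero_right] at hx
      gcongr)
    (fun n => by fun_prop)
  refine (h.differentiableOn (Eventually.of_forall fun s => ?_) Metric.isOpen_ball).differentiableAt
    (Metric.isOpen_ball.mem_nhds (by simp))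
  simpa [Finset.prod_fn] using DifferentiableOn.finsetProd (fun _ _ => by fun_prop)

theorem qProduct_eq {Q : ℂ} (hQ : ‖Q‖ < 1) (w : ℂ) :
    qProduct Q w = (1 - w) * qProduct Q (Q * w) := by
  have hm := multipliable_one_add_of_summable (summable_qProduct hQ (Q * w))
  have e : ∀ n : ℕ, 1 + -(Q ^ n * (Q * w)) = 1 + -(Q ^ (n + 1) * w) := fun n => by ring
  simp only [e] at hm
  rw [qProduct, qProduct, tprod_eq_zero_mul' (f := fun n => 1 + -(Q ^ n * w)) hm]
  simp only [e]
  ring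

theorem qProduct_eq_zero {Q : ℂ} (hQ : ‖Q‖ < 1) {w : ℂ} (h : qProduct Q w = 0) :
    ∃ n : ℕ, Q ^ n * w = 1 := by
  by_contra! hc
  refine tprod_one_add_ne_zero_of_summable (f := fun n : ℕ => -(Q ^ n * w)) (fun n h0 => hc n ?_)
    (summable_qProduct hQ w) h
  linear_combination -h0

/-- An entire function with the quasi-periodicity of `θ` and with simple zeros exactly at the
periods. -/
structure IsSigma (τ : ℂ) (S : ℂ → ℂ) : Prop where
  mem : S ∈ Theta τ 1 0
  isPeriod : ∀ z, S z = 0 → IsPeriod τ z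
  zero : S 0 = 0
  deriv : deriv S 0 ≠ 0

/-- The function is ∏_{n≥0} (1 - Qⁿw)(1 - Qⁿ⁺¹w⁻¹) with w = e^{2πiz} and Q = e^{2πiτ}. Its zeros are
visible factor by factor, and the zero at 0 is simple because only the factor 1 - w vanishes there.
Comparing θ with it later avoids the Jacobi triple product. -/
theorem exists_isSigma {τ : ℂ} (hτ : 0 < τ.im) : ∃ S, IsSigma τ S := by
  set Q := expTwoPi τ with hQdef
  have hQ : ‖Q‖ < 1 := by
    rw [hQdef, norm_expTwoPi, Real.exp_lt_one_iff]
    have := Real.pi_pos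
    have : 0 < 2 * Real.pi * τ.im := by positivity
    linarith
  have hdiff := differentiable_qProduct hQ
  have hneg : Differentiable ℂ fun z => expTwoPi (-z) :=
    differentiable_expTwoPi.comp differentiable_neg
  set G : ℂ → ℂ := fun z => qProduct Q (Q * expTwoPi z) * qProduct Q (Q * expTwoPi (-z)) with hG
  have hGd : Differentiable ℂ G :=
    (hdiff.comp (differentiable_expTwoPi.const_mul Q)).mul (hdiff.comp (hneg.const_mul Q))
  have hS : ∀ z, qProduct Q (expTwoPi z) * qProduct Q (Q * expTwoPi (-z)) =
      (1 - expTwoPi z) * G z := fun z => by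
    rw [qProduct_eq hQ (expTwoPi z), hG]; ring
  have h1 : qProduct Q 1 = 0 := by rw [qProduct_eq hQ]; simp
  have hper : ∀ (n : ℕ) (z : ℂ), Q ^ n * expTwoPi z = 1 → ∃ a : ℤ, z = a - n * τ := by
    intro n z h
    rw [hQdef, ← expTwoPi_nat_mul, ← expTwoPi_add, expTwoPi_eq_one_iff] at h
    obtain ⟨a, ha⟩ := h
    exact ⟨a, by linear_combination ha⟩
  refine ⟨fun z => qProduct Q (expTwoPi z) * qProduct Q (Q * expTwoPi (-z)), ?_, ?_, ?_, ?_⟩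
  · rw [mem_Theta_iff]
    refine ⟨(hdiff.comp differentiable_expTwoPi).mul (hdiff.comp (hneg.const_mul Q)),
      fun z => ?_, fun z => ?_⟩
    · simp only [neg_add, expTwoPi_add, expTwoPi_one, expTwoPi_neg, mul_one, inv_one]
    · have e : Q * expTwoPi (-(z + τ)) = expTwoPi (-z) := by
        rw [hQdef, ← expTwoPi_add]; ring_nf
      have e' : expTwoPi (z + τ) = Q * expTwoPi z := by rw [expTwoPi_add, mul_comm]
      have e3 : expTwoPi (0 - (1 : ℕ) * z) = expTwoPi (-z) := by congr 1; push_cast; ring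
      simp only [e, e', e3]
      by_cases hz : expTwoPi z = 1
      · simp [expTwoPi_neg, hz, h1]
      · have hz' : 1 - expTwoPi z ≠ 0 := sub_ne_zero.2 (Ne.symm hz)
        rw [qProduct_eq hQ (expTwoPi z), qProduct_eq hQ (expTwoPi (-z)), expTwoPi_neg]
        have := expTwoPi_ne_zero z
        field_simp
        ring
  · intro z hz
    rcases mul_eq_zero.1 hz with hz | hz
    · obtain ⟨n, hn⟩ := qProduct_eq_zero hQ hz
      obtain ⟨a, ha⟩ := hper n z hn
      exact ⟨a, -n, by rw [ha]; push_cast; ring⟩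
    · obtain ⟨n, hn⟩ := qProduct_eq_zero hQ hz
      obtain ⟨a, ha⟩ := hper (n + 1) (-z) (by rw [← hn]; ring)
      exact ⟨-a, n + 1, by push_cast at ha ⊢; linear_combination -ha⟩
  · simp [expTwoPi_zero, h1]
  · have hne : qProduct Q Q ≠ 0 := fun h => by
      obtain ⟨n, hn⟩ := qProduct_eq_zero hQ h
      have : ‖Q ^ (n + 1)‖ < 1 := by
        rw [norm_pow]; exact pow_lt_one₀ (norm_nonneg _) hQ (by simp)
      rw [pow_succ, hn, norm_one] at this
      exact lt_irrefl _ this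
    have hd : HasDerivAt (fun z => (1 - expTwoPi z) * G z)
        (-(2 * Real.pi * Complex.I) * G 0 + (1 - expTwoPi 0) * deriv G 0) 0 :=
      (deriv_expTwoPi_zero.const_sub 1).mul (hGd 0).hasDerivAt
    simp only [hS]
    rw [hd.deriv, expTwoPi_zero, sub_self, zero_mul, add_zero, hG]
    simp only [neg_zero, expTwoPi_zero, mul_one]
    exact mul_ne_zero (neg_ne_zero.2 Complex.two_pi_I_ne_zero) (mul_ne_zero hne hne)

/-! ### Dividing theta functions by their zeros -/

namespace IsSigma

variable {τ : ℂ} {S : ℂ → ℂ}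

theorem eq_zero_iff (hS : IsSigma τ S) {z : ℂ} : S z = 0 ↔ IsPeriod τ z :=
  ⟨hS.isPeriod z, fun h => Theta_eq_zero_of_isPeriod hS.mem hS.zero (by simpa using h)⟩

theorem differentiable (hS : IsSigma τ S) : Differentiable ℂ S := hS.mem.1

theorem exists_ne_zero (hS : IsSigma τ S) : ∃ w, S w ≠ 0 := by
  by_contra! h
  exact hS.deriv (by rw [show S = fun _ => 0 from funext h]; simp)

theorem deriv_ne_zero (hS : IsSigma τ S) {z : ℂ} (hz : S z = 0) : _root_.deriv S z ≠ 0 := by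
  obtain ⟨h0, h1, h2⟩ := mem_Theta_iff.1 hS.mem
  refine (IsPeriod.induction (τ := τ) (p := fun x => S x = 0 ∧ _root_.deriv S x ≠ 0)
    ⟨hS.zero, hS.deriv⟩ (fun x => ?_) (fun x => ?_) (hS.isPeriod z hz)).2
  · rw [← deriv_comp_add_const, funext h1, h1]
  · have hu : expTwoPi (0 - (1 : ℕ) * x) ≠ 0 := expTwoPi_ne_zero _
    have e : ∀ x, S (x + τ) = -expTwoPi (-x) * S x := fun x => by
      rw [h2]; congr 1; simp
    rw [← deriv_comp_add_const, funext e, e]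
    have hd : Differentiable ℂ fun y : ℂ => -expTwoPi (-y) :=
      (differentiable_expTwoPi.comp differentiable_neg).neg
    rw [deriv_fun_mul (hd x) (h0 x)]
    have hne : -expTwoPi (-x) ≠ 0 := neg_ne_zero.2 (expTwoPi_ne_zero _)
    constructor
    · rintro ⟨ha, hb⟩
      have ha := (mul_eq_zero.1 ha).resolve_left hne
      rw [ha, mul_zero, zero_add] at hb
      exact ⟨ha, right_ne_zero_of_mul hb⟩
    · rintro ⟨ha, hb⟩
      rw [ha, mul_zero, mul_zero, zero_add]
      exact ⟨rfl, mul_ne_zero hne hb⟩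

theorem comp_sub_mem (hS : IsSigma τ S) (a : ℂ) : (fun z => S (z - a)) ∈ Theta τ 1 a := by
  simpa using Theta_comp_sub_mem hS.mem a

theorem exists_comp_sub_ne_zero (hS : IsSigma τ S) (a : ℂ) : ∃ w, S (w - a) ≠ 0 := by
  obtain ⟨w, hw⟩ := hS.exists_ne_zero
  exact ⟨w + a, by simpa using hw⟩

/-- A theta function vanishing at `a` is divisible by `S (z - a)`. -/
theorem exists_eq_mul (hS : IsSigma τ S) {n : ℕ} {c a : ℂ} {f : ℂ → ℂ} (hf : f ∈ Theta τ (n + 1) c)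
    (ha : f a = 0) : ∃ h ∈ Theta τ n (c - a), ∀ z, f z = h z * S (z - a) := by
  have hSa := hS.comp_sub_mem a
  obtain ⟨h, hd, hh⟩ := entire_div_of_local (f := f) hSa.1 (hS.exists_comp_sub_ne_zero a) (fun z => by
    by_cases hz : S (z - a) = 0
    · refine entire_div_sub hf.1 hSa.1 (Theta_eq_zero_of_isPeriod hf ha (hS.isPeriod _ hz)) hz ?_
      rw [deriv_comp_sub_const]
      exact hS.deriv_ne_zero hz
    · refine ⟨fun w => f w / S (w - a), (hf.1 z).div (hSa.1 z) hz, ?_⟩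
      filter_upwards [(hSa.1 z).continuousAt.eventually_ne hz] with w hw
      rw [div_mul_cancel₀ _ hw])
  refine ⟨h, Theta_of_mul_mem hd hSa (hS.exists_comp_sub_ne_zero a) ?_, hh⟩
  rw [sub_add_cancel, ← funext hh]
  exact hf

/-- A theta function with prescribed, pairwise incongruent zeros. -/
theorem exists_eq_mul_prod (hS : IsSigma τ S) {m : ℕ} {f : ℂ → ℂ} (n : ℕ) {c : ℂ}
    (hf : f ∈ Theta τ (m + n) c) (a : Fin n → ℂ) (ha : ∀ i, f (a i) = 0)
    (hne : ∀ i j, i ≠ j → ¬ IsPeriod τ (a i - a j)) :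
    ∃ h ∈ Theta τ m (c - ∑ i, a i), ∀ z, f z = h z * ∏ i, S (z - a i) := by
  induction n generalizing f c with
  | zero => exact ⟨f, by simpa using hf, fun z => by simp⟩
  | succ n ih =>
    obtain ⟨g, hg, hfg⟩ := hS.exists_eq_mul hf (ha 0)
    obtain ⟨h, hh, hgh⟩ := ih hg (fun i => a i.succ) (fun i => by
      have := ha i.succ
      rw [hfg] at this
      refine (mul_eq_zero.1 this).resolve_right fun h0 => ?_
      exact hne i.succ 0 (Fin.succ_ne_zero i) (hS.isPeriod _ h0))
      (fun i j hij => hne _ _ fun h => hij (Fin.succ_injective _ h))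
    refine ⟨h, Theta_congr (by rw [Fin.sum_univ_succ]; ring) hh, fun z => ?_⟩
    rw [hfg, hgh, Fin.prod_univ_succ]; ring

end IsSigma

/-! ### Theta functions of order zero -/

/-- A nonzero theta function of order zero is an exponential. -/
theorem Theta_zero_eq {τ c : ℂ} (hτ : 0 < τ.im) {f : ℂ → ℂ} (hf : f ∈ Theta τ 0 c)
    (h0 : ∃ w, f w ≠ 0) : ∃ k : ℤ, expTwoPi (c - k * τ) = 1 ∧ ∀ z, f z = f 0 * expTwoPi (k * z) := by
  obtain ⟨hd, h1, h2⟩ := mem_Theta_iff.1 hf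
  simp only [pow_zero, Nat.cast_zero, zero_mul, sub_zero, one_mul] at h2
  -- With this real `t`, the factor e^{-2πitz} leaves the multiplier of `f` under z ↦ z + τ with
  -- absolute value one and does not change absolute values under z ↦ z + 1. Then |g| is doubly
  -- periodic, hence bounded, and Liouville applies. Periodicity of `f` itself finally makes `t` an
  -- integer.
  set t : ℝ := c.im / τ.im with ht
  set g : ℂ → ℂ := fun z => f z * expTwoPi (-(t * z)) with hg
  have hed : Differentiable ℂ fun z : ℂ => expTwoPi (-(t * z)) :=
    differentiable_expTwoPi.comp (by fun_prop)
  have hgd : Differentiable ℂ g := hd.mul hed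
  have hg1 : ∀ z, ‖g (z + 1)‖ = ‖g z‖ := fun z => by
    simp only [hg, h1, norm_mul, norm_expTwoPi]
    simp
  have hg2 : ∀ z, ‖g (z + τ)‖ = ‖g z‖ := fun z => by
    simp only [hg, h2, norm_mul, norm_expTwoPi]
    rw [mul_assoc, mul_left_comm, ← Real.exp_add]
    congr 2
    have : t * τ.im = c.im := by rw [ht]; field_simp
    simp only [Complex.neg_im, Complex.im_ofReal_mul, Complex.add_im]
    linear_combination 2 * Real.pi * this
  have hbd : ∃ C, ∀ z, ‖g z‖ ≤ C := by
    have hK : IsCompact ((fun x : ℝ × ℝ => (x.1 : ℂ) + x.2 * τ) '' (Set.Icc 0 1 ×ˢ Set.Icc 0 1)) :=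
      (isCompact_Icc.prod isCompact_Icc).image (by fun_prop)
    obtain ⟨C, hC⟩ := hK.exists_bound_of_continuousOn hgd.continuous.continuousOn
    refine ⟨C, fun z => ?_⟩
    set y : ℝ := z.im / τ.im with hy
    set x : ℝ := z.re - y * τ.re with hx
    have hz : z = x + y * τ := by
      apply Complex.ext
      · simp [hx]
      · simp [hy, hτ.ne']
    have key : ∀ γ, IsPeriod τ γ → ‖g (z + γ)‖ = ‖g z‖ := fun γ hγ =>
      IsPeriod.induction (p := fun γ => ‖g (z + γ)‖ = ‖g z‖) (by simp)
        (fun w => by rw [← add_assoc, hg1]) (fun w => by rw [← add_assoc, hg2]) hγ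
    rw [← key (((-⌊x⌋ : ℤ) : ℂ) + ((-⌊y⌋ : ℤ) : ℂ) * τ) ⟨_, _, rfl⟩]
    refine hC _ ⟨(Int.fract x, Int.fract y), ⟨⟨Int.fract_nonneg _, (Int.fract_lt_one _).le⟩,
      ⟨Int.fract_nonneg _, (Int.fract_lt_one _).le⟩⟩, ?_⟩
    simp only [Int.fract]
    rw [hz]; push_cast; ring
  have hconst : ∀ z, g z = g 0 := by
    obtain ⟨C, hC⟩ := hbd
    exact fun z => hgd.apply_eq_apply_of_bounded
      (isBounded_iff_forall_norm_le.2 ⟨C, by rintro _ ⟨z, rfl⟩; exact hC z⟩) z 0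
  have hf' : ∀ z, f z = f 0 * expTwoPi (t * z) := fun z => by
    have := hconst z
    simp only [hg, mul_zero, expTwoPi_zero, inv_one, mul_one, expTwoPi_neg] at this
    rw [← this, inv_mul_cancel_right₀ (expTwoPi_ne_zero _)]
  have hf0 : f 0 ≠ 0 := fun h => by
    obtain ⟨w, hw⟩ := h0
    rw [hf', h, zero_mul] at hw
    exact hw rfl
  have ht1 : expTwoPi t = 1 := by
    have := h1 0
    rw [zero_add, hf' 1, mul_one] at this
    exact mul_left_cancel₀ hf0 (by rw [this, mul_one])
  obtain ⟨k, hk⟩ := expTwoPi_eq_one_iff.1 ht1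
  refine ⟨k, ?_, fun z => by rw [← hk]; exact hf' z⟩
  have := h2 0
  rw [zero_add, hf' τ, mul_comm] at this
  rw [← hk, expTwoPi_sub, ← mul_right_cancel₀ hf0 this, div_self (expTwoPi_ne_zero _)]

theorem Theta_zero_eq_zero {τ c : ℂ} (hτ : 0 < τ.im) (hc : ¬ IsPeriod τ c) {f : ℂ → ℂ}
    (hf : f ∈ Theta τ 0 c) (z : ℂ) : f z = 0 := by
  by_contra h
  obtain ⟨k, hk, -⟩ := Theta_zero_eq hτ hf ⟨z, h⟩
  obtain ⟨n, hn⟩ := expTwoPi_eq_one_iff.1 hk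
  exact hc ⟨n, k, by linear_combination hn⟩

theorem Theta_zero_int_eq_const {τ : ℂ} (hτ : 0 < τ.im) {m : ℤ} {f : ℂ → ℂ}
    (hf : f ∈ Theta τ 0 m) (z : ℂ) : f z = f 0 := by
  by_cases h0 : ∃ w, f w ≠ 0
  · obtain ⟨k, hk, hfz⟩ := Theta_zero_eq hτ hf h0
    obtain ⟨n, hn⟩ := expTwoPi_eq_one_iff.1 hk
    have him := congrArg Complex.im hn
    simp [hτ.ne'] at him
    rw [hfz, him]
    simp [expTwoPi_zero]
  · push Not at h0
    rw [h0, h0]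

/-! ### The function `θ` -/

theorem theta_eq_jacobiTheta₂ (τ z : ℂ) : theta τ z = jacobiTheta₂ (z + 1 / 2 - τ / 2) τ := by
  refine tsum_congr fun a => ?_
  have h : (-1 : ℂ) ^ a = Complex.exp (Real.pi * Complex.I * a) := by
    rw [← Complex.exp_pi_mul_I, ← Complex.exp_int_mul]; ring_nf
  rw [jacobiTheta₂_term, h, ← Complex.exp_add]
  congr 1
  ring

theorem theta_neg (τ z : ℂ) : theta τ (-z) = -(expTwoPi (-z) * theta τ z) := by
  rw [theta_eq_jacobiTheta₂, theta_eq_jacobiTheta₂, ← jacobiTheta₂_neg_left,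
    show -(-z + 1 / 2 - τ / 2) = (z - 1 / 2 - τ / 2) + τ by ring, jacobiTheta₂_add_left',
    show z + 1 / 2 - τ / 2 = (z - 1 / 2 - τ / 2) + 1 by ring, jacobiTheta₂_add_left]
  have e : Complex.exp (-Real.pi * Complex.I * (τ + 2 * (z - 1 / 2 - τ / 2))) =
      expTwoPi (1 / 2) * expTwoPi (-z) := by
    rw [← expTwoPi_add, expTwoPi]; ring_nf
  rw [e, expTwoPi_half]; ring

theorem theta_mem {τ : ℂ} (hτ : 0 < τ.im) : theta τ ∈ Theta τ 1 0 := by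
  rw [mem_Theta_iff]
  refine ⟨fun z => ?_, fun z => ?_, fun z => ?_⟩
  · rw [show theta τ = fun z => jacobiTheta₂ (z + 1 / 2 - τ / 2) τ from
      funext (theta_eq_jacobiTheta₂ τ)]
    exact (differentiableAt_jacobiTheta₂_fst (z + 1 / 2 - τ / 2) hτ).comp z
      (f := fun z => z + 1 / 2 - τ / 2) (by fun_prop)
  · rw [theta_eq_jacobiTheta₂, theta_eq_jacobiTheta₂,
      show z + 1 + 1 / 2 - τ / 2 = z + 1 / 2 - τ / 2 + 1 by ring, jacobiTheta₂_add_left]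
  · rw [theta_eq_jacobiTheta₂, theta_eq_jacobiTheta₂,
      show z + τ + 1 / 2 - τ / 2 = z + 1 / 2 - τ / 2 + τ by ring, jacobiTheta₂_add_left']
    have e : Complex.exp (-Real.pi * Complex.I * (τ + 2 * (z + 1 / 2 - τ / 2))) =
        (expTwoPi (1 / 2))⁻¹ * expTwoPi (0 - (1 : ℕ) * z) := by
      rw [← expTwoPi_neg, ← expTwoPi_add, expTwoPi]; push_cast; ring_nf
    rw [e, expTwoPi_half]; norm_num

/-- The series is a Fourier series whose constant coefficient is 1, so integrating over [0, 1] rules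
out vanishing everywhere. -/
theorem exists_jacobiTheta₂_ne_zero {τ : ℂ} (hτ : 0 < τ.im) : ∃ z, jacobiTheta₂ z τ ≠ 0 := by
  by_contra! h
  have hnorm : ∀ (n : ℤ) (x : ℝ), ‖jacobiTheta₂_term n x τ‖ = Real.exp (-Real.pi * n ^ 2 * τ.im) :=
    fun n x => by rw [norm_jacobiTheta₂_term]; simp
  have hsum : Summable fun n : ℤ => Real.exp (-Real.pi * n ^ 2 * τ.im) := by
    have := ((summable_jacobiTheta₂_term_iff 0 τ).2 hτ).norm
    simp only [norm_jacobiTheta₂_term] at this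
    simpa using this
  have hint := intervalIntegral.hasSum_integral_of_dominated_convergence (a := (0 : ℝ)) (b := 1)
    (μ := MeasureTheory.volume) (F := fun (n : ℤ) (x : ℝ) => jacobiTheta₂_term n x τ)
    (f := fun _ => (0 : ℂ)) (fun n _ => Real.exp (-Real.pi * n ^ 2 * τ.im))
    (fun n => by unfold jacobiTheta₂_term; fun_prop)
    (fun n => Eventually.of_forall fun x _ => (hnorm n x).le)
    (Eventually.of_forall fun x _ => hsum)
    (by simp)
    (Eventually.of_forall fun x _ => by
      simpa [h] using hasSum_jacobiTheta₂_term (x : ℂ) hτ)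
  have hterm : ∀ n : ℤ, ∫ x in (0 : ℝ)..1, jacobiTheta₂_term n x τ = if n = 0 then 1 else 0 := by
    intro n
    split_ifs with hn
    · simp [hn, jacobiTheta₂_term]
    · have hc : (2 * Real.pi * Complex.I * n : ℂ) ≠ 0 :=
        mul_ne_zero Complex.two_pi_I_ne_zero (by exact_mod_cast hn)
      simp only [jacobiTheta₂_term, Complex.exp_add]
      rw [intervalIntegral.integral_mul_const, integral_exp_mul_complex hc]
      have : Complex.exp (2 * Real.pi * Complex.I * n) = 1 := expTwoPi_int n
      simp [this]
  simp only [hterm, intervalIntegral.integral_zero] at hint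
  exact one_ne_zero ((hasSum_ite_eq (0 : ℤ) (1 : ℂ)).unique hint)

theorem exists_theta_ne_zero {τ : ℂ} (hτ : 0 < τ.im) : ∃ z, theta τ z ≠ 0 := by
  obtain ⟨z, hz⟩ := exists_jacobiTheta₂_ne_zero hτ
  exact ⟨z - 1 / 2 + τ / 2, by
    rwa [theta_eq_jacobiTheta₂, show z - 1 / 2 + τ / 2 + 1 / 2 - τ / 2 = z by ring]⟩

theorem theta_zero (τ : ℂ) : theta τ 0 = 0 := by
  have := theta_neg τ 0
  rw [neg_zero, expTwoPi_zero, one_mul] at this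
  exact self_eq_neg.1 this

/-- θ vanishes at 0 by the reflection formula and has the same multipliers as the product `S`, so
θ/S is entire of order zero with trivial multiplier, hence a nonzero constant. The zeros of `S` are
then those of θ. -/
theorem isSigma_theta {τ : ℂ} (hτ : 0 < τ.im) : IsSigma τ (theta τ) := by
  obtain ⟨S, hS⟩ := exists_isSigma hτ
  obtain ⟨h, hh, hθ⟩ := hS.exists_eq_mul (n := 0) (theta_mem hτ) (theta_zero τ)
  have hc : ∀ z, theta τ z = h 0 * S z := fun z => by
    have hh' : h ∈ Theta τ 0 ((0 : ℤ) : ℂ) := Theta_congr (by simp) hh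
    rw [hθ, Theta_zero_int_eq_const hτ hh', sub_zero]
  have h0 : h 0 ≠ 0 := fun h0 => by
    obtain ⟨z, hz⟩ := exists_theta_ne_zero hτ
    rw [hc, h0, zero_mul] at hz
    exact hz rfl
  refine ⟨theta_mem hτ, fun z hz => ?_, theta_zero τ, ?_⟩
  · rw [hc] at hz
    exact hS.isPeriod z ((mul_eq_zero.1 hz).resolve_left h0)
  · rw [funext hc, deriv_const_mul _ (hS.differentiable 0)]
    exact mul_ne_zero h0 hS.deriv

/-! ### Dimensions -/

theorem theta_pow_mem {τ : ℂ} (hτ : 0 < τ.im) (n : ℕ) : (fun z => theta τ z ^ n) ∈ Theta τ n 0 := by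
  induction n with
  | zero => rw [mem_Theta_iff]; simp [expTwoPi_zero]
  | succ n ih => simpa [pow_succ] using Theta_mul_mem ih (theta_mem hτ)

/-- Evaluation at a point z₀ where some theta function of order n + 1 does not vanish splits off one
dimension, and the functions vanishing at z₀ are θ(z - z₀) times those of order n. In order one, z₀
is chosen off the zeros of θ(z - c). The quotient then has order zero with multiplier c - z₀ outside
the lattice, so it is zero. -/
theorem Theta_finite_finrank {τ : ℂ} (hτ : 0 < τ.im) (n : ℕ) (c : ℂ) :
    Module.Finite ℂ (Theta τ (n + 1) c) ∧ Module.finrank ℂ (Theta τ (n + 1) c) = n + 1 := by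
  have hσ := isSigma_theta hτ
  induction n generalizing c with
  | zero =>
    have hne := hσ.exists_comp_sub_ne_zero c
    have hmem := hσ.comp_sub_mem c
    have hbij : Function.Bijective
        (LinearMap.toSpanSingleton ℂ (Theta τ (0 + 1) c) ⟨_, hmem⟩) := by
      constructor
      · rw [injective_iff_map_eq_zero]
        intro a ha
        obtain ⟨w, hw⟩ := hne
        have := congrFun (congrArg Subtype.val ha) w
        simpa [hw] using this
      · rintro ⟨f, hf⟩
        obtain ⟨z₀, hz₀⟩ := hne
        have hc : ¬ IsPeriod τ (c - z₀) := fun h => hz₀ (hσ.eq_zero_iff.2 (by simpa using h.neg))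
        refine ⟨f z₀ / theta τ (z₀ - c), Subtype.ext (funext fun z => ?_)⟩
        set t := f z₀ / theta τ (z₀ - c) with ht
        have hg : f - t • (fun z => theta τ (z - c)) ∈ Theta τ (0 + 1) c :=
          Submodule.sub_mem _ hf (Submodule.smul_mem _ _ hmem)
        obtain ⟨h, hh, hgh⟩ := hσ.exists_eq_mul (a := z₀) hg (by simp [ht, hz₀])
        have := hgh z
        rw [Theta_zero_eq_zero hτ hc hh z, zero_mul] at this
        simpa using (sub_eq_zero.1 this).symm
    have e := LinearEquiv.ofBijective _ hbij
    exact ⟨Module.Finite.equiv e, by rw [← e.finrank_eq, Module.finrank_self]⟩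
  | succ n ih =>
    have hf₀ : (fun z => theta τ z ^ (n + 1) * theta τ (z - c)) ∈ Theta τ (n + 1 + 1) c := by
      simpa using Theta_mul_mem (theta_pow_mem hτ (n + 1)) (hσ.comp_sub_mem c)
    set f₀ : ℂ → ℂ := fun z => theta τ z ^ (n + 1) * theta τ (z - c) with hf₀'
    obtain ⟨z₀, hz₀⟩ : ∃ z, f₀ z ≠ 0 := by
      by_contra! h
      rcases entire_mul_eq_zero (hσ.differentiable.pow (n + 1)) (hσ.comp_sub_mem c).1 h with h | h
      · obtain ⟨w, hw⟩ := hσ.exists_ne_zero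
        exact pow_ne_zero (n + 1) hw (h w)
      · obtain ⟨w, hw⟩ := hσ.exists_comp_sub_ne_zero c
        exact hw (h w)
    have hmem : ∀ h ∈ Theta τ (n + 1) (c - z₀),
        (fun z => h z * theta τ (z - z₀)) ∈ Theta τ (n + 1 + 1) c := fun h hh =>
      Theta_congr (by ring) (Theta_mul_mem hh (hσ.comp_sub_mem z₀))
    let T : Theta τ (n + 1) (c - z₀) × ℂ →ₗ[ℂ] Theta τ (n + 1 + 1) c :=
      { toFun := fun x => ⟨fun z => (x.1 : ℂ → ℂ) z * theta τ (z - z₀) + x.2 * f₀ z,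
          Submodule.add_mem _ (hmem _ x.1.2) (Submodule.smul_mem _ x.2 hf₀)⟩
        map_add' := fun x y => Subtype.ext (funext fun z => by simp; ring)
        map_smul' := fun a x => Subtype.ext (funext fun z => by simp; ring) }
    have hT : ∀ x z, (T x : ℂ → ℂ) z = (x.1 : ℂ → ℂ) z * theta τ (z - z₀) + x.2 * f₀ z :=
      fun _ _ => rfl
    have hbij : Function.Bijective T := by
      constructor
      · rw [injective_iff_map_eq_zero]
        rintro ⟨⟨h, hh⟩, t⟩ h0
        have h0 : ∀ z, h z * theta τ (z - z₀) + t * f₀ z = 0 := fun z => by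
          rw [← hT ⟨⟨h, hh⟩, t⟩, h0]; rfl
        have ht : t = 0 := by
          have := h0 z₀
          rw [sub_self, theta_zero, mul_zero, zero_add] at this
          exact (mul_eq_zero.1 this).resolve_right hz₀
        have hz : ∀ z, h z = 0 := (entire_mul_eq_zero hh.1 (hσ.comp_sub_mem z₀).1
          (fun z => by simpa [ht] using h0 z)).resolve_right fun h => by
            obtain ⟨w, hw⟩ := hσ.exists_comp_sub_ne_zero z₀
            exact hw (h w)
        exact Prod.ext (Subtype.ext (funext hz)) ht
      · rintro ⟨f, hf⟩
        set t := f z₀ / f₀ z₀ with ht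
        have hg : f - t • f₀ ∈ Theta τ (n + 1 + 1) c :=
          Submodule.sub_mem _ hf (Submodule.smul_mem _ _ hf₀)
        obtain ⟨h, hh, hgh⟩ := hσ.exists_eq_mul (a := z₀) hg (by simp [ht, hz₀])
        refine ⟨⟨⟨h, hh⟩, t⟩, Subtype.ext (funext fun z => ?_)⟩
        rw [hT]
        have := hgh z
        simp only [Pi.sub_apply, Pi.smul_apply, smul_eq_mul] at this
        linear_combination -this
    have e := LinearEquiv.ofBijective _ hbij
    obtain ⟨h1, h2⟩ := ih (c - z₀)
    exact ⟨Module.Finite.equiv e, by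
      rw [← e.finrank_eq, Module.finrank_prod, h2, Module.finrank_self]⟩

theorem Theta_finite {τ : ℂ} (hτ : 0 < τ.im) {n : ℕ} (hn : n ≠ 0) (c : ℂ) :
    Module.Finite ℂ (Theta τ n c) := by
  obtain ⟨m, rfl⟩ := Nat.exists_eq_succ_of_ne_zero hn
  exact (Theta_finite_finrank hτ m c).1

theorem Theta_finrank {τ : ℂ} (hτ : 0 < τ.im) {n : ℕ} (hn : n ≠ 0) (c : ℂ) :
    Module.finrank ℂ (Theta τ n c) = n := by
  obtain ⟨m, rfl⟩ := Nat.exists_eq_succ_of_ne_zero hn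
  exact (Theta_finite_finrank hτ m c).2

/-- Theta functions of order zero and integral multiplier are the constants. -/
def thetaZeroEquiv {τ : ℂ} (hτ : 0 < τ.im) {c : ℂ} (hc : c = 0) : Theta τ 0 c ≃ₗ[ℂ] ℂ where
  toFun f := (f : ℂ → ℂ) 0
  map_add' _ _ := rfl
  map_smul' _ _ := rfl
  invFun a := ⟨fun _ => a, by rw [mem_Theta_iff]; simp [hc, expTwoPi_zero]⟩
  left_inv f := Subtype.ext (funext fun z =>
    (Theta_zero_int_eq_const hτ (m := 0) (Theta_congr (by simpa using hc) f.2) z).symm)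
  right_inv _ := rfl

/-! ### Theta functions of order three -/

theorem sum_zmod_three {M : Type*} [AddCommMonoid M] (f : ZMod 3 → M) :
    ∑ i, f i = f 0 + f 1 + f 2 := Fin.sum_univ_three f

theorem forall_zmod_three {P : ZMod 3 → Prop} (h0 : P 0) (h1 : P 1) (h2 : P 2) (i : ZMod 3) :
    P i := by
  fin_cases i
  exacts [h0, h1, h2]

theorem zeta3_eq : zeta3 = expTwoPi (1 / 3) := by
  rw [zeta3, expTwoPi]; ring_nf

theorem zeta3_pow_three : zeta3 ^ 3 = 1 := by
  rw [zeta3_eq, ← expTwoPi_nat_mul, expTwoPi_eq_one_iff]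
  exact ⟨1, by norm_num⟩

theorem zeta3_ne_one : zeta3 ≠ 1 := by
  rw [zeta3_eq, Ne, expTwoPi_eq_one_iff]
  rintro ⟨n, hn⟩
  have h : (1 : ℂ) = ((3 * n : ℤ) : ℂ) := by push_cast; linear_combination 3 * hn
  have h : 1 = 3 * n := by exact_mod_cast h
  omega

theorem zeta3_ne_zero : zeta3 ≠ 0 := by
  rw [zeta3_eq]; exact expTwoPi_ne_zero _

theorem one_add_zeta3 : 1 + zeta3 + zeta3 ^ 2 = 0 := by
  have h : (zeta3 - 1) * (1 + zeta3 + zeta3 ^ 2) = 0 := by linear_combination zeta3_pow_three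
  exact (mul_eq_zero.1 h).resolve_left (sub_ne_zero.2 zeta3_ne_one)

theorem theta3_eq (τ : ℂ) (i : ZMod 3) (z : ℂ) : theta3 τ i z =
    theta τ (z + (i.val : ℂ) / 3 * τ) * theta τ (z + 1 / 3 + (i.val : ℂ) / 3 * τ) *
      theta τ (z + 2 / 3 + (i.val : ℂ) / 3 * τ) *
      expTwoPi (i.val * z + i.val * (i.val - 3) / 6 * τ + i.val / 6) := rfl

theorem theta3_zero_eq (τ z : ℂ) :
    theta3 τ 0 z = theta τ z * theta τ (z + 1 / 3) * theta τ (z + 2 / 3) := by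
  simp [theta3_eq, expTwoPi_zero]

theorem theta_add_one {τ : ℂ} (hτ : 0 < τ.im) (z : ℂ) : theta τ (z + 1) = theta τ z := (theta_mem hτ).2.1 z

theorem theta_add_tau {τ : ℂ} (hτ : 0 < τ.im) (z : ℂ) : theta τ (z + τ) = -(expTwoPi (-z) * theta τ z) := by
  rw [(mem_Theta_iff.1 (theta_mem hτ)).2.2]; simp

/-- Translations by τ/3 and 1/3 act on the θ_i as a Heisenberg group: the first permutes them
cyclically up to an exponential common to all of them, the second (`theta3_add_third`) is diagonal
with eigenvalues 1, ω, ω². The first reduces statements about all i to i = 0. -/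
theorem theta3_add_tau_div {τ : ℂ} (hτ : 0 < τ.im) (i : ZMod 3) (z : ℂ) :
    theta3 τ i (z + τ / 3) = expTwoPi (-(z - τ / 3 + 1 / 6)) * theta3 τ (i + 1) z := by
  revert i
  refine forall_zmod_three ?_ ?_ ?_
  · rw [theta3_zero_eq, zero_add, theta3_eq, show (1 : ZMod 3).val = 1 from rfl]
    push_cast
    rw [mul_left_comm, ← expTwoPi_add,
      show -(z - τ / 3 + 1 / 6) + (1 * z + 1 * (1 - 3) / 6 * τ + 1 / 6) = 0 by ring,
      expTwoPi_zero]
    ring_nf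
  · rw [theta3_eq, theta3_eq, show (1 : ZMod 3).val = 1 from rfl,
      show ((1 : ZMod 3) + 1).val = 2 from rfl]
    push_cast
    rw [mul_left_comm, ← expTwoPi_add]
    ring_nf
  · rw [theta3_eq, show (2 : ZMod 3) + 1 = 0 from rfl, theta3_zero_eq,
      show (2 : ZMod 3).val = 2 from rfl]
    push_cast
    rw [show z + τ / 3 + 2 / 3 * τ = z + τ by ring,
      show z + τ / 3 + 1 / 3 + 2 / 3 * τ = z + 1 / 3 + τ by ring,
      show z + τ / 3 + 2 / 3 + 2 / 3 * τ = z + 2 / 3 + τ by ring, theta_add_tau hτ,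
      theta_add_tau hτ, theta_add_tau hτ]
    have e : expTwoPi (-(z - τ / 3 + 1 / 6)) = -(expTwoPi (-z) * expTwoPi (-(z + 1 / 3)) *
        expTwoPi (-(z + 2 / 3)) * expTwoPi (2 * (z + τ / 3) + 2 * (2 - 3) / 6 * τ + 2 / 6)) := by
      rw [← expTwoPi_add, ← expTwoPi_add, ← expTwoPi_add, ← neg_one_mul (expTwoPi _),
        ← expTwoPi_half, ← expTwoPi_add]
      ring_nf
    rw [e]; ring

theorem theta3_succ {τ : ℂ} (hτ : 0 < τ.im) (i : ZMod 3) (z : ℂ) :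
    theta3 τ (i + 1) z = expTwoPi (z - τ / 3 + 1 / 6) * theta3 τ i (z + τ / 3) := by
  rw [theta3_add_tau_div hτ, ← mul_assoc, ← expTwoPi_add, add_neg_cancel, expTwoPi_zero, one_mul]

theorem zmod_three_induction {P : ZMod 3 → Prop} (h0 : P 0) (h : ∀ i, P i → P (i + 1)) (i : ZMod 3) :
    P i :=
  forall_zmod_three h0 (h 0 h0) (h 1 (h 0 h0)) i

theorem theta3_mem {τ : ℂ} (hτ : 0 < τ.im) (i : ZMod 3) : theta3 τ i ∈ Theta τ 3 0 := by
  refine zmod_three_induction (P := fun i => theta3 τ i ∈ Theta τ 3 0) ?_ (fun i ih => ?_) i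
  · have hσ := isSigma_theta hτ
    have h := Theta_mul_mem (Theta_mul_mem (theta_mem hτ) (hσ.comp_sub_mem (-(1 / 3))))
      (hσ.comp_sub_mem (-(2 / 3)))
    rw [show theta3 τ 0 = _ from funext (theta3_zero_eq τ)]
    simp only [sub_neg_eq_add] at h
    rw [mem_Theta_iff] at h ⊢
    refine ⟨h.1, h.2.1, fun z => ?_⟩
    rw [h.2.2, show 0 + -(1 / 3) + -(2 / 3) - ((1 + 1 + 1 : ℕ) : ℂ) * z =
      (0 - ((3 : ℕ) : ℂ) * z) + ((-1 : ℤ) : ℂ) by push_cast; ring, expTwoPi_add, expTwoPi_int,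
      mul_one]
  · have h1 := Theta_comp_sub_mem ih (-(τ / 3))
    have h2 : (fun z => expTwoPi (z - τ / 3 + 1 / 6)) ∈ Theta τ 0 τ := by
      rw [mem_Theta_iff]
      refine ⟨differentiable_expTwoPi.comp (by fun_prop), fun z => ?_, fun z => ?_⟩
      · rw [show z + 1 - τ / 3 + 1 / 6 = z - τ / 3 + 1 / 6 + 1 by ring, expTwoPi_add,
          expTwoPi_one, mul_one]
      · rw [pow_zero, one_mul, ← expTwoPi_add]; congr 1; push_cast; ring
    have h3 := Theta_mul_mem h2 h1
    simp only [sub_neg_eq_add] at h3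
    rw [show theta3 τ (i + 1) = _ from funext (theta3_succ hτ i)]
    have e : τ + (0 + ((3 : ℕ) : ℂ) * -(τ / 3)) = 0 := by push_cast; ring
    rw [e] at h3
    exact h3

theorem theta3_add_third {τ : ℂ} (hτ : 0 < τ.im) (i : ZMod 3) (z : ℂ) :
    theta3 τ i (z + 1 / 3) = zeta3 ^ i.val * theta3 τ i z := by
  rw [theta3_eq, theta3_eq, zeta3_eq, ← expTwoPi_nat_mul,
    show z + 1 / 3 + 2 / 3 + (i.val : ℂ) / 3 * τ = z + (i.val : ℂ) / 3 * τ + 1 by ring,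
    theta_add_one hτ,
    show (i.val : ℂ) * (z + 1 / 3) + i.val * (i.val - 3) / 6 * τ + i.val / 6 =
      i.val * (1 / 3) + (i.val * z + i.val * (i.val - 3) / 6 * τ + i.val / 6) by ring,
    expTwoPi_add, show z + 1 / 3 + 1 / 3 + (i.val : ℂ) / 3 * τ = z + 2 / 3 + i.val / 3 * τ by ring]
  ring

theorem theta3_zero_neg {τ : ℂ} (hτ : 0 < τ.im) (z : ℂ) : theta3 τ 0 (-z) = -(expTwoPi (-(3 * z)) * theta3 τ 0 z) := by
  rw [theta3_zero_eq, theta3_zero_eq, show -z + 1 / 3 = -(z - 1 / 3) by ring,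
    show -z + 2 / 3 = -(z - 2 / 3) by ring, theta_neg, theta_neg, theta_neg,
    ← theta_add_one hτ (z - 1 / 3), ← theta_add_one hτ (z - 2 / 3),
    show z - 1 / 3 + 1 = z + 2 / 3 by ring, show z - 2 / 3 + 1 = z + 1 / 3 by ring]
  have e : expTwoPi (-(3 * z)) = expTwoPi (-z) * expTwoPi (-(z - 1 / 3)) *
      expTwoPi (-(z - 2 / 3)) := by
    rw [← expTwoPi_add, ← expTwoPi_add, show -z + -(z - 1 / 3) + -(z - 2 / 3) = -(3 * z) + 1 by ring,
      expTwoPi_add, expTwoPi_one, mul_one]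
  rw [e]; ring

theorem theta3_one_neg {τ : ℂ} (hτ : 0 < τ.im) (z : ℂ) :
    theta3 τ 1 (-z) = -(zeta3 * expTwoPi (-(3 * z)) * theta3 τ 2 z) := by
  have h1 := theta3_succ hτ 0 (-z)
  have h2 := theta3_succ hτ 2 (z - τ / 3)
  have h3 := theta3_zero_neg hτ (z - τ / 3)
  rw [zero_add] at h1
  rw [show (2 : ZMod 3) + 1 = 0 from rfl, sub_add_cancel] at h2
  rw [h1, show -z + τ / 3 = -(z - τ / 3) by ring, h3, h2]
  have e : zeta3 * expTwoPi (-(3 * z)) = expTwoPi (-z - τ / 3 + 1 / 6) *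
      (expTwoPi (-(3 * (z - τ / 3))) * expTwoPi (z - τ / 3 - τ / 3 + 1 / 6)) := by
    rw [zeta3_eq, ← expTwoPi_add, ← expTwoPi_add, ← expTwoPi_add]; ring_nf
  rw [e]; ring

theorem theta3_two_neg {τ : ℂ} (hτ : 0 < τ.im) (z : ℂ) :
    theta3 τ 2 (-z) = -(zeta3 ^ 2 * expTwoPi (-(3 * z)) * theta3 τ 1 z) := by
  have h := theta3_one_neg hτ (-z)
  rw [neg_neg] at h
  have e : expTwoPi (-(3 * z)) * expTwoPi (-(3 * -z)) = 1 := by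
    rw [← expTwoPi_add, show -(3 * z) + -(3 * -z) = 0 by ring, expTwoPi_zero]
  rw [h]
  linear_combination (-theta3 τ 2 (-z)) * zeta3_pow_three - zeta3 ^ 3 * theta3 τ 2 (-z) * e

theorem theta3_eq_zero_iff {τ : ℂ} (hτ : 0 < τ.im) (i : ZMod 3) (z : ℂ) :
    theta3 τ i z = 0 ↔ ∃ a b : ℤ, z + i.val / 3 * τ = a / 3 + b * τ := by
  have hσ := isSigma_theta hτ
  rw [theta3_eq, mul_eq_zero, or_iff_left (expTwoPi_ne_zero _), mul_eq_zero, mul_eq_zero,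
    hσ.eq_zero_iff, hσ.eq_zero_iff, hσ.eq_zero_iff]
  constructor
  · rintro ((⟨a, b, h⟩ | ⟨a, b, h⟩) | ⟨a, b, h⟩)
    · exact ⟨3 * a, b, by push_cast; linear_combination h⟩
    · exact ⟨3 * a - 1, b, by push_cast; linear_combination h⟩
    · exact ⟨3 * a - 2, b, by push_cast; linear_combination h⟩
  · rintro ⟨a, b, h⟩
    obtain ⟨m, rfl | rfl | rfl⟩ : ∃ m, a = 3 * m ∨ a = 3 * m - 1 ∨ a = 3 * m - 2 :=
      ⟨(a + 2) / 3, by omega⟩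
    · exact Or.inl (Or.inl ⟨m, b, by push_cast at h; linear_combination h⟩)
    · exact Or.inl (Or.inr ⟨m, b, by push_cast at h; linear_combination h⟩)
    · exact Or.inr ⟨m, b, by push_cast at h; linear_combination h⟩

theorem theta3_zero_apply_zero (τ : ℂ) : theta3 τ 0 0 = 0 := by
  rw [theta3_zero_eq, theta_zero, zero_mul, zero_mul]

theorem theta3_ne_zero {τ : ℂ} (hτ : 0 < τ.im) {η : ℂ} (hη : ∀ a b : ℤ, 3 * η ≠ (a : ℂ) + (b : ℂ) * τ) (i : ZMod 3) :
    theta3 τ i η ≠ 0 := by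
  rw [Ne, theta3_eq_zero_iff hτ]
  rintro ⟨a, b, h⟩
  exact hη a (3 * b - i.val) (by push_cast; linear_combination 3 * h)

/-- The zeros of θ_0 form ⅓ℤ + ℤτ and those of θ_1 its translate by -τ/3. The pencil of θ_0 and θ_1
is therefore base-point-free. -/
theorem theta3_zero_one_coprime {τ : ℂ} (hτ : 0 < τ.im) {z : ℂ} (h0 : theta3 τ 0 z = 0) : theta3 τ 1 z ≠ 0 := by
  intro h1
  rw [theta3_eq_zero_iff hτ] at h0 h1
  obtain ⟨a, b, h0⟩ := h0
  obtain ⟨c, d, h1⟩ := h1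
  rw [show (1 : ZMod 3).val = 1 from rfl] at h1
  rw [show (0 : ZMod 3).val = 0 from rfl] at h0
  have h := congrArg Complex.im (show τ = (c - a : ℤ) + ((3 * (d - b) : ℤ) : ℝ) * τ by
    push_cast at *; linear_combination 3 * h1 - 3 * h0)
  rw [Complex.add_im, Complex.intCast_im, zero_add, Complex.im_ofReal_mul] at h
  have h : (1 : ℝ) = ((3 * (d - b) : ℤ) : ℝ) := mul_right_cancel₀ hτ.ne' (by linarith)
  have h : 1 = 3 * (d - b) := by exact_mod_cast h
  omega

theorem exists_theta3_ne_zero {τ : ℂ} (hτ : 0 < τ.im) (i : ZMod 3) : ∃ z, theta3 τ i z ≠ 0 := by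
  by_contra! h
  refine zmod_three_induction (P := fun i => ¬ ∀ z, theta3 τ i z = 0) ?_ ?_ i h
  · intro h
    rcases entire_mul_eq_zero (f := fun z => theta τ z * theta τ (z + 1 / 3))
      (g := fun z => theta τ (z + 2 / 3))
      ((theta_mem hτ).1.mul ((theta_mem hτ).1.comp (differentiable_id.add_const _)))
      ((theta_mem hτ).1.comp (differentiable_id.add_const _)) (fun z => (theta3_zero_eq τ z).symm.trans (h z))
      with h | h
    · rcases entire_mul_eq_zero (f := theta τ) (g := fun z => theta τ (z + 1 / 3))
        (theta_mem hτ).1 ((theta_mem hτ).1.comp (differentiable_id.add_const _)) h with h | h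
      · exact (exists_theta_ne_zero hτ).elim fun w hw => hw (h w)
      · exact (exists_theta_ne_zero hτ).elim fun w hw => hw (by simpa using h (w - 1 / 3))
    · exact (exists_theta_ne_zero hτ).elim fun w hw => hw (by simpa using h (w - 2 / 3))
  · intro i hi h
    refine hi fun z => ?_
    have := theta3_add_tau_div hτ i (z - τ / 3)
    rwa [h, mul_zero, sub_add_cancel] at this

/-- The θ_i are eigenvectors of translation by 1/3 with distinct eigenvalues. The combinations below
are the discrete Fourier projections. -/
theorem theta3_linearIndependent {τ : ℂ} (hτ : 0 < τ.im) {c : ZMod 3 → ℂ} (h : ∀ z, ∑ i, c i * theta3 τ i z = 0)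
    (i : ZMod 3) : c i = 0 := by
  have h0 : ∀ z, c 0 * theta3 τ 0 z + c 1 * theta3 τ 1 z + c 2 * theta3 τ 2 z = 0 :=
    fun z => by rw [← h z, sum_zmod_three]
  have h1 : ∀ z, c 0 * theta3 τ 0 z + c 1 * (zeta3 * theta3 τ 1 z) +
      c 2 * (zeta3 ^ 2 * theta3 τ 2 z) = 0 := fun z => by
    have := h0 (z + 1 / 3)
    simp only [theta3_add_third hτ] at this
    simpa [show (1 : ZMod 3).val = 1 from rfl, show (2 : ZMod 3).val = 2 from rfl] using this
  have h2 : ∀ z, c 0 * theta3 τ 0 z + c 1 * (zeta3 ^ 2 * theta3 τ 1 z) +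
      c 2 * (zeta3 * theta3 τ 2 z) = 0 := fun z => by
    have := h1 (z + 1 / 3)
    simp only [theta3_add_third hτ] at this
    simp only [ZMod.val_zero, show (1 : ZMod 3).val = 1 from rfl, show (2 : ZMod 3).val = 2 from rfl]
      at this
    linear_combination this - c 2 * zeta3 * theta3 τ 2 z * zeta3_pow_three
  have hz := one_add_zeta3
  have h3 := zeta3_pow_three
  have key : ∀ i z, c i * theta3 τ i z = 0 := by
    refine forall_zmod_three (fun z => ?_) (fun z => ?_) (fun z => ?_)
    · linear_combination (1 / 3) * (h0 z + h1 z + h2 z) - (1 / 3) *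
        (c 1 * theta3 τ 1 z + c 2 * theta3 τ 2 z) * hz
    · linear_combination (1 / 3) * (h0 z + zeta3 ^ 2 * h1 z + zeta3 * h2 z) - (1 / 3) *
        (c 0 * theta3 τ 0 z + c 2 * theta3 τ 2 z) * hz - (1 / 3) *
        (2 * c 1 * theta3 τ 1 z + c 2 * theta3 τ 2 z * zeta3) * h3
    · linear_combination (1 / 3) * (h0 z + zeta3 * h1 z + zeta3 ^ 2 * h2 z) - (1 / 3) *
        (c 0 * theta3 τ 0 z + c 1 * theta3 τ 1 z) * hz - (1 / 3) *
        (2 * c 2 * theta3 τ 2 z + c 1 * theta3 τ 1 z * zeta3) * h3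
  obtain ⟨z, hz⟩ := exists_theta3_ne_zero hτ i
  exact (mul_eq_zero.1 (key i z)).resolve_right hz

theorem exists_eq_sum_theta3 {τ : ℂ} (hτ : 0 < τ.im) {f : ℂ → ℂ} (hf : f ∈ Theta τ 3 0) :
    ∃ c : ZMod 3 → ℂ, ∀ z, f z = ∑ i, c i * theta3 τ i z := by
  have := Theta_finite hτ (n := 3) (by norm_num) 0
  let T : (ZMod 3 → ℂ) →ₗ[ℂ] Theta τ 3 0 :=
    Fintype.linearCombination ℂ fun i => (⟨theta3 τ i, theta3_mem hτ i⟩ : Theta τ 3 0)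
  have hT : ∀ c z, (T c : ℂ → ℂ) z = ∑ i, c i * theta3 τ i z := fun c z => by
    simp [T, Fintype.linearCombination_apply]
  have hinj : Function.Injective T := by
    rw [injective_iff_map_eq_zero]
    intro c hc
    refine funext (theta3_linearIndependent hτ fun z => ?_)
    rw [← hT, hc]; rfl
  have hsurj := (LinearMap.injective_iff_surjective_of_finrank_eq_finrank (f := T) (by
    rw [Theta_finrank hτ (by norm_num), Module.finrank_fintype_fun_eq_card, ZMod.card])).1 hinj
  obtain ⟨c, hc⟩ := hsurj ⟨f, hf⟩
  exact ⟨c, fun z => by rw [← hT, hc]⟩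

/-! ### The quadratic relations -/

/-- Supplies the pairwise incongruence of the six points 0, -1/3, -2/3, η, η - 1/3, η - 2/3. -/
theorem not_isPeriod_int_mul_add {τ η : ℂ} (hτ : 0 < τ.im)
    (hη : ∀ a b : ℤ, 3 * η ≠ (a : ℂ) + (b : ℂ) * τ) {e k : ℤ}
    (h : e = 0 ∧ ¬ 3 ∣ k ∨ e = 1 ∨ e = -1) : ¬ IsPeriod τ (e * η + k / 3) := by
  rintro ⟨a, b, hab⟩
  rcases h with ⟨rfl, hk⟩ | rfl | rfl
  · have h := congrArg Complex.im (show (((0 : ℤ) : ℂ) * η + k / 3) * 3 =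
      ((3 * a : ℤ) : ℂ) + ((3 * b : ℤ) : ℝ) * τ by rw [hab]; push_cast; ring)
    have e : (((0 : ℤ) : ℂ) * η + k / 3) * 3 = k := by push_cast; ring
    rw [e, Complex.add_im, Complex.intCast_im, Complex.intCast_im, zero_add,
      Complex.im_ofReal_mul] at h
    have hb : ((3 * b : ℤ) : ℝ) = 0 := (mul_eq_zero.1 h.symm).resolve_right hτ.ne'
    have hb : b = 0 := by
      have : 3 * b = 0 := by exact_mod_cast hb
      omega
    have : ((k : ℤ) : ℂ) = ((3 * a : ℤ) : ℂ) := by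
      rw [hb] at hab; push_cast at hab ⊢; linear_combination 3 * hab
    exact hk ⟨a, by exact_mod_cast this⟩
  · exact hη (3 * a - k) (3 * b) (by push_cast at hab ⊢; linear_combination 3 * hab)
  · exact hη (k - 3 * a) (-(3 * b)) (by push_cast at hab ⊢; linear_combination -3 * hab)

theorem paramP_ne_zero {τ η : ℂ} (hτ : 0 < τ.im)
    (hη : ∀ a b : ℤ, 3 * η ≠ (a : ℂ) + (b : ℂ) * τ) : paramP τ η ≠ 0 :=
  neg_ne_zero.2 (div_ne_zero (mul_ne_zero zeta3_ne_zero (theta3_ne_zero hτ hη 0))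
    (theta3_ne_zero hτ hη 2))

theorem paramQ_ne_zero {τ η : ℂ} (hτ : 0 < τ.im)
    (hη : ∀ a b : ℤ, 3 * η ≠ (a : ℂ) + (b : ℂ) * τ) : paramQ τ η ≠ 0 :=
  neg_ne_zero.2 (div_ne_zero (mul_ne_zero (pow_ne_zero 2 zeta3_ne_zero) (theta3_ne_zero hτ hη 1))
    (theta3_ne_zero hτ hη 2))

theorem theta3_mul_shift_mem {τ : ℂ} (hτ : 0 < τ.im) (η : ℂ) (i j : ZMod 3) :
    (fun u => theta3 τ i u * theta3 τ j (u - η)) ∈ Theta τ 6 (3 * η) := by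
  have h := Theta_mul_mem (theta3_mem hτ i) (Theta_comp_sub_mem (theta3_mem hτ j) η)
  have e : 0 + (0 + ((3 : ℕ) : ℂ) * η) = 3 * η := by push_cast; ring
  rw [e] at h
  exact h

/-- The conditions G(η) = 0 and G(0) = 0 are what fix p and then q. Since G(u + 1/3) = ω G(u), there
are six incongruent zeros in all, as many as the order, so G is a constant times θ_0(u) θ_0(u - η).
That product is invariant under u ↦ u + 1/3, so the constant vanishes. -/
theorem theta3_relation_zero {τ η : ℂ} (hτ : 0 < τ.im)
    (hη : ∀ a b : ℤ, 3 * η ≠ (a : ℂ) + (b : ℂ) * τ) (u : ℂ) :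
    theta3 τ 0 u * theta3 τ 1 (u - η) - paramQ τ η * (theta3 τ 1 u * theta3 τ 0 (u - η)) -
      paramP τ η * (theta3 τ 2 u * theta3 τ 2 (u - η)) = 0 := by
  set G : ℂ → ℂ := fun u =>
    theta3 τ 0 u * theta3 τ 1 (u - η) - paramQ τ η * (theta3 τ 1 u * theta3 τ 0 (u - η)) -
      paramP τ η * (theta3 τ 2 u * theta3 τ 2 (u - η)) with hG
  change G u = 0
  have hmem : G ∈ Theta τ (0 + 6) (3 * η) :=
    Submodule.sub_mem _ (Submodule.sub_mem _ (theta3_mul_shift_mem hτ η 0 1)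
      (Submodule.smul_mem _ _ (theta3_mul_shift_mem hτ η 1 0)))
      (Submodule.smul_mem _ _ (theta3_mul_shift_mem hτ η 2 2))
  have h2 := theta3_ne_zero hτ hη 2
  have h3 := zeta3_pow_three
  have hshift : ∀ u, G (u + 1 / 3) = zeta3 * G u := fun u => by
    simp only [hG, show u + 1 / 3 - η = u - η + 1 / 3 by ring, theta3_add_third hτ,
      ZMod.val_zero, show (1 : ZMod 3).val = 1 from rfl, show (2 : ZMod 3).val = 2 from rfl]
    linear_combination -paramP τ η * zeta3 * (theta3 τ 2 u * theta3 τ 2 (u - η)) * h3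
  have hone : theta3 τ 1 0 = -(zeta3 * theta3 τ 2 0) := by
    have := theta3_one_neg hτ 0
    simpa [expTwoPi_zero] using this
  have hG0 : G 0 = 0 := by
    simp only [hG, zero_sub, theta3_zero_apply_zero, theta3_zero_neg hτ, theta3_two_neg hτ, hone,
      paramP, paramQ]
    field_simp
    ring
  have hGη : G η = 0 := by
    simp only [hG, sub_self, theta3_zero_apply_zero, hone, paramP]
    field_simp
    ring
  have hback : ∀ u, G u = 0 → G (u - 1 / 3) = 0 := fun u hu => by
    have := hshift (u - 1 / 3)
    rw [sub_add_cancel, hu] at this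
    exact (mul_eq_zero.1 this.symm).resolve_left zeta3_ne_zero
  -- The i-th zero is `ev i * η + kv i / 3`. Integer coordinates let `decide` check that all
  -- differences are covered by `not_isPeriod_int_mul_add`.
  let ev : Fin 6 → ℤ := ![0, 0, 0, 1, 1, 1]
  let kv : Fin 6 → ℤ := ![0, -1, -2, 0, -1, -2]
  obtain ⟨h, hh, hGh⟩ := (isSigma_theta hτ).exists_eq_mul_prod 6 hmem
    (fun i => ev i * η + kv i / 3) (fun i => by
      have a1 := hback 0 hG0
      have b1 := hback η hGη
      have a2 := hback _ a1
      have b2 := hback _ b1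
      rw [show (0 : ℂ) - 1 / 3 - 1 / 3 = -2 / 3 by ring] at a2
      rw [show η - 1 / 3 - 1 / 3 = η + -2 / 3 by ring] at b2
      rw [show (0 : ℂ) - 1 / 3 = -1 / 3 by ring] at a1
      rw [show η - 1 / 3 = η + -1 / 3 by ring] at b1
      fin_cases i <;> simp [ev, kv] <;> assumption)
    (fun i j hij => by
      rw [show (ev i * η + kv i / 3) - (ev j * η + kv j / 3) =
        ((ev i - ev j : ℤ) : ℂ) * η + ((kv i - kv j : ℤ) : ℂ) / 3 by push_cast; ring]
      refine not_isPeriod_int_mul_add hτ hη ?_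
      revert i j
      decide)
  have hprod : ∀ z, ∏ i : Fin 6, theta τ (z - (ev i * η + kv i / 3)) =
      theta3 τ 0 z * theta3 τ 0 (z - η) := fun z => by
    simp only [Fin.prod_univ_six, ev, kv, theta3_zero_eq]
    simp
    ring_nf
  have hconst : ∀ z, h z = h 0 := by
    -- The zeros sum to 3η - 2, so the cofactor has multiplier 3η - (3η - 2) = 2, an integer.
    refine Theta_zero_int_eq_const hτ (m := 2) (Theta_congr ?_ hh)
    simp only [Fin.sum_univ_six, ev, kv]
    simp
    ring
  have hG' : ∀ z, G z = h 0 * (theta3 τ 0 z * theta3 τ 0 (z - η)) := fun z => by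
    rw [hGh, hconst, hprod]
  have hw := hshift u
  rw [hG', hG', show u + 1 / 3 - η = u - η + 1 / 3 by ring, theta3_add_third hτ,
    theta3_add_third hτ, ZMod.val_zero, pow_zero, one_mul, one_mul] at hw
  rw [hG']
  have : (1 - zeta3) * (h 0 * (theta3 τ 0 u * theta3 τ 0 (u - η))) = 0 := by
    linear_combination hw
  exact (mul_eq_zero.1 this).resolve_left (sub_ne_zero.2 zeta3_ne_one.symm)

/-- The theta functions of order three satisfy the relations of `Q_3`. -/
theorem theta3_relation {τ η : ℂ} (hτ : 0 < τ.im)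
    (hη : ∀ a b : ℤ, 3 * η ≠ (a : ℂ) + (b : ℂ) * τ) (i : ZMod 3) (u : ℂ) :
    theta3 τ i u * theta3 τ (i + 1) (u - η) -
      paramQ τ η * (theta3 τ (i + 1) u * theta3 τ i (u - η)) -
      paramP τ η * (theta3 τ (i + 2) u * theta3 τ (i + 2) (u - η)) = 0 := by
  revert u
  refine zmod_three_induction (P := fun i => ∀ u, theta3 τ i u * theta3 τ (i + 1) (u - η) -
      paramQ τ η * (theta3 τ (i + 1) u * theta3 τ i (u - η)) -
      paramP τ η * (theta3 τ (i + 2) u * theta3 τ (i + 2) (u - η)) = 0)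
    (theta3_relation_zero hτ hη) (fun i ih u => ?_) i
  rw [add_right_comm i 1 2]
  simp only [theta3_succ hτ _ u, theta3_succ hτ _ (u - η)]
  have := ih (u + τ / 3)
  rw [show u + τ / 3 - η = u - η + τ / 3 by ring] at this
  linear_combination expTwoPi (u - τ / 3 + 1 / 6) * expTwoPi (u - η - τ / 3 + 1 / 6) * this

/-- The matrix `M` of linear forms with `∑_j x_j M_{k j}` the `k`-th relation. -/
def relMatrix {R : Type*} [AddCommMonoid R] [Module ℂ R] (p q : ℂ) (x : ZMod 3 → R)
    (k j : ZMod 3) : R :=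
  (if j = k then (1 : ℂ) else if j = k + 1 then -q else -p) • x (2 * k + 1 - j)

theorem relMatrix_apply_zero {R : Type*} [AddCommGroup R] [Module ℂ R] (p q : ℂ) (x : ZMod 3 → R) :
    relMatrix p q x 0 0 = x 1 ∧ relMatrix p q x 0 1 = -(q • x 0) ∧
      relMatrix p q x 0 2 = -(p • x 2) := by
  simp only [relMatrix]
  refine ⟨?_, ?_, ?_⟩
  · rw [if_pos trivial, one_smul]; rfl
  · rw [if_neg (by decide), if_pos (by decide), neg_smul]; rfl
  · rw [if_neg (by decide), if_neg (by decide), neg_smul]; rfl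

theorem relMatrix_apply_one {R : Type*} [AddCommGroup R] [Module ℂ R] (p q : ℂ) (x : ZMod 3 → R) :
    relMatrix p q x 1 0 = -(p • x 0) ∧ relMatrix p q x 1 1 = x 2 ∧
      relMatrix p q x 1 2 = -(q • x 1) := by
  simp only [relMatrix]
  refine ⟨?_, ?_, ?_⟩
  · rw [if_neg (by decide), if_neg (by decide), neg_smul]; rfl
  · rw [if_pos trivial, one_smul]; rfl
  · rw [if_neg (by decide), if_pos (by decide), neg_smul]; rfl

theorem relMatrix_apply_two {R : Type*} [AddCommGroup R] [Module ℂ R] (p q : ℂ) (x : ZMod 3 → R) :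
    relMatrix p q x 2 0 = -(q • x 2) ∧ relMatrix p q x 2 1 = -(p • x 1) ∧
      relMatrix p q x 2 2 = x 0 := by
  simp only [relMatrix]
  refine ⟨?_, ?_, ?_⟩
  · rw [if_neg (by decide), if_pos (by decide), neg_smul]; rfl
  · rw [if_neg (by decide), if_neg (by decide), neg_smul]; rfl
  · rw [if_pos trivial, one_smul]; rfl

/-! ### The relation matrix read from both sides -/

section RelMatrix

variable {R : Type*} [Ring R] [Algebra ℂ R] (p q : ℂ) (x y : ZMod 3 → R)

theorem sum_mul_relMatrix (k : ZMod 3) : ∑ j, x j * relMatrix p q y k j =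
    x k * y (k + 1) - q • (x (k + 1) * y k) - p • (x (k + 2) * y (k + 2)) := by
  revert k
  simp only [sum_zmod_three]
  refine forall_zmod_three ?_ ?_ ?_
  · obtain ⟨h0, h1, h2⟩ := relMatrix_apply_zero p q y
    simp only [h0, h1, h2, mul_neg, mul_smul_comm, zero_add]
    abel
  · obtain ⟨h0, h1, h2⟩ := relMatrix_apply_one p q y
    simp only [h0, h1, h2, mul_neg, mul_smul_comm, show (1 : ZMod 3) + 1 = 2 from rfl,
      show (1 : ZMod 3) + 2 = 0 from rfl]
    abel
  · obtain ⟨h0, h1, h2⟩ := relMatrix_apply_two p q y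
    simp only [h0, h1, h2, mul_neg, mul_smul_comm, show (2 : ZMod 3) + 1 = 0 from rfl,
      show (2 : ZMod 3) + 2 = 1 from rfl]
    abel

/-- The cubic ∑ x_j M_{kj} y_{k+2} groups either as relations on the left or as relations on the
right, with indices rotated. One matrix therefore serves both consecutive compositions of the
complex, and (x_{k+2})_k is a null vector of it. -/
theorem sum_relMatrix_mul (j : ZMod 3) : ∑ k, relMatrix p q x k j * y (k + 2) =
    x (j + 1) * y (j + 2) - q • (x (j + 2) * y (j + 1)) - p • (x j * y j) := by
  revert j
  simp only [sum_zmod_three]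
  obtain ⟨h00, h01, h02⟩ := relMatrix_apply_zero p q x
  obtain ⟨h10, h11, h12⟩ := relMatrix_apply_one p q x
  obtain ⟨h20, h21, h22⟩ := relMatrix_apply_two p q x
  have e1 : (1 : ZMod 3) + 1 = 2 := rfl
  have e2 : (1 : ZMod 3) + 2 = 0 := rfl
  have e3 : (2 : ZMod 3) + 1 = 0 := rfl
  have e4 : (2 : ZMod 3) + 2 = 1 := rfl
  refine forall_zmod_three ?_ ?_ ?_ <;>
  · simp only [h00, h01, h02, h10, h11, h12, h20, h21, h22, neg_mul, smul_mul_assoc, zero_add,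
      e1, e2, e3, e4]
    abel

end RelMatrix

theorem theta3_sum_mul_relMatrix {τ η : ℂ} (hτ : 0 < τ.im)
    (hη : ∀ a b : ℤ, 3 * η ≠ (a : ℂ) + (b : ℂ) * τ) (k : ZMod 3) (u : ℂ) :
    ∑ j, theta3 τ j u * relMatrix (paramP τ η) (paramQ τ η) (fun i => theta3 τ i (u - η)) k j = 0 := by
  rw [sum_mul_relMatrix (paramP τ η) (paramQ τ η) (fun i => theta3 τ i u)
    (fun i => theta3 τ i (u - η))]
  exact theta3_relation hτ hη k u

theorem theta3_sum_relMatrix_mul {τ η : ℂ} (hτ : 0 < τ.im)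
    (hη : ∀ a b : ℤ, 3 * η ≠ (a : ℂ) + (b : ℂ) * τ) (j : ZMod 3) (u : ℂ) :
    ∑ k, relMatrix (paramP τ η) (paramQ τ η) (fun i => theta3 τ i u) k j *
      theta3 τ (k + 2) (u - η) = 0 := by
  rw [sum_relMatrix_mul (paramP τ η) (paramQ τ η) (fun i => theta3 τ i u)
    (fun i => theta3 τ i (u - η))]
  have h := theta3_relation hτ hη (j + 1) u
  have e1 : j + 1 + 1 = j + 2 := by rw [add_assoc]; rfl
  have e2 : j + 1 + 2 = j := by rw [add_assoc, show (1 : ZMod 3) + 2 = 0 from rfl, add_zero]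
  rw [e1, e2] at h
  exact h

/-- The parameters avoid the degenerate points. -/
theorem param_nondegenerate {τ η : ℂ} (hτ : 0 < τ.im)
    (hη : ∀ a b : ℤ, 3 * η ≠ (a : ℂ) + (b : ℂ) * τ) :
    ¬ (paramP τ η ^ 3 = -1 ∧ paramQ τ η ^ 3 = -1) := by
  rintro ⟨hp, hq⟩
  set p := paramP τ η
  set q := paramQ τ η
  have hcubic : ∀ u, 3 * (theta3 τ 0 u * theta3 τ 1 u * theta3 τ 2 u) -
      p * q * (theta3 τ 0 u ^ 3 + theta3 τ 1 u ^ 3 + theta3 τ 2 u ^ 3) = 0 := by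
    intro u
    have h0 := theta3_relation hτ hη 0 u
    have h1 := theta3_relation hτ hη 1 u
    have h2 := theta3_relation hτ hη 2 u
    simp only [zero_add, show (1 : ZMod 3) + 1 = 2 from rfl, show (1 : ZMod 3) + 2 = 0 from rfl,
      show (2 : ZMod 3) + 1 = 0 from rfl, show (2 : ZMod 3) + 2 = 1 from rfl] at h0 h1 h2
    change _ - q * _ - p * _ = 0 at h0
    change _ - q * _ - p * _ = 0 at h1
    change _ - q * _ - p * _ = 0 at h2
    have hcop := theta3_zero_one_coprime hτ (z := u - η)
    generalize theta3 τ 0 u = x at *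
    generalize theta3 τ 1 u = y at *
    generalize theta3 τ 2 u = z at *
    generalize theta3 τ 0 (u - η) = a at *
    generalize theta3 τ 1 (u - η) = b at *
    generalize theta3 τ 2 (u - η) = c at *
    -- The nonzero vector (a, b, c) is annihilated by a matrix with determinant (1 - p³ - q³)xyz -
    -- pq(x³ + y³ + z³) up to sign, and 1 - p³ - q³ = 3 here. The coefficients below are cofactors,
    -- for a column chosen so that the surviving coordinate is nonzero.
    by_cases ha : a = 0
    · refine (mul_eq_zero.1 (?_ : b * _ = 0)).resolve_left (hcop ha)
      linear_combination (y * z - p * q * x ^ 2) * h0 + (q ^ 2 * x * y + p * z ^ 2) * h1 +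
        (q * y ^ 2 + p ^ 2 * x * z) * h2 + b * x * y * z * (hp + hq)
    · refine (mul_eq_zero.1 (?_ : a * _ = 0)).resolve_left ha
      linear_combination (q ^ 2 * x * z + p * y ^ 2) * h0 + (q * x ^ 2 + p ^ 2 * y * z) * h1 +
        (x * y - p * q * z ^ 2) * h2 + a * x * y * z * (hp + hq)
  have hlin : ∀ β γ : ℂ, ¬ ∀ u, theta3 τ 0 u + β * theta3 τ 1 u + γ * theta3 τ 2 u = 0 := by
    intro β γ h
    have := theta3_linearIndependent hτ (c := fun i => if i = 0 then 1 else if i = 1 then β else γ)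
      (fun z => by
        rw [sum_zmod_three, if_pos rfl, if_neg (by decide), if_pos rfl, if_neg (by decide),
          if_neg (by decide), one_mul]
        exact h z) 0
    rw [if_pos rfl] at this
    exact one_ne_zero this
  have hdiff : ∀ β γ : ℂ, Differentiable ℂ fun u =>
      theta3 τ 0 u + β * theta3 τ 1 u + γ * theta3 τ 2 u := fun β γ =>
    ((theta3_mem hτ 0).1.add ((theta3_mem hτ 1).1.const_mul β)).add
      ((theta3_mem hτ 2).1.const_mul γ)
  -- As (pq)³ = 1, this c is the inverse of pq and a cube root of unity. Multiplying the cubic by -c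
  -- gives x³ + y³ + (cz)³ - 3xy(cz), a product of three linear forms. One of them would be a linear
  -- dependence of the θ_i.
  set c := (p * q) ^ 2 with hc
  have hpq : (p * q) ^ 3 = 1 := by rw [mul_pow, hp, hq]; norm_num
  rcases entire_mul_eq_zero ((hdiff 1 c).mul (hdiff zeta3 (zeta3 ^ 2 * c)))
    (hdiff (zeta3 ^ 2) (zeta3 * c)) (fun u => by
      have h := hcubic u
      have hz := one_add_zeta3
      simp only [Pi.mul_apply]
      generalize theta3 τ 0 u = x at *
      generalize theta3 τ 1 u = y at *
      generalize theta3 τ 2 u = z at *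
      have hc3 : c ^ 3 = 1 := by rw [hc, ← pow_mul, show 2 * 3 = 3 * 2 from rfl, pow_mul, hpq, one_pow]
      have e : (x + zeta3 * y + zeta3 ^ 2 * c * z) * (x + zeta3 ^ 2 * y + zeta3 * c * z) =
          x ^ 2 + y ^ 2 + (c * z) ^ 2 - x * y - x * (c * z) - y * (c * z) := by
        linear_combination (x * y + x * (c * z) + y * (c * z)) * hz +
          (y ^ 2 + (c * z) ^ 2 + zeta3 * y * (c * z)) * zeta3_pow_three
      rw [one_mul, mul_assoc, e]
      linear_combination -(c * h) + z ^ 3 * hc3 +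
        (x ^ 3 + y ^ 3 + z ^ 3) * (-(p * q * hc) - hpq)) with h | h
  · rcases entire_mul_eq_zero (hdiff 1 c) (hdiff zeta3 (zeta3 ^ 2 * c)) h with h | h
    · exact hlin _ _ h
    · exact hlin _ _ h
  · exact hlin _ _ h

/-! ### Linear algebra -/

/-- Bounds a kernel by a space of theta functions that parametrizes it, comparing both inside a
common ambient space so that no linear choice of parameter is needed. -/
theorem finrank_le_of_range_le {V U W : Type*} [AddCommGroup V] [Module ℂ V] [AddCommGroup U]
    [Module ℂ U] [AddCommGroup W] [Module ℂ W] [Module.Finite ℂ V] (L : V →ₗ[ℂ] W)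
    {K : Submodule ℂ U} (ι : K →ₗ[ℂ] W)
    (hι : Function.Injective ι) (h : ∀ x, ∃ v, L v = ι x) :
    Module.finrank ℂ K ≤ Module.finrank ℂ V := by
  have hle : LinearMap.range ι ≤ LinearMap.range L := by
    rintro _ ⟨x, rfl⟩; exact h x
  calc Module.finrank ℂ K = Module.finrank ℂ (LinearMap.range ι) :=
        (LinearMap.finrank_range_of_inj hι).symm
    _ ≤ Module.finrank ℂ (LinearMap.range L) := Submodule.finrank_mono hle
    _ ≤ Module.finrank ℂ V := LinearMap.finrank_range_le L

/-- A subspace of codimension at most one is completed by any vector outside it. Applied to the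
exceptional syzygy represented by the central element. -/
theorem exists_sub_smul_mem_of_finrank_le {V : Type*} [AddCommGroup V] [Module ℂ V]
    [Module.Finite ℂ V] {W S : Submodule ℂ V} (hWS : W ≤ S)
    (hfin : Module.finrank ℂ S ≤ Module.finrank ℂ W + 1) {c : V} (hc : c ∈ S) (hcW : c ∉ W)
    {b : V} (hb : b ∈ S) : ∃ t : ℂ, b - t • c ∈ W := by
  have hlt : W < W ⊔ Submodule.span ℂ {c} := lt_of_le_of_ne le_sup_left fun h => hcW (by
    rw [h]; exact Submodule.mem_sup_right (Submodule.mem_span_singleton_self c))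
  have hle : W ⊔ Submodule.span ℂ {c} ≤ S :=
    sup_le hWS ((Submodule.span_singleton_le_iff_mem c S).2 hc)
  have heq := Submodule.eq_of_le_of_finrank_le hle
    (hfin.trans (Nat.succ_le_of_lt (Submodule.finrank_lt_finrank_of_lt hlt)))
  rw [← heq, Submodule.mem_sup] at hb
  obtain ⟨w, hw, y, hy, rfl⟩ := hb
  obtain ⟨t, rfl⟩ := Submodule.mem_span_singleton.1 hy
  exact ⟨t, by simpa using hw⟩

/-! ### The twisted theta functions -/

theorem theta3_mem_twisted {τ : ℂ} (hτ : 0 < τ.im) (η : ℂ) (i : ZMod 3) :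
    theta3 τ i ∈ TwistedTheta τ η 1 := by
  have h := theta3_mem hτ i
  have e : (0 : ℂ) = ((1 : ℕ) : ℂ) * (((1 : ℕ) : ℂ) - 1) / 2 * (3 * η) := by simp
  rw [e] at h
  exact h

theorem theta3_shiftMul_mem {τ : ℂ} (hτ : 0 < τ.im) {η : ℂ} (i : ZMod 3) {n : ℕ} {f : ℂ → ℂ}
    (hf : f ∈ TwistedTheta τ η n) :
    (fun u => theta3 τ i u * f (u - η)) ∈ TwistedTheta τ η (n + 1) := by
  have h := twistedMul_mem (theta3_mem_twisted hτ η i) hf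
  have e : twistedMul η 1 (theta3 τ i) f = fun u => theta3 τ i u * f (u - η) :=
    funext fun u => by simp [twistedMul]
  rwa [e, add_comm 1 n] at h

/-- The operator `f(u) ↦ θ_i(u) f(u - η)` from degree `n` to degree `n + 1`. -/
def shiftMul {τ : ℂ} (hτ : 0 < τ.im) (η : ℂ) (n : ℕ) (i : ZMod 3) :
    TwistedTheta τ η n →ₗ[ℂ] TwistedTheta τ η (n + 1) where
  toFun f := ⟨_, theta3_shiftMul_mem hτ i f.2⟩
  map_add' f g := Subtype.ext (funext fun u => by simp [mul_add])
  map_smul' a f := Subtype.ext (funext fun u => by simp [mul_left_comm])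

theorem shiftMul_apply {τ : ℂ} (hτ : 0 < τ.im) (η : ℂ) (n : ℕ) (i : ZMod 3)
    (f : TwistedTheta τ η n) (u : ℂ) :
    (shiftMul hτ η n i f : ℂ → ℂ) u = theta3 τ i u * (f : ℂ → ℂ) (u - η) := rfl

theorem relMatrix_shiftMul_apply {τ : ℂ} (hτ : 0 < τ.im) (η p q : ℂ) (n : ℕ) (k j : ZMod 3)
    (f : TwistedTheta τ η n) (u : ℂ) :
    (relMatrix p q (shiftMul hτ η n) k j f : ℂ → ℂ) u =
      relMatrix p q (fun i => theta3 τ i u) k j * (f : ℂ → ℂ) (u - η) := by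
  simp only [relMatrix, LinearMap.smul_apply, Submodule.coe_smul, Pi.smul_apply, shiftMul_apply,
    smul_mul_assoc]

/-- The map `(b_j) ↦ ∑_j X_j b_j` for a family of operators `X_j`. -/
def sumMap {V W : Type*} [AddCommMonoid V] [Module ℂ V] [AddCommMonoid W] [Module ℂ W]
    (X : ZMod 3 → V →ₗ[ℂ] W) : (ZMod 3 → V) →ₗ[ℂ] W :=
  ∑ j, X j ∘ₗ LinearMap.proj j

/-- The map `(g_k) ↦ (∑_k M_{k j} g_k)_j` for a family of operators `X_j`. -/
def relMap {V W : Type*} [AddCommMonoid V] [Module ℂ V] [AddCommMonoid W] [Module ℂ W] (p q : ℂ)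
    (X : ZMod 3 → V →ₗ[ℂ] W) : (ZMod 3 → V) →ₗ[ℂ] (ZMod 3 → W) :=
  LinearMap.pi fun j => ∑ k, relMatrix p q X k j ∘ₗ LinearMap.proj k

theorem sumMap_apply {V W : Type*} [AddCommMonoid V] [Module ℂ V] [AddCommMonoid W] [Module ℂ W]
    (X : ZMod 3 → V →ₗ[ℂ] W) (b : ZMod 3 → V) : sumMap X b = ∑ j, X j (b j) := by
  simp [sumMap]

theorem relMap_apply {V W : Type*} [AddCommMonoid V] [Module ℂ V] [AddCommMonoid W] [Module ℂ W]
    (p q : ℂ) (X : ZMod 3 → V →ₗ[ℂ] W) (g : ZMod 3 → V) (j : ZMod 3) :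
    relMap p q X g j = ∑ k, relMatrix p q X k j (g k) := by
  simp [relMap]

theorem sumMap_shiftMul_apply {τ : ℂ} (hτ : 0 < τ.im) (η : ℂ) (n : ℕ)
    (b : ZMod 3 → TwistedTheta τ η n) (u : ℂ) :
    (sumMap (shiftMul hτ η n) b : ℂ → ℂ) u = ∑ j, theta3 τ j u * (b j : ℂ → ℂ) (u - η) := by
  rw [sumMap_apply, Submodule.coe_sum, Finset.sum_apply]; rfl

theorem relMap_shiftMul_apply {τ : ℂ} (hτ : 0 < τ.im) (η p q : ℂ) (n : ℕ)
    (g : ZMod 3 → TwistedTheta τ η n) (j : ZMod 3) (u : ℂ) :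
    (relMap p q (shiftMul hτ η n) g j : ℂ → ℂ) u =
      ∑ k, relMatrix p q (fun i => theta3 τ i u) k j * (g k : ℂ → ℂ) (u - η) := by
  rw [relMap_apply, Submodule.coe_sum, Finset.sum_apply]
  simp only [relMatrix_shiftMul_apply]

theorem twisted_finite {τ : ℂ} (hτ : 0 < τ.im) (η : ℂ) (n : ℕ) :
    Module.Finite ℂ (TwistedTheta τ η n) := by
  rcases Nat.eq_zero_or_pos n with rfl | hn
  · exact Module.Finite.equiv (thetaZeroEquiv (c := (0 : ℕ) * ((0 : ℕ) - 1) / 2 * (3 * η)) hτ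
      (by simp)).symm
  · exact Theta_finite hτ (by omega) _

theorem twisted_finrank {τ : ℂ} (hτ : 0 < τ.im) (η : ℂ) {n : ℕ} (hn : n ≠ 0) :
    Module.finrank ℂ (TwistedTheta τ η n) = 3 * n :=
  Theta_finrank hτ (by omega) _

theorem twisted_finrank_zero {τ : ℂ} (hτ : 0 < τ.im) (η : ℂ) :
    Module.finrank ℂ (TwistedTheta τ η 0) = 1 := by
  have e : TwistedTheta τ η 0 ≃ₗ[ℂ] ℂ :=
    thetaZeroEquiv (c := (0 : ℕ) * ((0 : ℕ) - 1) / 2 * (3 * η)) hτ (by simp)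
  rw [e.finrank_eq, Module.finrank_self]

theorem twisted_zero_const {τ : ℂ} (hτ : 0 < τ.im) {η : ℂ} {f : ℂ → ℂ}
    (hf : f ∈ TwistedTheta τ η 0) (z : ℂ) : f z = f 0 :=
  Theta_zero_int_eq_const hτ (m := 0) (Theta_congr (by simp) hf) z

theorem twisted_pi_finrank {τ : ℂ} (hτ : 0 < τ.im) (η : ℂ) {n : ℕ} (hn : n ≠ 0) :
    Module.finrank ℂ (ZMod 3 → TwistedTheta τ η n) = 9 * n := by
  have := twisted_finite hτ η n
  rw [Module.finrank_pi_fintype, sum_zmod_three, twisted_finrank hτ η hn]; ring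

/-- The component of degree `n + 2` is generated by the one of degree `n + 1`. -/
theorem sumMap_shiftMul_surjective {τ η : ℂ} (hτ : 0 < τ.im)
    (hη : ∀ a b : ℤ, 3 * η ≠ (a : ℂ) + (b : ℂ) * τ) (n : ℕ) :
    Function.Surjective (sumMap (shiftMul hτ η (n + 1))) := by
  have := twisted_finite hτ η (n + 1)
  have := twisted_finite hτ η (n + 1 + 1)
  set X := shiftMul hτ η (n + 1)
  -- Base-point-free pencil trick: θ_0 and θ_1 alone generate. A pair with θ_0 f(u - η) + θ_1 g(u -
  -- η) = 0 is h·(θ_1, -θ_0) with h entire, hence h is a theta function of order 3n.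
  let T : TwistedTheta τ η (n + 1) × TwistedTheta τ η (n + 1) →ₗ[ℂ] TwistedTheta τ η (n + 1 + 1) :=
    (X 0).coprod (X 1)
  set c : ℂ := ((n + 1 : ℕ) : ℂ) * (((n + 1 : ℕ) : ℂ) - 1) / 2 * (3 * η) + (n + 1 : ℕ) * (3 * η)
    with hc
  have hker : ∀ x : LinearMap.ker T, ∃ h ∈ Theta τ (3 * n) c,
      (∀ u, (x.1.1 : ℂ → ℂ) u = h (u + η) * theta3 τ 1 (u + η)) ∧
      ∀ u, (x.1.2 : ℂ → ℂ) u = -(h (u + η) * theta3 τ 0 (u + η)) := by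
    rintro ⟨⟨⟨f, hf⟩, ⟨g, hg⟩⟩, hx⟩
    have hx : ∀ u, theta3 τ 0 u * f (u - η) + theta3 τ 1 u * g (u - η) = 0 := fun u => by
      have h : T (⟨f, hf⟩, ⟨g, hg⟩) = 0 := hx
      exact congrFun (congrArg Subtype.val h) u
    have hsub : ∀ {f : ℂ → ℂ}, Differentiable ℂ f → Differentiable ℂ fun u => f (u - η) :=
      fun hf => hf.comp (differentiable_id.sub_const η)
    obtain ⟨k, hk, hk0, hk1⟩ := entire_proportional (f₀ := theta3 τ 0) (f₁ := theta3 τ 1)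
      (g₀ := fun u => -g (u - η)) (g₁ := fun u => f (u - η)) (theta3_mem hτ 0).1
      (theta3_mem hτ 1).1 (hsub hg.1).neg (hsub hf.1) (exists_theta3_ne_zero hτ 0)
      (fun z hz => theta3_zero_one_coprime hτ hz) (fun z => by linear_combination -hx z)
    refine ⟨k, ?_, fun u => ?_, fun u => ?_⟩
    · refine Theta_of_mul_mem hk (theta3_mem hτ 1) (exists_theta3_ne_zero hτ 1) ?_
      rw [← funext hk1]
      refine Theta_congr ?_ (Theta_comp_sub_mem hf η)
      rw [hc]; push_cast; ring
    · have := hk1 (u + η)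
      rwa [add_sub_cancel_right] at this
    · have := hk0 (u + η)
      rw [add_sub_cancel_right] at this
      change g u = _
      rw [← this, neg_neg]
  have hfin : Module.finrank ℂ (LinearMap.ker T) ≤ 3 * n := by
    -- For n = 0 the factor h has order zero and multiplier c = 3η, so 3η outside the lattice is
    -- what makes the kernel vanish.
    rcases Nat.eq_zero_or_pos n with rfl | hn
    · have hper : ¬ IsPeriod τ c := by
        rintro ⟨a, b, h⟩
        refine hη a b ?_
        rw [← h, hc]; push_cast; ring
      have : LinearMap.ker T = ⊥ := by
        rw [Submodule.eq_bot_iff]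
        intro x hx
        obtain ⟨h, hh, h1, h2⟩ := hker ⟨x, hx⟩
        have h0 := Theta_zero_eq_zero hτ hper hh
        refine Prod.ext (Subtype.ext (funext fun u => ?_)) (Subtype.ext (funext fun u => ?_))
        · rw [h1, h0, zero_mul]; rfl
        · rw [h2, h0, zero_mul, neg_zero]; rfl
      rw [this, finrank_bot]
    · have := Theta_finite hτ (n := 3 * n) (by omega) c
      let L : Theta τ (3 * n) c →ₗ[ℂ] (ℂ → ℂ) × (ℂ → ℂ) :=
        { toFun := fun h => (fun u => (h : ℂ → ℂ) (u + η) * theta3 τ 1 (u + η),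
            fun u => -((h : ℂ → ℂ) (u + η) * theta3 τ 0 (u + η)))
          map_add' := fun h h' => by
            refine Prod.ext (funext fun u => ?_) (funext fun u => ?_) <;> simp <;> ring
          map_smul' := fun a h => by
            refine Prod.ext (funext fun u => ?_) (funext fun u => ?_) <;> simp <;> ring }
      let ι : LinearMap.ker T →ₗ[ℂ] (ℂ → ℂ) × (ℂ → ℂ) :=
        ((TwistedTheta τ η (n + 1)).subtype.prodMap (TwistedTheta τ η (n + 1)).subtype) ∘ₗ
          (LinearMap.ker T).subtype
      have hι : Function.Injective ι := by
        intro x y hxy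
        exact Subtype.ext (Prod.ext (Subtype.ext (congrArg Prod.fst hxy))
          (Subtype.ext (congrArg Prod.snd hxy)))
      refine (finrank_le_of_range_le L ι hι fun x => ?_).trans_eq (Theta_finrank hτ (by omega) c)
      obtain ⟨h, hh, h1, h2⟩ := hker x
      exact ⟨⟨h, hh⟩, Prod.ext (funext fun u => (h1 u).symm) (funext fun u => (h2 u).symm)⟩
  have hrn := LinearMap.finrank_range_add_finrank_ker T
  rw [Module.finrank_prod, twisted_finrank hτ η (Nat.succ_ne_zero n)] at hrn
  -- The rank is at least 2·3(n + 1) - 3n = 3(n + 2), the dimension of the target.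
  have htop : LinearMap.range T = ⊤ := Submodule.eq_top_of_finrank_eq (le_antisymm
    (Submodule.finrank_le _) (by rw [twisted_finrank hτ η (Nat.succ_ne_zero (n + 1))]; omega))
  intro f
  obtain ⟨⟨b, b'⟩, hb⟩ := LinearMap.range_eq_top.1 htop f
  refine ⟨fun i => if i = 0 then b else if i = 1 then b' else 0, ?_⟩
  rw [sumMap_apply, sum_zmod_three, if_pos rfl, if_neg (by decide), if_pos rfl,
    if_neg (by decide), if_neg (by decide), map_zero, add_zero, ← hb]
  rfl

/-- The vectors annihilated by the relation matrix on the left are proportional to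
`(θ_{k+2}(u))_k`. -/
theorem relMap_ker_proportional {τ η : ℂ} (hτ : 0 < τ.im)
    (hη : ∀ a b : ℤ, 3 * η ≠ (a : ℂ) + (b : ℂ) * τ) {n : ℕ} {g : ZMod 3 → TwistedTheta τ η n}
    (hg : relMap (paramP τ η) (paramQ τ η) (shiftMul hτ η n) g = 0) (i j : ZMod 3) (u : ℂ) :
    (g (i + 1) : ℂ → ℂ) u * theta3 τ j u = (g (j + 1) : ℂ → ℂ) u * theta3 τ i u := by
  set p := paramP τ η with hp
  set q := paramQ τ η with hq
  have hq0 : q ≠ 0 := paramQ_ne_zero hτ hη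
  have hsub : ∀ {f : ℂ → ℂ}, Differentiable ℂ f → Differentiable ℂ fun u => f (u - η) :=
    fun hf => hf.comp (differentiable_id.sub_const η)
  have e1 : (1 : ZMod 3) + 1 = 2 := rfl
  have e2 : (1 : ZMod 3) + 2 = 0 := rfl
  have e3 : (2 : ZMod 3) + 1 = 0 := rfl
  have e4 : (2 : ZMod 3) + 2 = 1 := rfl
  have hy : ∀ j u, theta3 τ (j + 1) u * (g (j + 2 + 1) : ℂ → ℂ) (u - η) -
      q * (theta3 τ (j + 2) u * (g (j + 1 + 1) : ℂ → ℂ) (u - η)) -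
      p * (theta3 τ j u * (g (j + 1) : ℂ → ℂ) (u - η)) = 0 := fun j u => by
    have h := congrFun (congrArg Subtype.val (congrFun hg j)) u
    rw [relMap_shiftMul_apply] at h
    have h' := sum_relMatrix_mul p q (fun i => theta3 τ i u)
      (fun i => (g (i + 1) : ℂ → ℂ) (u - η)) j
    simp only [add_assoc, e3, add_zero] at h'
    rw [h] at h'
    simpa [add_assoc, e3, sub_eq_zero] using h'.symm
  have ht : ∀ j u, theta3 τ (j + 1) u * theta3 τ (j + 2) (u - η) -
      q * (theta3 τ (j + 2) u * theta3 τ (j + 1) (u - η)) -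
      p * (theta3 τ j u * theta3 τ j (u - η)) = 0 := fun j u => by
    rw [← theta3_sum_relMatrix_mul hτ hη j u, sum_relMatrix_mul p q (fun i => theta3 τ i u)
      (fun i => theta3 τ i (u - η))]
    rfl
  have hm : Differentiable ℂ fun u =>
      (p ^ 2 * (theta3 τ 0 u * theta3 τ 1 u) + q * theta3 τ 2 u ^ 2) ^ 2 :=
    (((((theta3_mem hτ 0).1.mul (theta3_mem hτ 1).1).const_mul _).add
      (((theta3_mem hτ 2).1.pow 2).const_mul _))).pow 2
  have h20 : theta3 τ 2 0 ≠ 0 := fun h => by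
    have := theta3_one_neg hτ 0
    rw [h, mul_zero, neg_zero] at this
    exact theta3_zero_one_coprime hτ (theta3_zero_apply_zero τ) this
  have hdiff : Differentiable ℂ fun u => (g (i + 1) : ℂ → ℂ) (u - η) * theta3 τ j (u - η) -
      (g (j + 1) : ℂ → ℂ) (u - η) * theta3 τ i (u - η) :=
    ((hsub (g (i + 1)).2.1).mul (hsub (theta3_mem hτ j).1)).sub
      ((hsub (g (j + 1)).2.1).mul (hsub (theta3_mem hτ i).1))
  -- Two of the three equations, solved with the minor m = p²θ_0θ_1 + qθ_2², express m times each
  -- null vector through its last coordinate by the same coefficients. All 2×2 minors of two null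
  -- vectors are thus killed by m². At u = 0 only qθ_2(0)² survives in m, so m is not identically
  -- zero.
  rcases entire_mul_eq_zero hm hdiff (fun u => by
    have y0 := hy 0 u
    have y1 := hy 1 u
    have t0 := ht 0 u
    have t1 := ht 1 u
    simp only [zero_add, e1, e2, e3] at y0 y1 t0 t1
    have key : ∀ (x0 x1 x2 : ℂ) (y t : ZMod 3 → ℂ), x1 * y 2 - q * (x2 * y 1) - p * (x0 * y 0) = 0 →
        x2 * y 0 - q * (x0 * y 2) - p * (x1 * y 1) = 0 →
        x1 * t 2 - q * (x2 * t 1) - p * (x0 * t 0) = 0 →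
        x2 * t 0 - q * (x0 * t 2) - p * (x1 * t 1) = 0 →
        ∀ i j, (p ^ 2 * (x0 * x1) + q * x2 ^ 2) ^ 2 * (y i * t j - y j * t i) = 0 := by
      clear * -
      intro x0 x1 x2 y t y0 y1 t0 t1
      have ya : (p ^ 2 * (x0 * x1) + q * x2 ^ 2) * y 0 = (p * x1 ^ 2 + q ^ 2 * x0 * x2) * y 2 := by
        linear_combination -(p * x1) * y0 + q * x2 * y1
      have yb : (p ^ 2 * (x0 * x1) + q * x2 ^ 2) * y 1 = (x1 * x2 - p * q * x0 ^ 2) * y 2 := by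
        linear_combination -x2 * y0 - p * x0 * y1
      have ta : (p ^ 2 * (x0 * x1) + q * x2 ^ 2) * t 0 = (p * x1 ^ 2 + q ^ 2 * x0 * x2) * t 2 := by
        linear_combination -(p * x1) * t0 + q * x2 * t1
      have tb : (p ^ 2 * (x0 * x1) + q * x2 ^ 2) * t 1 = (x1 * x2 - p * q * x0 ^ 2) * t 2 := by
        linear_combination -x2 * t0 - p * x0 * t1
      set m := p ^ 2 * (x0 * x1) + q * x2 ^ 2
      have hcomb : ∃ a : ZMod 3 → ℂ, (∀ i, m * y i = a i * y 2) ∧ ∀ i, m * t i = a i * t 2 :=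
        ⟨fun i => if i = 0 then p * x1 ^ 2 + q ^ 2 * x0 * x2 else
          if i = 1 then x1 * x2 - p * q * x0 ^ 2 else m,
          forall_zmod_three ya yb rfl, forall_zmod_three ta tb rfl⟩
      obtain ⟨a, ha, hb⟩ := hcomb
      intro i j
      linear_combination (m * t j) * ha i + a i * y 2 * hb j - (m * t i) * ha j - a j * y 2 * hb i
    exact key _ _ _ (fun i => (g (i + 1) : ℂ → ℂ) (u - η)) (fun i => theta3 τ i (u - η))
      (by simpa only [zero_add, e1, e2, e3, e4] using y0)
      (by simpa only [zero_add, e1, e2, e3, e4] using y1) t0 t1 i j) with h | h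
  · have := h 0
    rw [theta3_zero_apply_zero, zero_mul, mul_zero, zero_add] at this
    exact absurd this (pow_ne_zero 2 (mul_ne_zero hq0 (pow_ne_zero 2 h20)))
  · have := h (u + η)
    simp only [add_sub_cancel_right] at this
    exact sub_eq_zero.1 this

/-! ### Exactness of the complex of theta functions -/

theorem relMap_ker_zero {τ η : ℂ} (hτ : 0 < τ.im)
    (hη : ∀ a b : ℤ, 3 * η ≠ (a : ℂ) + (b : ℂ) * τ) :
    LinearMap.ker (relMap (paramP τ η) (paramQ τ η) (shiftMul hτ η 0)) = ⊥ := by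
  rw [Submodule.eq_bot_iff]
  intro g hg
  have hprop := relMap_ker_proportional hτ hη hg
  have hne : ∀ i : ZMod 3, i ≠ i + 1 := by decide
  -- In degree zero the g_i are constants, and proportionality to the θ_i becomes a linear relation
  -- between two different θ_i.
  have key : ∀ i, (g (i + 1) : ℂ → ℂ) 0 = 0 := by
    intro i
    have hi := hne i
    have := theta3_linearIndependent hτ (c := fun k => if k = i + 1 then (g (i + 1) : ℂ → ℂ) 0 else
      if k = i then -(g (i + 1 + 1) : ℂ → ℂ) 0 else 0) (fun u => by
        have h := hprop i (i + 1) u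
        rw [twisted_zero_const hτ (g (i + 1)).2, twisted_zero_const hτ (g (i + 1 + 1)).2] at h
        rw [Finset.sum_eq_add (i + 1) i hi.symm (fun c _ hc => by simp [hc.1, hc.2])
          (by simp) (by simp)]
        rw [if_pos rfl, if_neg hi, if_pos rfl]
        linear_combination h) (i + 1)
    simpa using this
  funext i
  refine Subtype.ext (funext fun u => ?_)
  rw [twisted_zero_const hτ (g i).2 u]
  have := key (i + 2)
  rwa [show i + 2 + 1 = i by rw [add_assoc, show (2 : ZMod 3) + 1 = 0 from rfl, add_zero]] at this

/-- Proportional to the coprime pair θ_0, θ_1, a kernel element is h·(θ_i)_i for a theta function h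
of order 3n. For n = 0 the multiplier is zero and h may be any constant. This one dimension in
excess of 3n is where a new relation in degree three can enter. -/
theorem finrank_relMap_ker_le {τ η : ℂ} (hτ : 0 < τ.im)
    (hη : ∀ a b : ℤ, 3 * η ≠ (a : ℂ) + (b : ℂ) * τ) (n : ℕ) :
    Module.finrank ℂ
      (LinearMap.ker (relMap (paramP τ η) (paramQ τ η) (shiftMul hτ η (n + 1)))) ≤
      if n = 0 then 1 else 3 * n := by
  set K := LinearMap.ker (relMap (paramP τ η) (paramQ τ η) (shiftMul hτ η (n + 1)))
  set c : ℂ := ((n + 1 : ℕ) : ℂ) * (((n + 1 : ℕ) : ℂ) - 1) / 2 * (3 * η) with hc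
  have hker : ∀ g : K, ∃ h ∈ Theta τ (3 * n) c,
      ∀ i u, (g.1 (i + 1) : ℂ → ℂ) u = h u * theta3 τ i u := by
    rintro ⟨g, hg⟩
    have hprop := relMap_ker_proportional hτ hη hg
    obtain ⟨k, hk, hk0, hk1⟩ := entire_proportional (theta3_mem hτ 0).1
      (theta3_mem hτ 1).1 (g (0 + 1)).2.1 (g (1 + 1)).2.1 (exists_theta3_ne_zero hτ 0)
      (fun z hz => theta3_zero_one_coprime hτ hz) (hprop 0 1)
    refine ⟨k, ?_, forall_zmod_three hk0 hk1 fun u => ?_⟩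
    · refine Theta_of_mul_mem hk (theta3_mem hτ 0) (exists_theta3_ne_zero hτ 0) ?_
      rw [← funext hk0, add_zero]
      exact (g (0 + 1)).2
    · refine entire_mul_right_cancel (g (2 + 1)).2.1 (hk.mul (theta3_mem hτ 2).1)
        (theta3_mem hτ 0).1 (exists_theta3_ne_zero hτ 0) (fun u => ?_) u
      rw [hprop 2 0 u, hk0 u]
      simp only [Pi.mul_apply]
      ring
  have hfin : Module.Finite ℂ (Theta τ (3 * n) c) ∧
      Module.finrank ℂ (Theta τ (3 * n) c) = if n = 0 then 1 else 3 * n := by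
    split_ifs with hn
    · subst hn
      have e : Theta τ (3 * 0) c ≃ₗ[ℂ] ℂ := thetaZeroEquiv hτ (by rw [hc]; simp)
      exact ⟨Module.Finite.equiv e.symm, by rw [e.finrank_eq, Module.finrank_self]⟩
    · exact ⟨Theta_finite hτ (by omega) _, Theta_finrank hτ (by omega) _⟩
  have := hfin.1
  rw [← hfin.2]
  let L : Theta τ (3 * n) c →ₗ[ℂ] (ZMod 3 → ℂ → ℂ) :=
    { toFun := fun h i u => (h : ℂ → ℂ) u * theta3 τ i u
      map_add' := fun h h' => funext fun i => funext fun u => by simp [add_mul]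
      map_smul' := fun a h => funext fun i => funext fun u => by simp [mul_assoc] }
  let ι : K →ₗ[ℂ] (ZMod 3 → ℂ → ℂ) :=
    { toFun := fun g i => (g.1 (i + 1) : ℂ → ℂ)
      map_add' := fun h h' => rfl
      map_smul' := fun a h => rfl }
  have hι : Function.Injective ι := by
    intro x y hxy
    refine Subtype.ext (funext fun i => Subtype.ext ?_)
    have := congrFun hxy (i + 2)
    change (x.1 (i + 2 + 1) : ℂ → ℂ) = (y.1 (i + 2 + 1) : ℂ → ℂ) at this
    rwa [show i + 2 + 1 = i by rw [add_assoc, show (2 : ZMod 3) + 1 = 0 from rfl, add_zero]] at this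
  refine finrank_le_of_range_le L ι hι fun g => ?_
  obtain ⟨h, hh, hg⟩ := hker g
  exact ⟨⟨h, hh⟩, funext fun i => funext fun u => (hg i u).symm⟩

theorem relMap_range_le {τ η : ℂ} (hτ : 0 < τ.im)
    (hη : ∀ a b : ℤ, 3 * η ≠ (a : ℂ) + (b : ℂ) * τ) (n : ℕ) :
    LinearMap.range (relMap (paramP τ η) (paramQ τ η) (shiftMul hτ η n)) ≤
      LinearMap.ker (sumMap (shiftMul hτ η (n + 1))) := by
  rintro _ ⟨g, rfl⟩
  refine LinearMap.mem_ker.2 (Subtype.ext (funext fun u => ?_))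
  rw [sumMap_shiftMul_apply]
  simp only [relMap_shiftMul_apply, Finset.mul_sum]
  rw [Finset.sum_comm]
  refine Finset.sum_eq_zero fun k _ => ?_
  simp only [← mul_assoc]
  rw [← Finset.sum_mul, theta3_sum_mul_relMatrix hτ hη, zero_mul]

theorem finrank_sumMap_ker {τ η : ℂ} (hτ : 0 < τ.im)
    (hη : ∀ a b : ℤ, 3 * η ≠ (a : ℂ) + (b : ℂ) * τ) (n : ℕ) :
    Module.finrank ℂ (LinearMap.ker (sumMap (shiftMul hτ η (n + 1)))) = 6 * n + 3 := by
  have := twisted_finite hτ η (n + 1)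
  have h := LinearMap.finrank_range_add_finrank_ker (sumMap (shiftMul hτ η (n + 1)))
  rw [LinearMap.range_eq_top.2 (sumMap_shiftMul_surjective hτ hη n), finrank_top,
    twisted_pi_finrank hτ η (Nat.succ_ne_zero n), twisted_finrank hτ η (Nat.succ_ne_zero _)] at h
  omega

/-- The target dimension is 6n + 3. The rank is 3 for n = 0 and at least 9n - 3(n - 1) = 6n + 3 for
n ≥ 2. For n = 1 the same count yields only 9 - 1 = 8, one short. -/
theorem relMap_range_eq {τ η : ℂ} (hτ : 0 < τ.im)
    (hη : ∀ a b : ℤ, 3 * η ≠ (a : ℂ) + (b : ℂ) * τ) {n : ℕ} (hn : n ≠ 1) :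
    LinearMap.range (relMap (paramP τ η) (paramQ τ η) (shiftMul hτ η n)) =
      LinearMap.ker (sumMap (shiftMul hτ η (n + 1))) := by
  have := twisted_finite hτ η n
  have := twisted_finite hτ η (n + 1)
  refine Submodule.eq_of_le_of_finrank_le (relMap_range_le hτ hη n) ?_
  have h := LinearMap.finrank_range_add_finrank_ker
    (relMap (paramP τ η) (paramQ τ η) (shiftMul hτ η n))
  rw [finrank_sumMap_ker hτ hη]
  rcases n with _ | n
  · rw [relMap_ker_zero hτ hη, finrank_bot, Module.finrank_pi_fintype, sum_zmod_three,
      twisted_finrank_zero hτ η] at h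
    omega
  · have hk := finrank_relMap_ker_le hτ hη n
    rw [if_neg (by omega)] at hk
    rw [twisted_pi_finrank hτ η (Nat.succ_ne_zero n)] at h
    omega

theorem finrank_relMap_range_one {τ η : ℂ} (hτ : 0 < τ.im)
    (hη : ∀ a b : ℤ, 3 * η ≠ (a : ℂ) + (b : ℂ) * τ) :
    Module.finrank ℂ (LinearMap.ker (sumMap (shiftMul hτ η (1 + 1)))) ≤
    Module.finrank ℂ (LinearMap.range (relMap (paramP τ η) (paramQ τ η) (shiftMul hτ η 1))) + 1 := by
  have := twisted_finite hτ η 1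
  have h := LinearMap.finrank_range_add_finrank_ker
    (relMap (paramP τ η) (paramQ τ η) (shiftMul hτ η 1))
  have hk := finrank_relMap_ker_le hτ hη 0
  rw [if_pos rfl] at hk
  rw [twisted_pi_finrank hτ η one_ne_zero] at h
  rw [finrank_sumMap_ker hτ hη]
  change Module.finrank ℂ (LinearMap.ker (relMap (paramP τ η) (paramQ τ η) (shiftMul hτ η 1))) ≤ 1
    at hk
  omega

section

/-! ### The algebra `A_{p,q}` -/

theorem gen_relation (p q : ℂ) (i : ZMod 3) :
    gen p q i * gen p q (i + 1) - q • (gen p q (i + 1) * gen p q i) -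
      p • (gen p q (i + 2) * gen p q (i + 2)) = 0 := by
  have h := RingQuot.mkAlgHom_rel ℂ (Rel.mk (p := p) (q := q) i)
  simp only [map_sub, map_mul, map_smul, map_pow] at h
  rw [pow_two] at h
  exact sub_eq_zero.2 h

/-- Algebra homomorphisms from `A_{p,q}`. -/
def liftA {p q : ℂ} {R : Type*} [Ring R] [Algebra ℂ R] (y : ZMod 3 → R)
    (h : ∀ i, y i * y (i + 1) - q • (y (i + 1) * y i) - p • (y (i + 2) * y (i + 2)) = 0) :
    A p q →ₐ[ℂ] R :=
  RingQuot.liftAlgHom ℂ ⟨FreeAlgebra.lift ℂ y, by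
    rintro _ _ ⟨i⟩
    simp only [map_sub, map_mul, map_smul, map_pow, FreeAlgebra.lift_ι_apply]
    rw [pow_two]
    exact sub_eq_zero.1 (h i)⟩

theorem liftA_gen {p q : ℂ} {R : Type*} [Ring R] [Algebra ℂ R] (y : ZMod 3 → R)
    (h : ∀ i, y i * y (i + 1) - q • (y (i + 1) * y i) - p • (y (i + 2) * y (i + 2)) = 0)
    (i : ZMod 3) : liftA y h (gen p q i) = y i := by
  rw [liftA, gen, RingQuot.liftAlgHom_mkAlgHom_apply, FreeAlgebra.lift_ι_apply]

theorem A_induction {p q : ℂ} {P : A p q → Prop} (hC : ∀ r : ℂ, P (algebraMap ℂ _ r))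
    (hX : ∀ i, P (gen p q i)) (hmul : ∀ a b, P a → P b → P (a * b))
    (hadd : ∀ a b, P a → P b → P (a + b)) (a : A p q) : P a := by
  obtain ⟨x, rfl⟩ := RingQuot.mkAlgHom_surjective ℂ (Rel p q) a
  induction x using FreeAlgebra.induction with
  | grade0 r => rw [AlgHom.commutes]; exact hC r
  | grade1 i => exact hX i
  | mul a b ha hb => rw [map_mul]; exact hmul _ _ ha hb
  | add a b ha hb => rw [map_add]; exact hadd _ _ ha hb

variable {p q : ℂ}

/-! ### The grading -/

theorem gen_mul_mem {n : ℕ} {a : A p q} (ha : a ∈ F p q n) (i : ZMod 3) :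
    gen p q i * a ∈ F p q (n + 1) := by
  induction ha using Submodule.span_induction with
  | mem x hx =>
    obtain ⟨w, rfl⟩ := hx
    refine Submodule.subset_span ⟨Fin.cons i w, ?_⟩
    simp [List.ofFn_succ]
  | zero => rw [mul_zero]; exact Submodule.zero_mem _
  | add x y _ _ hx hy => rw [mul_add]; exact Submodule.add_mem _ hx hy
  | smul c x _ hx => rw [mul_smul_comm]; exact Submodule.smul_mem _ c hx

theorem mem_F_zero {a : A p q} : a ∈ F p q 0 ↔ ∃ c : ℂ, c • (1 : A p q) = a := by
  have : (Set.range fun w : Fin 0 → ZMod 3 => (List.ofFn fun k => gen p q (w k)).prod) = {1} := by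
    simp
  rw [F, this, Submodule.mem_span_singleton]

theorem one_mem_F : (1 : A p q) ∈ F p q 0 := mem_F_zero.2 ⟨1, one_smul _ _⟩

theorem gen_mem_F (i : ZMod 3) : gen p q i ∈ F p q 1 := by
  simpa using gen_mul_mem one_mem_F i

theorem exists_eq_sum_of_mem_F_succ {n : ℕ} {a : A p q} (ha : a ∈ F p q (n + 1)) :
    ∃ d : ZMod 3 → F p q n, a = ∑ j, gen p q j * (d j : A p q) := by
  induction ha using Submodule.span_induction with
  | mem x hx =>
    obtain ⟨w, rfl⟩ := hx
    refine ⟨Pi.single (w 0) ⟨(List.ofFn fun k => gen p q (w k.succ)).prod,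
      Submodule.subset_span ⟨fun k => w k.succ, rfl⟩⟩, ?_⟩
    rw [Finset.sum_eq_single (w 0)]
    · simp [List.ofFn_succ]
    · intro j _ hj
      simp [hj]
    · simp
  | zero => exact ⟨0, by simp⟩
  | add x y _ _ hx hy =>
    obtain ⟨d, rfl⟩ := hx
    obtain ⟨e, rfl⟩ := hy
    exact ⟨d + e, by simp [mul_add, Finset.sum_add_distrib]⟩
  | smul c x _ hx =>
    obtain ⟨d, rfl⟩ := hx
    exact ⟨c • d, by simp [Finset.smul_sum]⟩

instance F_addCommGroup (n : ℕ) : AddCommGroup (F p q n) := (F p q n).addCommGroup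

instance F_finite (n : ℕ) : Module.Finite ℂ (F p q n) :=
  Module.Finite.span_of_finite ℂ (Set.finite_range _)

theorem iSup_F_eq_top : ⨆ n, F p q n = ⊤ := by
  rw [Submodule.eq_top_iff']
  have key : ∀ a : A p q, ∀ b ∈ ⨆ n, F p q n, a * b ∈ ⨆ n, F p q n := by
    intro a
    induction a using A_induction with
    | hC r =>
      intro b hb
      rw [← Algebra.smul_def]
      exact Submodule.smul_mem _ r hb
    | hX i =>
      intro b hb
      induction hb using Submodule.iSup_induction' with
      | mem n x hx => exact Submodule.mem_iSup_of_mem (n + 1) (gen_mul_mem hx i)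
      | zero => rw [mul_zero]; exact Submodule.zero_mem _
      | add x y _ _ hx hy => rw [mul_add]; exact Submodule.add_mem _ hx hy
    | hmul x y hx hy =>
      intro b hb
      rw [mul_assoc]
      exact hx _ (hy _ hb)
    | hadd x y hx hy =>
      intro b hb
      rw [add_mul]
      exact Submodule.add_mem _ (hx _ hb) (hy _ hb)
  intro a
  simpa using key a 1 (Submodule.mem_iSup_of_mem 0 one_mem_F)

/-- The homomorphism `x_i ↦ x_i X` to the polynomial ring. -/
def gradeHom (p q : ℂ) : A p q →ₐ[ℂ] Polynomial (A p q) :=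
  liftA (fun i => Polynomial.monomial 1 (gen p q i)) fun i => by
    simp only [Polynomial.monomial_mul_monomial, Polynomial.smul_monomial]
    rw [← Polynomial.monomial_sub, ← Polynomial.monomial_sub, gen_relation, Polynomial.monomial_zero_right]

theorem gradeHom_gen_mul (i : ZMod 3) (a : A p q) :
    gradeHom p q (gen p q i * a) =
      Polynomial.C (gen p q i) * (Polynomial.X * gradeHom p q a) := by
  rw [map_mul, gradeHom, liftA_gen, ← Polynomial.C_mul_X_eq_monomial, mul_assoc]

theorem gradeHom_of_mem {n : ℕ} {a : A p q} (ha : a ∈ F p q n) :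
    gradeHom p q a = Polynomial.monomial n a := by
  induction n generalizing a with
  | zero =>
    obtain ⟨c, rfl⟩ := mem_F_zero.1 ha
    rw [map_smul, map_one, ← Polynomial.smul_monomial, ← Polynomial.monomial_zero_one]
  | succ n ih =>
    obtain ⟨d, rfl⟩ := exists_eq_sum_of_mem_F_succ ha
    rw [map_sum, map_sum]
    refine Finset.sum_congr rfl fun j _ => ?_
    rw [gradeHom_gen_mul, ih (d j).2, Polynomial.X_mul_monomial, Polynomial.C_mul_monomial]

/-- The projection to the component of degree `n`. -/
def gradeProj (p q : ℂ) (n : ℕ) : A p q →ₗ[ℂ] A p q where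
  toFun a := (gradeHom p q a).coeff n
  map_add' a b := by rw [map_add, Polynomial.coeff_add]
  map_smul' c a := by rw [map_smul, Polynomial.coeff_smul, RingHom.id_apply]

theorem gradeProj_of_mem {n m : ℕ} {a : A p q} (ha : a ∈ F p q n) :
    gradeProj p q m a = if n = m then a else 0 := by
  change (gradeHom p q a).coeff m = _
  rw [gradeHom_of_mem ha, Polynomial.coeff_monomial]

theorem gradeProj_mem (n : ℕ) (a : A p q) : gradeProj p q n a ∈ F p q n := by
  have ha : a ∈ ⨆ n, F p q n := by rw [iSup_F_eq_top]; trivial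
  induction ha using Submodule.iSup_induction' with
  | mem m x hx =>
    rw [gradeProj_of_mem hx]
    split_ifs with h
    · exact h ▸ hx
    · exact Submodule.zero_mem _
  | zero => rw [map_zero]; exact Submodule.zero_mem _
  | add x y _ _ hx hy => rw [map_add]; exact Submodule.add_mem _ hx hy

theorem gradeProj_succ_gen_mul (n : ℕ) (i : ZMod 3) (a : A p q) :
    gradeProj p q (n + 1) (gen p q i * a) = gen p q i * gradeProj p q n a := by
  change (gradeHom p q _).coeff _ = _
  rw [gradeHom_gen_mul, Polynomial.coeff_C_mul, Polynomial.coeff_X_mul]; rfl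

/-! ### Exactness of the presentation -/

/-- Left multiplication by the generators. -/
def genMulLeft (p q : ℂ) (i : ZMod 3) : A p q →ₗ[ℂ] A p q := LinearMap.mulLeft ℂ (gen p q i)

theorem genMulLeft_apply (i : ZMod 3) (a : A p q) : genMulLeft p q i a = gen p q i * a := rfl

theorem relMatrix_map_apply {V W : Type*} [AddCommMonoid V] [Module ℂ V] [AddCommMonoid W]
    [Module ℂ W] (X : ZMod 3 → V →ₗ[ℂ] W) (k j : ZMod 3) (v : V) :
    relMatrix p q X k j v = relMatrix p q (fun i => X i v) k j := by
  simp only [relMatrix, LinearMap.smul_apply]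

theorem relMatrix_mul {R : Type*} [Ring R] [Algebra ℂ R] (x : ZMod 3 → R) (k j : ZMod 3) (r : R) :
    relMatrix p q x k j * r = relMatrix p q (fun i => x i * r) k j := by
  simp only [relMatrix, smul_mul_assoc]

theorem sum_genMulLeft_relMatrix (k : ZMod 3) (a : A p q) :
    ∑ j, gen p q j * relMatrix p q (genMulLeft p q) k j a = 0 := by
  simp only [relMatrix_map_apply, genMulLeft_apply, ← relMatrix_mul, ← mul_assoc]
  rw [← Finset.sum_mul, sum_mul_relMatrix, gen_relation, zero_mul]

theorem relMap_range_le_ker_genMulLeft :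
    LinearMap.range (relMap p q (genMulLeft p q)) ≤ LinearMap.ker (sumMap (genMulLeft p q)) := by
  rintro _ ⟨g, rfl⟩
  rw [LinearMap.mem_ker, sumMap_apply]
  simp only [relMap_apply, genMulLeft_apply, Finset.mul_sum]
  rw [Finset.sum_comm]
  exact Finset.sum_eq_zero fun k _ => sum_genMulLeft_relMatrix k _

/-- The cokernel of the relation matrix. -/
abbrev RelCoker (p q : ℂ) : Type :=
  (ZMod 3 → A p q) ⧸ LinearMap.range (relMap p q (genMulLeft p q))

/-- The map `ℂ ⊕ coker M → A`, `(c, (a_j)) ↦ c + ∑_j x_j a_j`. -/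
def cokerToA (p q : ℂ) : ℂ × RelCoker p q →ₗ[ℂ] A p q :=
  (LinearMap.toSpanSingleton ℂ (A p q) 1).coprod
    ((LinearMap.range (relMap p q (genMulLeft p q))).liftQ (sumMap (genMulLeft p q))
      relMap_range_le_ker_genMulLeft)

theorem cokerToA_mk (c : ℂ) (a : ZMod 3 → A p q) :
    cokerToA p q (c, Submodule.Quotient.mk a) = c • 1 + ∑ j, gen p q j * a j := by
  simp only [cokerToA, LinearMap.coprod_apply, LinearMap.toSpanSingleton_apply]
  congr 1

/-- The action of `x_i` on `ℂ ⊕ coker M`. -/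
def cokerAct (p q : ℂ) (i : ZMod 3) : Module.End ℂ (ℂ × RelCoker p q) :=
  LinearMap.inr ℂ ℂ (RelCoker p q) ∘ₗ Submodule.mkQ _ ∘ₗ
    LinearMap.single ℂ (fun _ : ZMod 3 => A p q) i ∘ₗ cokerToA p q

theorem cokerAct_apply (i : ZMod 3) (v : ℂ × RelCoker p q) :
    cokerAct p q i v = (0, Submodule.Quotient.mk (Pi.single i (cokerToA p q v))) := rfl

theorem cokerToA_cokerAct (i : ZMod 3) (v : ℂ × RelCoker p q) :
    cokerToA p q (cokerAct p q i v) = gen p q i * cokerToA p q v := by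
  rw [cokerAct_apply, cokerToA_mk, zero_smul, zero_add, Finset.sum_eq_single i]
  · simp
  · intro j _ hj
    simp [hj]
  · simp

theorem relMap_single {V W : Type*} [AddCommGroup V] [Module ℂ V] [AddCommGroup W] [Module ℂ W]
    (X : ZMod 3 → V →ₗ[ℂ] W) (i : ZMod 3) (v : V) :
    relMap p q X (Pi.single i v) = (Pi.single i (X (i + 1) v) : ZMod 3 → W) -
      q • (Pi.single (i + 1) (X i v) : ZMod 3 → W) -
      p • (Pi.single (i + 2) (X (i + 2) v) : ZMod 3 → W) := by
  have e : ∀ j, relMap p q X (Pi.single i v) j = relMatrix p q (fun l => X l v) i j := fun j => by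
    rw [relMap_apply, Finset.sum_eq_single i]
    · rw [Pi.single_eq_same, relMatrix_map_apply]
    · intro k _ hk
      rw [Pi.single_eq_of_ne hk, map_zero]
    · simp
  funext j
  rw [e]
  simp only [Pi.sub_apply, Pi.smul_apply]
  revert j
  revert i
  have e1 : (1 : ZMod 3) + 1 = 2 := rfl
  have e2 : (1 : ZMod 3) + 2 = 0 := rfl
  have e3 : (2 : ZMod 3) + 1 = 0 := rfl
  have e4 : (2 : ZMod 3) + 2 = 1 := rfl
  have e5 : (2 : ZMod 3) ≠ 0 := by decide
  have e6 : (2 : ZMod 3) ≠ 1 := by decide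
  refine forall_zmod_three (fun _ => ?_) (fun _ => ?_) (fun _ => ?_)
  · obtain ⟨h0, h1, h2⟩ := relMatrix_apply_zero p q (fun l => X l v)
    refine forall_zmod_three ?_ ?_ ?_ <;> simp only [h0, h1, h2] <;>
      simp [e5, e6, e5.symm, e6.symm]
  · obtain ⟨h0, h1, h2⟩ := relMatrix_apply_one p q (fun l => X l v)
    refine forall_zmod_three ?_ ?_ ?_ <;> simp only [h0, h1, h2] <;>
      simp [e1, e2, e5, e6, e5.symm, e6.symm]
  · obtain ⟨h0, h1, h2⟩ := relMatrix_apply_two p q (fun l => X l v)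
    refine forall_zmod_three ?_ ?_ ?_ <;> simp only [h0, h1, h2] <;>
      simp [e3, e4, e5, e6, e5.symm, e6.symm]

/-- Applied to v, the i-th relation gives the class of column i of the relation matrix times the
image of v in A, which is zero in the cokernel by construction. -/
theorem cokerAct_relation (i : ZMod 3) :
    cokerAct p q i * cokerAct p q (i + 1) - q • (cokerAct p q (i + 1) * cokerAct p q i) -
      p • (cokerAct p q (i + 2) * cokerAct p q (i + 2)) = 0 := by
  refine LinearMap.ext fun v => ?_
  simp only [LinearMap.sub_apply, LinearMap.smul_apply, Module.End.mul_apply]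
  rw [cokerAct_apply i, cokerAct_apply (i + 1) (cokerAct p q i v),
    cokerAct_apply (i + 2) (cokerAct p q (i + 2) v)]
  simp only [cokerToA_cokerAct]
  refine Prod.ext (by simp) ?_
  change (Submodule.Quotient.mk _ : RelCoker p q) - q • Submodule.Quotient.mk _ -
    p • Submodule.Quotient.mk _ = 0
  rw [← Submodule.Quotient.mk_smul, ← Submodule.Quotient.mk_smul, ← Submodule.Quotient.mk_sub,
    ← Submodule.Quotient.mk_sub, Submodule.Quotient.mk_eq_zero]
  exact ⟨Pi.single i (cokerToA p q v), relMap_single (genMulLeft p q) i _⟩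

/-- Every relation among the generators with coefficients on the right comes from the defining
relations. -/
theorem exists_relMap_eq {d : ZMod 3 → A p q} (hd : ∑ j, gen p q j * d j = 0) :
    ∃ g, relMap p q (genMulLeft p q) g = d := by
  set ρ : A p q →ₐ[ℂ] Module.End ℂ (ℂ × RelCoker p q) := liftA (cokerAct p q) cokerAct_relation
    with hρ
  have hν : ∀ (a : A p q) v, cokerToA p q (ρ a v) = a * cokerToA p q v := by
    intro a
    induction a using A_induction with
    | hC r =>
      intro v
      rw [AlgHom.commutes, Module.algebraMap_end_apply, map_smul, Algebra.smul_def]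
    | hX i => intro v; rw [hρ, liftA_gen, cokerToA_cokerAct]
    | hmul x y hx hy => intro v; rw [map_mul, Module.End.mul_apply, hx, hy, mul_assoc]
    | hadd x y hx hy => intro v; rw [map_add, LinearMap.add_apply, map_add, hx, hy, add_mul]
  have h1 : cokerToA p q (1, 0) = 1 := by
    have := cokerToA_mk (p := p) (q := q) 1 0
    simpa using this
  -- Each d_j sends (1, 0) to a vector whose image in A is d_j, and x_j then places d_j in slot j.
  -- The class of d is thus recovered from the single element ∑ x_j d_j of A.
  have h : ρ (∑ j, gen p q j * d j) (1, 0) = (0, Submodule.Quotient.mk d) := by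
    have e : ∀ j, ρ (gen p q j * d j) (1, 0) = LinearMap.inr ℂ ℂ (RelCoker p q)
        (Submodule.mkQ _ (LinearMap.single ℂ (fun _ : ZMod 3 => A p q) j (d j))) := fun j => by
      rw [map_mul, Module.End.mul_apply, hρ, liftA_gen, ← hρ, cokerAct_apply, hν, h1, mul_one]
      rfl
    rw [map_sum, LinearMap.sum_apply]
    simp only [e]
    rw [← map_sum, ← map_sum]
    change (0, _) = _
    congr 1
    change Submodule.Quotient.mk _ = _
    congr 1
    exact LinearMap.sum_single_apply (fun _ => A p q) d
  rw [hd, map_zero, LinearMap.zero_apply] at h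
  have := congrArg Prod.snd h
  exact (Submodule.Quotient.mk_eq_zero _).1 this.symm

/-- Left multiplication by the generators, as maps from degree `n` to degree `n + 1`. -/
def genMul (p q : ℂ) (n : ℕ) (i : ZMod 3) : F p q n →ₗ[ℂ] F p q (n + 1) :=
  (genMulLeft p q i).restrict fun _ ha => gen_mul_mem ha i

theorem coe_genMul (n : ℕ) (i : ZMod 3) (a : F p q n) :
    (genMul p q n i a : A p q) = gen p q i * a := rfl

theorem coe_sumMap_genMul (n : ℕ) (d : ZMod 3 → F p q n) :
    (sumMap (genMul p q n) d : A p q) = ∑ j, gen p q j * (d j : A p q) := by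
  rw [sumMap_apply, Submodule.coe_sum]; rfl

theorem sumMap_genMul_surjective (n : ℕ) : Function.Surjective (sumMap (genMul p q n)) := by
  rintro ⟨a, ha⟩
  obtain ⟨d, rfl⟩ := exists_eq_sum_of_mem_F_succ ha
  exact ⟨d, Subtype.ext (coe_sumMap_genMul n d)⟩

theorem coe_relMap_genMul (n : ℕ) (g : ZMod 3 → F p q n) (j : ZMod 3) :
    (relMap p q (genMul p q n) g j : A p q) =
      relMap p q (genMulLeft p q) (fun k => (g k : A p q)) j := by
  rw [relMap_apply, relMap_apply, Submodule.coe_sum]; rfl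

theorem sumMap_genMul_relMap (n : ℕ) (g : ZMod 3 → F p q n) :
    sumMap (genMul p q (n + 1)) (relMap p q (genMul p q n) g) = 0 := by
  refine Subtype.ext ?_
  rw [coe_sumMap_genMul]
  simp only [coe_relMap_genMul]
  have := relMap_range_le_ker_genMulLeft (p := p) (q := q) ⟨fun k => (g k : A p q), rfl⟩
  rw [LinearMap.mem_ker, sumMap_apply] at this
  exact this

theorem exists_relMap_genMul_eq {n : ℕ} {d : ZMod 3 → F p q (n + 1)}
    (hd : sumMap (genMul p q (n + 1)) d = 0) : ∃ g, relMap p q (genMul p q n) g = d := by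
  have h := congrArg Subtype.val hd
  rw [coe_sumMap_genMul] at h
  obtain ⟨g, hg⟩ := exists_relMap_eq h
  -- The preimage g need not be homogeneous, but M has entries of degree one, so its component of
  -- degree n already maps to d.
  refine ⟨fun k => ⟨gradeProj p q n (g k), gradeProj_mem n _⟩, funext fun j => Subtype.ext ?_⟩
  have e := gradeProj_of_mem (m := n + 1) (d j).2
  rw [if_pos rfl, ← congrFun hg j, relMap_apply, map_sum] at e
  rw [coe_relMap_genMul, relMap_apply, ← congrFun hg j, relMap_apply, ← e]
  refine Finset.sum_congr rfl fun k _ => ?_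
  simp only [relMatrix, LinearMap.smul_apply, map_smul, genMulLeft_apply, gradeProj_succ_gen_mul]

end

/-! ### The central element of degree three -/

/-- The cubic form giving the central element. -/
def cubicForm {R : Type*} [Ring R] [Algebra ℂ R] (p q : ℂ) (x y z : R) : R :=
  (-(p * (1 + q ^ 3))) • (x * (x * x) + y * (y * y) + z * (z * z)) +
    (q * (1 + p ^ 3)) • (z * (y * x) + y * (x * z) + x * (z * y)) +
    (p ^ 3 - q ^ 3) • (x * (y * z) + y * (z * x) + z * (x * y))

theorem cubicForm_rotate {R : Type*} [Ring R] [Algebra ℂ R] (p q : ℂ) (x y z : R) :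
    cubicForm p q y z x = cubicForm p q x y z := by
  simp only [cubicForm]
  congr 1
  · congr 1 <;> congr 1 <;> abel
  · congr 1; abel

/-- The commutator lies in the degree four part of the ideal of relations. `key` gives explicit
coefficients, with the relations kept as named factors r0, r1, r2 so that setting them to zero
finishes. Commutation with the other generators follows by cyclic symmetry. -/
theorem cubicForm_commute {R : Type*} [Ring R] [Algebra ℂ R] {p q : ℂ} {x y z : R}
    (h0 : x * y - q • (y * x) - p • (z * z) = 0) (h1 : y * z - q • (z * y) - p • (x * x) = 0)
    (h2 : z * x - q • (x * z) - p • (y * y) = 0) :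
    x * cubicForm p q x y z = cubicForm p q x y z * x := by
  have key : ∀ r0 r1 r2 : R, r0 = x * y - q • (y * x) - p • (z * z) →
      r1 = y * z - q • (z * y) - p • (x * x) → r2 = z * x - q • (x * z) - p • (y * y) →
      x * cubicForm p q x y z - cubicForm p q x y z * x =
      (3 * q) • (r0 * (x * z)) +
      (p ^ 3 - 2) • (r0 * (z * x)) +
      (-p ^ 3 + 2) • (x * r0 * z) +
      (-(3 * q * p)) • (y * r0 * y) +
      (-p ^ 3 - q ^ 3 + 1) • (z * r0 * x) +
      (p ^ 3 + q ^ 3 - 1) • (x * z * r0) +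
      (-(3 * q ^ 2)) • (z * x * r0) +
      (2 * p ^ 3 + q ^ 3) • (r1 * (x * x)) +
      (-(3 * p ^ 2)) • (r1 * (y * z)) +
      (-p ^ 3 + 2) • (x * r1 * x) +
      (-p ^ 3 - q ^ 3 - 2) • (x * x * r1) +
      (3 * p ^ 2) • (y * z * r1) +
      (3 * q ^ 2) • (r2 * (x * y)) +
      (-q ^ 3 - 1) • (r2 * (y * x)) +
      (q ^ 3 + 1) • (x * r2 * y) +
      (3 * q * p) • (z * r2 * z) +
      (-(3 * q)) • (y * x * r2) := by
    rintro _ _ _ rfl rfl rfl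
    simp only [cubicForm, mul_add, add_mul, mul_sub, sub_mul, smul_mul_assoc, mul_smul_comm,
      mul_assoc]
    module
  have := key 0 0 0 h0.symm h1.symm h2.symm
  simp only [mul_zero, zero_mul, smul_zero, add_zero] at this
  exact sub_eq_zero.1 this

/-- The central element of degree three. -/
def centralElt (p q : ℂ) : A p q := cubicForm p q (gen p q 0) (gen p q 1) (gen p q 2)

theorem centralElt_mem (p q : ℂ) : centralElt p q ∈ F p q 3 := by
  have h : ∀ i j k, gen p q i * (gen p q j * gen p q k) ∈ F p q 3 := fun i j k =>
    gen_mul_mem (gen_mul_mem (gen_mem_F k) j) i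
  have h3 : ∀ (c : ℂ) {x y z : A p q}, x ∈ F p q 3 → y ∈ F p q 3 → z ∈ F p q 3 →
      c • (x + y + z) ∈ F p q 3 := fun c _ _ _ hx hy hz =>
    Submodule.smul_mem _ c (Submodule.add_mem _ (Submodule.add_mem _ hx hy) hz)
  exact Submodule.add_mem _ (Submodule.add_mem _ (h3 _ (h _ _ _) (h _ _ _) (h _ _ _))
    (h3 _ (h _ _ _) (h _ _ _) (h _ _ _))) (h3 _ (h _ _ _) (h _ _ _) (h _ _ _))

theorem gen_mul_centralElt (p q : ℂ) (i : ZMod 3) :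
    gen p q i * centralElt p q = centralElt p q * gen p q i := by
  have h0 := gen_relation p q 0
  have h1 := gen_relation p q 1
  have h2 := gen_relation p q 2
  rw [zero_add, zero_add] at h0
  rw [show (1 : ZMod 3) + 1 = 2 from rfl, show (1 : ZMod 3) + 2 = 0 from rfl] at h1
  rw [show (2 : ZMod 3) + 1 = 0 from rfl, show (2 : ZMod 3) + 2 = 1 from rfl] at h2
  revert i
  refine forall_zmod_three ?_ ?_ ?_
  · exact cubicForm_commute h0 h1 h2
  · rw [centralElt, ← cubicForm_rotate]
    exact cubicForm_commute h1 h2 h0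
  · rw [centralElt, ← cubicForm_rotate, ← cubicForm_rotate]
    exact cubicForm_commute h2 h0 h1

theorem mul_centralElt {p q : ℂ} (a : A p q) : a * centralElt p q = centralElt p q * a := by
  induction a using A_induction with
  | hC r => exact Algebra.commutes r _
  | hX i => exact gen_mul_centralElt p q i
  | hmul x y hx hy => rw [mul_assoc, hy, ← mul_assoc, hx, mul_assoc]
  | hadd x y hx hy => rw [add_mul, mul_add, hx, hy]

/-- A cyclic functional on the words of length three. -/
def cyclicFunctional (a b d : ℂ) (i j k : ZMod 3) : ℂ :=
  if i = j ∧ j = k then d else if j = i + 1 ∧ k = i + 2 then a else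
    if j = i + 2 ∧ k = i + 1 then b else 0

/-- The functional is nonzero on words of m·r_i only for m = i + 2, where the three words take the
values a, b, d. For other m all three vanish. -/
theorem cyclicFunctional_relation_left {p q a b d : ℂ} (h : a - q * b - p * d = 0) (m i : ZMod 3) :
    cyclicFunctional a b d m i (i + 1) - q * cyclicFunctional a b d m (i + 1) i -
      p * cyclicFunctional a b d m (i + 2) (i + 2) = 0 := by
  revert m i
  refine forall_zmod_three ?_ ?_ ?_ <;> refine forall_zmod_three ?_ ?_ ?_ <;>
    simp +decide only [cyclicFunctional, if_true, if_false, mul_zero, sub_zero] <;>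
    linear_combination h

theorem cyclicFunctional_relation_right {p q a b d : ℂ} (h : a - q * b - p * d = 0) (i m : ZMod 3) :
    cyclicFunctional a b d i (i + 1) m - q * cyclicFunctional a b d (i + 1) i m -
      p * cyclicFunctional a b d (i + 2) (i + 2) m = 0 := by
  revert i m
  refine forall_zmod_three ?_ ?_ ?_ <;> refine forall_zmod_three ?_ ?_ ?_ <;>
    simp +decide only [cyclicFunctional, if_true, if_false, mul_zero, sub_zero] <;>
    linear_combination h

/-- The operators of a representation of `A_{p,q}` on `ℂ ⊕ ℂ³ ⊕ ℂ³ ⊕ ℂ` whose products of length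
three are given by a functional on words. -/
def wordOp (L : ZMod 3 → ZMod 3 → ZMod 3 → ℂ) (i : ZMod 3) :
    Module.End ℂ (ℂ × (ZMod 3 → ℂ) × (ZMod 3 → ℂ) × ℂ) where
  toFun v := (0, v.1 • Pi.single i 1, fun m => ∑ k, v.2.1 k * L m i k, v.2.2.1 i)
  map_add' v w := by
    refine Prod.ext (by simp) (Prod.ext ?_ (Prod.ext (funext fun m => ?_) ?_))
    · simp [add_smul]
    · simp [add_mul, Finset.sum_add_distrib]
    · simp
  map_smul' c v := by
    refine Prod.ext (by simp) (Prod.ext ?_ (Prod.ext (funext fun m => ?_) ?_))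
    · simp [mul_smul]
    · simp [mul_assoc, Finset.mul_sum]
    · simp

theorem wordOp_apply (L : ZMod 3 → ZMod 3 → ZMod 3 → ℂ) (i : ZMod 3)
    (v : ℂ × (ZMod 3 → ℂ) × (ZMod 3 → ℂ) × ℂ) : wordOp L i v =
      (0, v.1 • Pi.single i 1, fun m => ∑ k, v.2.1 k * L m i k, v.2.2.1 i) := rfl

theorem wordOp_wordOp_apply (L : ZMod 3 → ZMod 3 → ZMod 3 → ℂ) (i j : ZMod 3)
    (v : ℂ × (ZMod 3 → ℂ) × (ZMod 3 → ℂ) × ℂ) : wordOp L i (wordOp L j v) =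
      (0, 0, fun m => v.1 * L m i j, ∑ k, v.2.1 k * L i j k) := by
  simp only [wordOp_apply]
  refine Prod.ext rfl (Prod.ext (by simp) (Prod.ext (funext fun m => ?_) rfl))
  simp [Pi.single_apply]

theorem wordOp_relation {p q : ℂ} {L : ZMod 3 → ZMod 3 → ZMod 3 → ℂ}
    (h1 : ∀ m i, L m i (i + 1) - q * L m (i + 1) i - p * L m (i + 2) (i + 2) = 0)
    (h2 : ∀ i m, L i (i + 1) m - q * L (i + 1) i m - p * L (i + 2) (i + 2) m = 0) (i : ZMod 3) :
    wordOp L i * wordOp L (i + 1) - q • (wordOp L (i + 1) * wordOp L i) -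
      p • (wordOp L (i + 2) * wordOp L (i + 2)) = 0 := by
  refine LinearMap.ext fun v => ?_
  simp only [LinearMap.sub_apply, LinearMap.smul_apply, Module.End.mul_apply, wordOp_wordOp_apply]
  refine Prod.ext (by simp) (Prod.ext (by simp) (Prod.ext (funext fun m => ?_) ?_))
  · change v.1 * _ - q * (v.1 * _) - p * (v.1 * _) = 0
    linear_combination v.1 * h1 m i
  · change (∑ k, v.2.1 k * _) - q * (∑ k, v.2.1 k * _) - p * (∑ k, v.2.1 k * _) = 0
    rw [Finset.mul_sum, Finset.mul_sum, ← Finset.sum_sub_distrib, ← Finset.sum_sub_distrib]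
    exact Finset.sum_eq_zero fun k _ => by linear_combination v.2.1 k * h2 i k

theorem wordOp_prod_apply (L : ZMod 3 → ZMod 3 → ZMod 3 → ℂ) (i j k : ZMod 3) :
    ((wordOp L i * (wordOp L j * wordOp L k)) (1, 0, 0, 0)).2.2.2 = L i j k := by
  rw [Module.End.mul_apply, Module.End.mul_apply, wordOp_wordOp_apply, wordOp_apply]
  simp [Pi.single_apply]

/-- Cyclic functionals with a = qb + pd kill all relations in degree three, and `wordOp` realizes
each by a finite-dimensional representation, so nonvanishing can be tested without a basis of A. If
the central element were zero, the free parameters b and d would give 1 + 2p³ = q³ and 1 + 2q³ = p³,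
so p³ = q³ = -1. -/
theorem centralElt_ne_zero {p q : ℂ} (hp : p ≠ 0) (hq : q ≠ 0) (h : ¬ (p ^ 3 = -1 ∧ q ^ 3 = -1)) :
    centralElt p q ≠ 0 := by
  intro h0
  have key : ∀ b d : ℂ, d * (p * (1 + 2 * q ^ 3 - p ^ 3)) = b * (q * (1 + 2 * p ^ 3 - q ^ 3)) := by
    intro b d
    set L := cyclicFunctional (q * b + p * d) b d with hL
    have hrel : (q * b + p * d) - q * b - p * d = 0 := by ring
    set ρ := liftA (p := p) (q := q) (wordOp L) (wordOp_relation
      (cyclicFunctional_relation_left hrel) (cyclicFunctional_relation_right hrel)) with hρ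
    have h1 : ρ (centralElt p q) = cubicForm p q (wordOp L 0) (wordOp L 1) (wordOp L 2) := by
      simp only [centralElt, cubicForm, map_add, map_smul, map_mul, hρ, liftA_gen]
    rw [h0, map_zero] at h1
    have h2 := congrArg (fun f : Module.End ℂ (ℂ × (ZMod 3 → ℂ) × (ZMod 3 → ℂ) × ℂ) =>
      (f (1, 0, 0, 0)).2.2.2) h1
    simp only [cubicForm, LinearMap.add_apply, LinearMap.smul_apply, Prod.snd_add, Prod.smul_snd,
      smul_eq_mul, wordOp_prod_apply, LinearMap.zero_apply, Prod.snd_zero] at h2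
    have ed : ∀ i, L i i i = d := fun i => by simp [hL, cyclicFunctional]
    have ea : L 0 1 2 = q * b + p * d ∧ L 1 2 0 = q * b + p * d ∧ L 2 0 1 = q * b + p * d := by
      refine ⟨?_, ?_, ?_⟩ <;> rw [hL, cyclicFunctional, if_neg (by decide), if_pos (by decide)]
    have eb : L 2 1 0 = b ∧ L 1 0 2 = b ∧ L 0 2 1 = b := by
      refine ⟨?_, ?_, ?_⟩ <;>
        rw [hL, cyclicFunctional, if_neg (by decide), if_neg (by decide), if_pos (by decide)]
    simp only [ed, ea.1, ea.2.1, ea.2.2, eb.1, eb.2.1, eb.2.2] at h2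
    linear_combination (1 / 3) * h2
  have k1 := key 0 1
  have k2 := key 1 0
  rw [one_mul, zero_mul] at k1 k2
  have k1 := (mul_eq_zero.1 k1).resolve_left hp
  have k2 := (mul_eq_zero.1 k2.symm).resolve_left hq
  exact h ⟨by linear_combination (1 / 3) * k1 + (2 / 3) * k2,
    by linear_combination (2 / 3) * k1 + (1 / 3) * k2⟩

section

/-! ### The homomorphism to the algebra of theta functions -/

theorem of_theta3_mul_of {τ : ℂ} (hτ : 0 < τ.im) (η : ℂ) (n : ℕ) (i : ZMod 3)
    (b : TwistedTheta τ η n) :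
    (DirectSum.of (fun α => TwistedTheta τ η α) 1 ⟨theta3 τ i, theta3_mem_twisted hτ η i⟩ *
      DirectSum.of (fun α => TwistedTheta τ η α) n b : ThetaAlgebra τ η) =
      DirectSum.of (fun α => TwistedTheta τ η α) (n + 1) (shiftMul hτ η n i b) := by
  rw [DirectSum.of_mul_of]
  refine DirectSum.of_eq_of_gradedMonoid_eq (twisted_ext _ _ (add_comm 1 n) (funext fun u => ?_))
  change theta3 τ i u * (b : ℂ → ℂ) (u - (1 : ℕ) * η) = theta3 τ i u * (b : ℂ → ℂ) (u - η)
  simp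

theorem of_smul (τ η : ℂ) (n : ℕ) (c : ℂ) (b : TwistedTheta τ η n) :
    (DirectSum.of (fun α => TwistedTheta τ η α) n (c • b) : ThetaAlgebra τ η) =
      c • DirectSum.of (fun α => TwistedTheta τ η α) n b :=
  map_smul (DirectSum.lof ℂ ℕ (fun α => TwistedTheta τ η α) n) c b

/-- Algebra homomorphisms from `A_{p,q}` to an algebra given without a subtraction. -/
def liftSemiring {p q : ℂ} {R : Type*} [Semiring R] [Algebra ℂ R] (y : ZMod 3 → R)
    (h : ∀ i, y i * y (i + 1) = q • (y (i + 1) * y i) + p • (y (i + 2) * y (i + 2))) :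
    A p q →ₐ[ℂ] R :=
  letI := Algebra.semiringToRing ℂ (A := R)
  liftA y fun i => by rw [h, add_sub_cancel_left, sub_self]

theorem liftSemiring_gen {p q : ℂ} {R : Type*} [Semiring R] [Algebra ℂ R] (y : ZMod 3 → R)
    (h : ∀ i, y i * y (i + 1) = q • (y (i + 1) * y i) + p • (y (i + 2) * y (i + 2)))
    (i : ZMod 3) : liftSemiring y h (gen p q i) = y i :=
  letI := Algebra.semiringToRing ℂ (A := R)
  liftA_gen y _ i

/-- The homomorphism `x_i ↦ θ_i`. -/
def toTheta {τ η : ℂ} (hτ : 0 < τ.im) (hη : ∀ a b : ℤ, 3 * η ≠ (a : ℂ) + (b : ℂ) * τ) :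
    Q3 τ η →ₐ[ℂ] ThetaAlgebra τ η :=
  liftSemiring (fun i => DirectSum.of (fun α => TwistedTheta τ η α) 1
    ⟨theta3 τ i, theta3_mem_twisted hτ η i⟩) fun i => by
    rw [of_theta3_mul_of hτ η 1, of_theta3_mul_of hτ η 1, of_theta3_mul_of hτ η 1, ← of_smul,
      ← of_smul, ← map_add]
    refine congrArg _ (Subtype.ext (funext fun u => ?_))
    have h := theta3_relation hτ hη i u
    rw [sub_sub, sub_eq_zero] at h
    exact h

variable {τ η : ℂ} (hτ : 0 < τ.im) (hη : ∀ a b : ℤ, 3 * η ≠ (a : ℂ) + (b : ℂ) * τ)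

theorem toTheta_gen (i : ZMod 3) : toTheta hτ hη (gen _ _ i) =
    DirectSum.of (fun α => TwistedTheta τ η α) 1 ⟨theta3 τ i, theta3_mem_twisted hτ η i⟩ :=
  liftSemiring_gen _ _ i

/-- The component of degree `n` of the homomorphism to theta functions. -/
def toThetaDeg (n : ℕ) : F (paramP τ η) (paramQ τ η) n →ₗ[ℂ] TwistedTheta τ η n :=
  DirectSum.component ℂ ℕ (fun α => TwistedTheta τ η α) n ∘ₗ (toTheta hτ hη).toLinearMap ∘ₗ
    (F (paramP τ η) (paramQ τ η) n).subtype

theorem exists_toTheta_eq_of {n : ℕ} {a : Q3 τ η} (ha : a ∈ F (paramP τ η) (paramQ τ η) n) :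
    ∃ b, toTheta hτ hη a = DirectSum.of (fun α => TwistedTheta τ η α) n b := by
  induction n generalizing a with
  | zero =>
    obtain ⟨c, rfl⟩ := mem_F_zero.1 ha
    refine ⟨c • (instGOne τ η).one, ?_⟩
    rw [map_smul, map_one, of_smul]
    rfl
  | succ n ih =>
    obtain ⟨d, rfl⟩ := exists_eq_sum_of_mem_F_succ ha
    choose b hb using fun j => ih (d j).2
    refine ⟨∑ j, shiftMul hτ η n j (b j), ?_⟩
    rw [map_sum, map_sum]
    refine Finset.sum_congr rfl fun j _ => ?_
    rw [map_mul, hb, toTheta_gen, of_theta3_mul_of]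

theorem toTheta_coe {n : ℕ} (a : F (paramP τ η) (paramQ τ η) n) :
    toTheta hτ hη a = DirectSum.of (fun α => TwistedTheta τ η α) n (toThetaDeg hτ hη n a) := by
  obtain ⟨b, hb⟩ := exists_toTheta_eq_of hτ hη a.2
  have h : toThetaDeg hτ hη n a = b := by
    change DirectSum.component ℂ ℕ (fun α => TwistedTheta τ η α) n (toTheta hτ hη a) = b
    rw [hb]
    exact DirectSum.component.lof_self ℂ (ι := ℕ) (M := fun α => TwistedTheta τ η α) n b
  rw [h, hb]

theorem toTheta_eq_zero_iff {n : ℕ} (a : F (paramP τ η) (paramQ τ η) n) :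
    toTheta hτ hη a = 0 ↔ toThetaDeg hτ hη n a = 0 := by
  rw [toTheta_coe]
  exact map_eq_zero_iff _ (DirectSum.of_injective n)

theorem toThetaDeg_genMul {n : ℕ} (i : ZMod 3) (a : F (paramP τ η) (paramQ τ η) n) :
    toThetaDeg hτ hη (n + 1) (genMul _ _ n i a) = shiftMul hτ η n i (toThetaDeg hτ hη n a) := by
  refine DirectSum.of_injective (β := fun α => TwistedTheta τ η α) (n + 1) ?_
  rw [← toTheta_coe, coe_genMul, map_mul, toTheta_coe, toTheta_gen, of_theta3_mul_of]

theorem toThetaDeg_sumMap {n : ℕ} (d : ZMod 3 → F (paramP τ η) (paramQ τ η) n) :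
    toThetaDeg hτ hη (n + 1) (sumMap (genMul _ _ n) d) =
      sumMap (shiftMul hτ η n) fun j => toThetaDeg hτ hη n (d j) := by
  simp only [sumMap_apply, map_sum, toThetaDeg_genMul]

theorem toThetaDeg_relMap {n : ℕ} (g : ZMod 3 → F (paramP τ η) (paramQ τ η) n) (j : ZMod 3) :
    toThetaDeg hτ hη (n + 1) (relMap (paramP τ η) (paramQ τ η) (genMul _ _ n) g j) =
      relMap (paramP τ η) (paramQ τ η) (shiftMul hτ η n) (fun k => toThetaDeg hτ hη n (g k)) j := by
  simp only [relMap_apply, map_sum, relMatrix, LinearMap.smul_apply, map_smul, toThetaDeg_genMul]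

theorem toThetaDeg_zero_one :
    (toThetaDeg hτ hη 0 ⟨1, one_mem_F⟩ : ℂ → ℂ) = fun _ => 1 := by
  have h : toThetaDeg hτ hη 0 ⟨1, one_mem_F⟩ = ⟨fun _ => 1, const_mem τ η 1⟩ := by
    refine DirectSum.of_injective (β := fun α => TwistedTheta τ η α) 0 ?_
    rw [← toTheta_coe]
    exact map_one _
  rw [h]

theorem toThetaDeg_gen (i : ZMod 3) :
    (toThetaDeg hτ hη 1 ⟨gen _ _ i, gen_mem_F i⟩ : ℂ → ℂ) = theta3 τ i := by
  have h : toThetaDeg hτ hη 1 ⟨gen _ _ i, gen_mem_F i⟩ =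
      ⟨theta3 τ i, theta3_mem_twisted hτ η i⟩ := by
    refine DirectSum.of_injective (β := fun α => TwistedTheta τ η α) 1 ?_
    rw [← toTheta_coe]
    exact toTheta_gen hτ hη i
  rw [h]

/-- Degree zero consists of constants and degree one is spanned by the θ_i. These are separate cases
because the pencil argument starts from degree one. -/
theorem toThetaDeg_surjective (n : ℕ) : Function.Surjective (toThetaDeg hτ hη n) := by
  induction n using Nat.strong_induction_on with
  | _ n ih =>
    match n with
    | 0 =>
      intro f
      refine ⟨(f : ℂ → ℂ) 0 • ⟨1, one_mem_F⟩, Subtype.ext (funext fun u => ?_)⟩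
      rw [map_smul, Submodule.coe_smul, toThetaDeg_zero_one, twisted_zero_const hτ f.2 u]
      simp
    | 1 =>
      intro f
      obtain ⟨c, hc⟩ := exists_eq_sum_theta3 hτ (Theta_congr (by simp) f.2)
      refine ⟨∑ i, c i • ⟨gen _ _ i, gen_mem_F i⟩, Subtype.ext (funext fun u => ?_)⟩
      rw [map_sum, Submodule.coe_sum, Finset.sum_apply, hc]
      refine Finset.sum_congr rfl fun i _ => ?_
      rw [map_smul, Submodule.coe_smul, toThetaDeg_gen]; rfl
    | n + 2 =>
      intro f
      obtain ⟨b, rfl⟩ := sumMap_shiftMul_surjective hτ hη n f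
      choose d hd using fun j => ih (n + 1) (by omega) (b j)
      exact ⟨sumMap (genMul _ _ (n + 1)) d, by
        rw [toThetaDeg_sumMap]; exact congrArg _ (funext hd)⟩

/-! ### The kernel of the homomorphism -/

theorem toThetaDeg_zero_injective : Function.Injective (toThetaDeg hτ hη 0) := by
  refine (injective_iff_map_eq_zero _).2 fun a ha => ?_
  obtain ⟨c, hc⟩ := mem_F_zero.1 a.2
  obtain rfl : c • ⟨1, one_mem_F⟩ = a := Subtype.ext hc
  have := congrFun (congrArg Subtype.val ha) 0
  rw [map_smul, Submodule.coe_smul, toThetaDeg_zero_one] at this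
  have hc0 : c = 0 := by simpa using this
  rw [hc0, zero_smul]

theorem toThetaDeg_one_injective : Function.Injective (toThetaDeg hτ hη 1) := by
  refine (injective_iff_map_eq_zero _).2 fun a ha => ?_
  obtain ⟨d, rfl⟩ := sumMap_genMul_surjective 0 a
  rw [toThetaDeg_sumMap] at ha
  have hd : d = 0 := funext fun j => by
    refine (injective_iff_map_eq_zero _).1 (toThetaDeg_zero_injective hτ hη) _
      (Subtype.ext (funext fun u => ?_))
    rw [twisted_zero_const hτ (toThetaDeg hτ hη 0 (d j)).2 u]
    refine theta3_linearIndependent hτ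
      (c := fun j => (toThetaDeg hτ hη 0 (d j) : ℂ → ℂ) 0) (fun z => ?_) j
    have := congrFun (congrArg Subtype.val ha) z
    rw [sumMap_shiftMul_apply] at this
    refine Eq.trans ?_ this
    refine Finset.sum_congr rfl fun k _ => ?_
    rw [twisted_zero_const hτ (toThetaDeg hτ hη 0 (d k)).2 (z - η), mul_comm]
  rw [hd, map_zero]

/-- An element of `ker φ` is `∑_j x_j e_j` with `e_j ∈ ker φ`, up to the syzygies among the theta
functions that do not come from the defining relations. -/
theorem exists_eq_sumMap_of_mem_range {n : ℕ}
    (d : ZMod 3 → F (paramP τ η) (paramQ τ η) (n + 1))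
    (hd : (fun j => toThetaDeg hτ hη (n + 1) (d j)) ∈
      LinearMap.range (relMap (paramP τ η) (paramQ τ η) (shiftMul hτ η n))) :
    ∃ e : ZMod 3 → F (paramP τ η) (paramQ τ η) (n + 1),
      (∀ j, toThetaDeg hτ hη (n + 1) (e j) = 0) ∧
      sumMap (genMul _ _ (n + 1)) d = sumMap (genMul _ _ (n + 1)) e := by
  obtain ⟨g, hg⟩ := hd
  choose g' hg' using fun k => toThetaDeg_surjective hτ hη n (g k)
  refine ⟨d - relMap (paramP τ η) (paramQ τ η) (genMul _ _ n) g', fun j => ?_, ?_⟩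
  · rw [Pi.sub_apply, map_sub, toThetaDeg_relMap, sub_eq_zero]
    simp only [hg']
    exact (congrFun hg j).symm
  · rw [map_sub, sumMap_genMul_relMap, sub_zero]

/-- The complex of theta functions is exact in its lowest degree, so the syzygies of the θ_i there
are exactly the defining relations. -/
theorem toThetaDeg_two_injective : Function.Injective (toThetaDeg hτ hη 2) := by
  refine (injective_iff_map_eq_zero _).2 fun a ha => ?_
  obtain ⟨d, rfl⟩ := sumMap_genMul_surjective 1 a
  rw [toThetaDeg_sumMap] at ha
  obtain ⟨e, he, h⟩ := exists_eq_sumMap_of_mem_range hτ hη (n := 0) d (by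
    rw [relMap_range_eq hτ hη (by norm_num)]; exact ha)
  have : e = 0 := funext fun j =>
    (injective_iff_map_eq_zero _).1 (toThetaDeg_one_injective hτ hη) _ (he j)
  exact h.trans (by rw [this, map_zero])

end

section

variable {τ η : ℂ} (hτ : 0 < τ.im) (hη : ∀ a b : ℤ, 3 * η ≠ (a : ℂ) + (b : ℂ) * τ)

/-! ### The central element is in the kernel -/

theorem theta3_two_zero_ne_zero {τ : ℂ} (hτ : 0 < τ.im) : theta3 τ 2 0 ≠ 0 := by
  have h1 := theta3_zero_one_coprime hτ (theta3_zero_apply_zero τ)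
  have h := theta3_one_neg hτ 0
  rw [neg_zero] at h
  intro h2
  rw [h2] at h
  exact h1 (by simpa using h)

/-- Translation by `-3η` is not proportional to the identity in the embedding given by
`θ_0, θ_1, θ_2`. -/
theorem exists_theta3_bracket_ne_zero {τ η : ℂ} (hτ : 0 < τ.im)
    (hη : ∀ a b : ℤ, 3 * η ≠ (a : ℂ) + (b : ℂ) * τ) :
    ∃ i j u, theta3 τ j u * theta3 τ i (u - 3 * η) - theta3 τ i u * theta3 τ j (u - 3 * η) ≠ 0 := by
  by_contra! h
  have h1 := theta3_zero_one_coprime hτ (theta3_zero_apply_zero τ)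
  have h2 := theta3_two_zero_ne_zero hτ
  have h01 := h 0 1 0
  rw [theta3_zero_apply_zero, zero_mul, sub_zero, zero_sub] at h01
  have h0 := (mul_eq_zero.1 h01).resolve_left h1
  obtain ⟨a, b, hab⟩ := (theta3_eq_zero_iff hτ 0 _).1 h0
  have hab : -(3 * η) = a / 3 + b * τ := by simpa using hab
  have h12 := h 2 1 0
  rw [zero_sub] at h12
  -- Vanishing at u = 0 already puts -3η in ⅓ℤ + ℤτ. Modulo the lattice it is r/3, where g takes the
  -- value θ_1(0)θ_2(0)(ω^{2r} - ω^r). This is nonzero unless r = 0, and r = 0 would make 3η a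
  -- period.
  set g : ℂ → ℂ := theta3 τ 1 0 • theta3 τ 2 - theta3 τ 2 0 • theta3 τ 1 with hg
  have hgm : g ∈ Theta τ 3 0 :=
    Submodule.sub_mem _ (Submodule.smul_mem _ _ (theta3_mem hτ 2))
      (Submodule.smul_mem _ _ (theta3_mem hτ 1))
  have ha : (a : ℂ) = ((a % 3 : ℤ) : ℂ) + 3 * ((a / 3 : ℤ) : ℂ) := by
    exact_mod_cast (Int.emod_add_mul_ediv a 3).symm
  have hgr : g (((a % 3 : ℤ) : ℂ) / 3) = 0 := by
    refine Theta_eq_zero_of_isPeriod hgm (z := -(3 * η)) ?_ ⟨-(a / 3), -b, ?_⟩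
    · simpa [hg] using h12
    · rw [hab, ha]; push_cast; ring
  have s1 : ∀ i, theta3 τ i (1 / 3) = zeta3 ^ i.val * theta3 τ i 0 := fun i => by
    simpa using theta3_add_third hτ i 0
  have s2 : ∀ i, theta3 τ i (2 / 3) = zeta3 ^ i.val * (zeta3 ^ i.val * theta3 τ i 0) := fun i => by
    rw [← s1, ← theta3_add_third hτ i]; norm_num
  have v1 : (1 : ZMod 3).val = 1 := rfl
  have v2 : (2 : ZMod 3).val = 2 := rfl
  have hz : zeta3 - 1 ≠ 0 := sub_ne_zero.2 zeta3_ne_one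
  have h3 := zeta3_pow_three
  have hr : a % 3 = 0 ∨ a % 3 = 1 ∨ a % 3 = 2 := by omega
  rcases hr with hr | hr | hr
  · rw [hr] at ha
    refine hη (-(a / 3)) (-b) ?_
    rw [ha] at hab
    push_cast at hab ⊢
    linear_combination -hab
  · rw [hr] at hgr
    have e : theta3 τ 1 0 * theta3 τ 2 0 * zeta3 * (zeta3 - 1) = 0 := by
      simp only [hg, Pi.sub_apply, Pi.smul_apply, smul_eq_mul, Int.cast_one, s1, v1, v2] at hgr
      linear_combination hgr
    exact (mul_ne_zero (mul_ne_zero (mul_ne_zero h1 h2) zeta3_ne_zero) hz) e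
  · rw [hr] at hgr
    have e : theta3 τ 1 0 * theta3 τ 2 0 * zeta3 * (zeta3 - 1) = 0 := by
      simp only [hg, Pi.sub_apply, Pi.smul_apply, smul_eq_mul, Int.cast_ofNat, s2, v1, v2] at hgr
      linear_combination -hgr + theta3 τ 1 0 * theta3 τ 2 0 * zeta3 * h3
    exact (mul_ne_zero (mul_ne_zero (mul_ne_zero h1 h2) zeta3_ne_zero) hz) e

theorem of_mul_of_theta3 {τ : ℂ} (hτ : 0 < τ.im) (η : ℂ) (n : ℕ) (i : ZMod 3)
    (b : TwistedTheta τ η n) :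
    (DirectSum.of (fun α => TwistedTheta τ η α) n b *
      DirectSum.of (fun α => TwistedTheta τ η α) 1 ⟨theta3 τ i, theta3_mem_twisted hτ η i⟩ :
        ThetaAlgebra τ η) =
      DirectSum.of (fun α => TwistedTheta τ η α) (n + 1)
        ⟨twistedMul η n b (theta3 τ i), twistedMul_mem b.2 (theta3_mem_twisted hτ η i)⟩ :=
  DirectSum.of_mul_of _ _

/-- Centrality alone suffices: eliminating c(u - η) between θ_i(u) c(u - η) = c(u) θ_i(u - 3η) for
two indices leaves c times a bracket that is not identically zero. No cubic theta identity is
computed. -/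
theorem toTheta_centralElt : toTheta hτ hη (centralElt _ _) = 0 := by
  set C : F (paramP τ η) (paramQ τ η) 3 := ⟨_, centralElt_mem _ _⟩ with hC
  set c := toThetaDeg hτ hη 3 C with hc
  have key : ∀ i u, theta3 τ i u * (c : ℂ → ℂ) (u - η) =
      (c : ℂ → ℂ) u * theta3 τ i (u - 3 * η) := fun i u => by
    have h := congrArg (toTheta hτ hη) (mul_centralElt (gen (paramP τ η) (paramQ τ η) i))
    rw [map_mul, map_mul, toTheta_gen, show centralElt _ _ = (C : Q3 τ η) from rfl, toTheta_coe,
      of_theta3_mul_of hτ, of_mul_of_theta3 hτ] at h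
    have := congrFun (f := fun u => theta3 τ i u * (c : ℂ → ℂ) (u - η))
      (congrArg Subtype.val (DirectSum.of_injective (β := fun α => TwistedTheta τ η α) (3 + 1) h)) u
    simpa [twistedMul] using this
  obtain ⟨i, j, v, hv⟩ := exists_theta3_bracket_ne_zero hτ hη
  have hd : ∀ k, Differentiable ℂ (theta3 τ k) := fun k => (theta3_mem hτ k).1
  have hd' : ∀ k, Differentiable ℂ fun u => theta3 τ k (u - 3 * η) :=
    fun k => (hd k).comp (differentiable_id.sub_const _)
  have h0 : ∀ u, (c : ℂ → ℂ) u = 0 := by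
    refine (entire_mul_eq_zero c.2.1 (g := fun u => theta3 τ j u * theta3 τ i (u - 3 * η) -
      theta3 τ i u * theta3 τ j (u - 3 * η))
      (((hd j).mul (hd' i)).sub ((hd i).mul (hd' j))) fun u => ?_).resolve_right fun h => hv (h v)
    linear_combination -theta3 τ j u * key i u + theta3 τ i u * key j u
  change toTheta hτ hη C = 0
  rw [toTheta_eq_zero_iff]
  exact Subtype.ext (funext h0)

/-! ### The kernel is generated by the central element -/

theorem mul_centralElt_mem {p q : ℂ} {n : ℕ} {a : A p q} (ha : a ∈ F p q n) :
    a * centralElt p q ∈ F p q (n + 3) := by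
  induction n generalizing a with
  | zero =>
    obtain ⟨c, rfl⟩ := mem_F_zero.1 ha
    rw [smul_mul_assoc, one_mul]
    exact Submodule.smul_mem _ c (centralElt_mem p q)
  | succ n ih =>
    obtain ⟨d, rfl⟩ := exists_eq_sum_of_mem_F_succ ha
    rw [Finset.sum_mul, show n + 1 + 3 = n + 3 + 1 by ring]
    refine Submodule.sum_mem _ fun j _ => ?_
    rw [mul_assoc]
    exact gen_mul_mem (ih (d j).2) j

/-- Multiplication by the central element. -/
def mulCentral (p q : ℂ) (n : ℕ) : F p q n →ₗ[ℂ] F p q (n + 3) :=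
  (LinearMap.mulRight ℂ (centralElt p q)).restrict fun _ ha => mul_centralElt_mem ha

theorem coe_mulCentral {p q : ℂ} {n : ℕ} (a : F p q n) :
    (mulCentral p q n a : A p q) = a * centralElt p q := rfl

theorem centralElt_param_ne_zero {τ η : ℂ} (hτ : 0 < τ.im)
    (hη : ∀ a b : ℤ, 3 * η ≠ (a : ℂ) + (b : ℂ) * τ) :
    centralElt (paramP τ η) (paramQ τ η) ≠ 0 :=
  centralElt_ne_zero (paramP_ne_zero hτ hη) (paramQ_ne_zero hτ hη) (param_nondegenerate hτ hη)

/-- Syzygies coming from the relation matrix lift to zero in A, because φ is injective in degree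
two. They have codimension at most one among all syzygies. The syzygy of C is outside them since C ≠
0, so it accounts for the rest. -/
theorem ker_toThetaDeg_three {a : F (paramP τ η) (paramQ τ η) 3} (ha : toThetaDeg hτ hη 3 a = 0) :
    ∃ t : ℂ, (a : Q3 τ η) = t • centralElt _ _ := by
  have := twisted_finite hτ η 2
  set C : F (paramP τ η) (paramQ τ η) 3 := ⟨_, centralElt_mem _ _⟩ with hC
  have hCk : toThetaDeg hτ hη 3 C = 0 :=
    (toTheta_eq_zero_iff hτ hη C).1 (toTheta_centralElt hτ hη)
  obtain ⟨d, rfl⟩ := sumMap_genMul_surjective 2 a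
  obtain ⟨e, he⟩ := sumMap_genMul_surjective 2 C
  rw [← he, toThetaDeg_sumMap] at hCk
  rw [toThetaDeg_sumMap] at ha
  have hz : ∀ d : ZMod 3 → F (paramP τ η) (paramQ τ η) 2,
      (fun j => toThetaDeg hτ hη 2 (d j)) ∈
        LinearMap.range (relMap (paramP τ η) (paramQ τ η) (shiftMul hτ η 1)) →
      sumMap (genMul _ _ 2) d = 0 := fun d hd => by
    obtain ⟨e, he, h⟩ := exists_eq_sumMap_of_mem_range hτ hη d hd
    have : e = 0 := funext fun j =>
      (injective_iff_map_eq_zero _).1 (toThetaDeg_two_injective hτ hη) _ (he j)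
    rw [h, this, map_zero]
  obtain ⟨t, ht⟩ := exists_sub_smul_mem_of_finrank_le
    (relMap_range_le hτ hη 1) (finrank_relMap_range_one hτ hη)
    (c := fun j => toThetaDeg hτ hη 2 (e j)) hCk (fun h => by
      have h0 := hz e h
      rw [he] at h0
      exact centralElt_param_ne_zero hτ hη (congrArg Subtype.val h0))
    (b := fun j => toThetaDeg hτ hη 2 (d j)) ha
  have h := hz (d - t • e) (by
    convert ht using 1
    funext j
    simp)
  rw [map_sub, map_smul, he, sub_eq_zero] at h
  exact ⟨t, congrArg Subtype.val h⟩

/-- Beyond degree three the complex for B is exact, so an element of the kernel is ∑ x_j e_j with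
e_j in the kernel one degree lower. By induction e_j = b_j C, and C factors out on the right. -/
theorem ker_toThetaDeg_add_three (m : ℕ) {a : F (paramP τ η) (paramQ τ η) (m + 3)}
    (ha : toThetaDeg hτ hη (m + 3) a = 0) : ∃ b, mulCentral _ _ m b = a := by
  induction m with
  | zero =>
    obtain ⟨t, ht⟩ := ker_toThetaDeg_three hτ hη ha
    refine ⟨t • ⟨1, one_mem_F⟩, Subtype.ext ?_⟩
    rw [coe_mulCentral, ht, Submodule.coe_smul, smul_mul_assoc, one_mul]
  | succ m ih =>
    obtain ⟨d, rfl⟩ := sumMap_genMul_surjective (m + 3) a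
    have ha' := ha
    rw [toThetaDeg_sumMap] at ha'
    obtain ⟨e, he, h⟩ := exists_eq_sumMap_of_mem_range hτ hη (n := m + 2) d (by
      rw [relMap_range_eq hτ hη (by omega)]; exact ha')
    choose b hb using fun j => ih (he j)
    refine ⟨sumMap (genMul _ _ m) b, Subtype.ext ?_⟩
    refine Eq.trans ?_ (congrArg Subtype.val h).symm
    rw [coe_mulCentral, coe_sumMap_genMul, coe_sumMap_genMul, Finset.sum_mul]
    refine Finset.sum_congr rfl fun j _ => ?_
    rw [← hb, coe_mulCentral, mul_assoc]

theorem toThetaDeg_mulCentral (m : ℕ) (b : F (paramP τ η) (paramQ τ η) m) :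
    toThetaDeg hτ hη (m + 3) (mulCentral _ _ m b) = 0 := by
  rw [← toTheta_eq_zero_iff, coe_mulCentral, map_mul, toTheta_centralElt, mul_zero]

theorem mem_span_of_toThetaDeg_eq_zero {n : ℕ} {a : F (paramP τ η) (paramQ τ η) n}
    (ha : toThetaDeg hτ hη n a = 0) :
    (a : Q3 τ η) ∈ TwoSidedIdeal.span {centralElt (paramP τ η) (paramQ τ η)} := by
  match n with
  | 0 =>
    rw [(injective_iff_map_eq_zero _).1 (toThetaDeg_zero_injective hτ hη) _ ha]
    exact TwoSidedIdeal.zero_mem _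
  | 1 =>
    rw [(injective_iff_map_eq_zero _).1 (toThetaDeg_one_injective hτ hη) _ ha]
    exact TwoSidedIdeal.zero_mem _
  | 2 =>
    rw [(injective_iff_map_eq_zero _).1 (toThetaDeg_two_injective hτ hη) _ ha]
    exact TwoSidedIdeal.zero_mem _
  | m + 3 =>
    obtain ⟨b, rfl⟩ := ker_toThetaDeg_add_three hτ hη m ha
    rw [coe_mulCentral]
    exact TwoSidedIdeal.mul_mem_left _ _ _ (TwoSidedIdeal.subset_span rfl)

theorem toTheta_surjective : Function.Surjective (toTheta hτ hη) := by
  intro f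
  induction f using DirectSum.induction_on with
  | zero => exact ⟨0, map_zero _⟩
  | of n f =>
    obtain ⟨a, rfl⟩ := toThetaDeg_surjective hτ hη n f
    exact ⟨a, toTheta_coe hτ hη a⟩
  | add f g hf hg =>
    obtain ⟨a, rfl⟩ := hf
    obtain ⟨b, rfl⟩ := hg
    exact ⟨a + b, map_add _ a b⟩

theorem toTheta_eq_zero_iff_mem_span (a : Q3 τ η) :
    toTheta hτ hη a = 0 ↔ a ∈ TwoSidedIdeal.span {centralElt (paramP τ η) (paramQ τ η)} := by
  constructor
  · intro h
    have ha : a ∈ ⨆ n, F (paramP τ η) (paramQ τ η) n := by rw [iSup_F_eq_top]; trivial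
    obtain ⟨f, hf, rfl⟩ := (Submodule.mem_iSup_iff_exists_finsupp _ _).1 ha
    refine sum_mem fun n hn => ?_
    refine mem_span_of_toThetaDeg_eq_zero hτ hη (a := ⟨f n, hf n⟩) ?_
    rw [Finsupp.sum, map_sum] at h
    have e : ∀ k, toTheta hτ hη (f k) = DirectSum.of (fun α => TwistedTheta τ η α) k
      (toThetaDeg hτ hη k ⟨f k, hf k⟩) := fun k => toTheta_coe hτ hη ⟨f k, hf k⟩
    simp only [e] at h
    have h' := congrArg (DirectSum.component ℂ ℕ (fun α => TwistedTheta τ η α) n) h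
    rw [map_sum, map_zero, Finset.sum_eq_single n] at h'
    · rwa [show DirectSum.component ℂ ℕ (fun α => TwistedTheta τ η α) n _ = _ from
        DirectSum.of_eq_same (β := fun α => TwistedTheta τ η α) n _] at h'
    · intro k _ hk
      exact DirectSum.of_eq_of_ne (β := fun α => TwistedTheta τ η α) _ _ _ hk.symm
    · exact fun hn' => absurd hn hn'
  · intro h
    have : TwoSidedIdeal.span {centralElt (paramP τ η) (paramQ τ η)} ≤
        TwoSidedIdeal.ker (toTheta hτ hη) := by
      rw [TwoSidedIdeal.span_le, Set.singleton_subset_iff]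
      exact (TwoSidedIdeal.mem_ker _).2 (toTheta_centralElt hτ hη)
    exact (TwoSidedIdeal.mem_ker _).1 (this h)

theorem toTheta_eq_iff (a b : Q3 τ η) : toTheta hτ hη a = toTheta hτ hη b ↔
    (TwoSidedIdeal.span {centralElt (paramP τ η) (paramQ τ η)}).ringCon a b := by
  rw [TwoSidedIdeal.rel_iff, ← toTheta_eq_zero_iff_mem_span hτ hη]
  have h : toTheta hτ hη a = toTheta hτ hη (a - b) + toTheta hτ hη b := by
    rw [← map_add, sub_add_cancel]
  rw [h]
  -- The direct sum carries only a semiring structure so far. The additive inverses induced by ℂ are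
  -- needed for cancellation.
  let _ : Ring (ThetaAlgebra τ η) := Algebra.semiringToRing ℂ
  exact add_eq_right

/-- The isomorphism from the quotient by the central element to the algebra of theta functions. -/
def quotEquiv : QuotBy (centralElt (paramP τ η) (paramQ τ η)) ≃ₐ[ℂ] ThetaAlgebra τ η :=
  AlgEquiv.ofBijective
    (RingCon.liftₐ _ (toTheta hτ hη) fun a b h => (toTheta_eq_iff hτ hη a b).2 h)
    ⟨fun x y => by
      induction x using Quotient.inductionOn
      induction y using Quotient.inductionOn
      exact fun h => Quotient.sound ((toTheta_eq_iff hτ hη _ _).1 h),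
    fun f => by
      obtain ⟨a, rfl⟩ := toTheta_surjective hτ hη f
      exact ⟨RingCon.mk' _ a, rfl⟩⟩

theorem quotEquiv_mk (a : Q3 τ η) : quotEquiv hτ hη (RingCon.mk' _ a) = toTheta hτ hη a := rfl

end

/-! ### Dimensions -/

theorem finrank_F_zero {τ η : ℂ} (hτ : 0 < τ.im)
    (hη : ∀ a b : ℤ, 3 * η ≠ (a : ℂ) + (b : ℂ) * τ) :
    Module.finrank ℂ (F (paramP τ η) (paramQ τ η) 0) = 1 := by
  rw [(LinearEquiv.ofBijective _
    ⟨toThetaDeg_zero_injective hτ hη, toThetaDeg_surjective hτ hη 0⟩).finrank_eq,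
    twisted_finrank_zero hτ]

theorem finrank_F_one {τ η : ℂ} (hτ : 0 < τ.im)
    (hη : ∀ a b : ℤ, 3 * η ≠ (a : ℂ) + (b : ℂ) * τ) :
    Module.finrank ℂ (F (paramP τ η) (paramQ τ η) 1) = 3 := by
  rw [(LinearEquiv.ofBijective _
    ⟨toThetaDeg_one_injective hτ hη, toThetaDeg_surjective hτ hη 1⟩).finrank_eq,
    twisted_finrank hτ η one_ne_zero, mul_one]

theorem finrank_F_two {τ η : ℂ} (hτ : 0 < τ.im)
    (hη : ∀ a b : ℤ, 3 * η ≠ (a : ℂ) + (b : ℂ) * τ) :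
    Module.finrank ℂ (F (paramP τ η) (paramQ τ η) 2) = 6 := by
  rw [(LinearEquiv.ofBijective _
    ⟨toThetaDeg_two_injective hτ hη, toThetaDeg_surjective hτ hη 2⟩).finrank_eq,
    twisted_finrank hτ η two_ne_zero]

/-- Rank–nullity for φ in degree m + 3, whose kernel is A_m C. Dropping the annihilator of C gives
the upper bound, and knowing both dimensions forces the annihilator to vanish
(`mulCentral_injective`). -/
theorem finrank_F_add_three {τ η : ℂ} (hτ : 0 < τ.im)
    (hη : ∀ a b : ℤ, 3 * η ≠ (a : ℂ) + (b : ℂ) * τ) (m : ℕ) :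
    Module.finrank ℂ (F (paramP τ η) (paramQ τ η) (m + 3)) +
      Module.finrank ℂ (LinearMap.ker (mulCentral (paramP τ η) (paramQ τ η) m)) =
    3 * (m + 3) + Module.finrank ℂ (F (paramP τ η) (paramQ τ η) m) := by
  have h1 := LinearMap.finrank_range_add_finrank_ker (K := ℂ)
    (V := F (paramP τ η) (paramQ τ η) (m + 3)) (V₂ := TwistedTheta τ η (m + 3))
    (toThetaDeg hτ hη (m + 3))
  have h2 := LinearMap.finrank_range_add_finrank_ker (K := ℂ)
    (V := F (paramP τ η) (paramQ τ η) m) (V₂ := F (paramP τ η) (paramQ τ η) (m + 3))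
    (mulCentral (paramP τ η) (paramQ τ η) m)
  have h3 : LinearMap.range (mulCentral (paramP τ η) (paramQ τ η) m) =
      LinearMap.ker (toThetaDeg hτ hη (m + 3)) := by
    refine le_antisymm ?_ fun a ha => ker_toThetaDeg_add_three hτ hη m ha
    rintro _ ⟨b, rfl⟩
    exact toThetaDeg_mulCentral hτ hη m b
  rw [LinearMap.range_eq_top.2 (toThetaDeg_surjective hτ hη (m + 3)), finrank_top,
    twisted_finrank hτ η (by omega)] at h1
  rw [h3] at h2
  omega

/-! ### The Koszul complex of A and the dimension count -/

theorem sum_relMatrix_genMulLeft_mul (p q : ℂ) (j : ZMod 3) (a : A p q) :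
    ∑ k, relMatrix p q (genMulLeft p q) k j (gen p q (k + 2) * a) = 0 := by
  have h : ∀ k, relMatrix p q (genMulLeft p q) k j (gen p q (k + 2) * a) =
      relMatrix p q (gen p q) k j * gen p q (k + 2) * a := fun k => by
    rw [relMatrix_map_apply, relMatrix_mul, relMatrix_mul]
    simp only [genMulLeft_apply, mul_assoc]
  simp only [h]
  rw [← Finset.sum_mul, sum_relMatrix_mul p q (gen p q) (gen p q)]
  have r := gen_relation p q (j + 1)
  have e1 : j + 1 + 1 = j + 2 := by rw [add_assoc]; rfl
  have e2 : j + 1 + 2 = j := by rw [add_assoc, show (1 : ZMod 3) + 2 = 0 from rfl, add_zero]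
  rw [e1, e2] at r
  rw [r, zero_mul]

/-- The lower bound for the dimensions coming from the Koszul complex. -/
theorem finrank_F_koszul {p q : ℂ} (m : ℕ)
    (hs : ∀ a : F p q m, (∀ i, genMul p q m i a = 0) → a = 0) :
    3 * Module.finrank ℂ (F p q (m + 2)) + Module.finrank ℂ (F p q m) ≤
      Module.finrank ℂ (F p q (m + 3)) + 3 * Module.finrank ℂ (F p q (m + 1)) := by
  have pi3 : ∀ n, Module.finrank ℂ (ZMod 3 → F p q n) = 3 * Module.finrank ℂ (F p q n) := fun n => by
    rw [Module.finrank_pi_fintype, sum_zmod_three]; ring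
  have h1 := LinearMap.finrank_range_add_finrank_ker (K := ℂ) (V := ZMod 3 → F p q (m + 2))
    (V₂ := F p q (m + 2 + 1)) (sumMap (genMul p q (m + 2)))
  have h2 := LinearMap.finrank_range_add_finrank_ker (K := ℂ) (V := ZMod 3 → F p q (m + 1))
    (V₂ := ZMod 3 → F p q (m + 1 + 1)) (relMap p q (genMul p q (m + 1)))
  have h3 : LinearMap.range (relMap p q (genMul p q (m + 1))) =
      LinearMap.ker (sumMap (genMul p q (m + 2))) := by
    refine le_antisymm ?_ fun d hd => exists_relMap_genMul_eq hd
    rintro _ ⟨g, rfl⟩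
    exact sumMap_genMul_relMap (m + 1) g
  rw [LinearMap.range_eq_top.2 (sumMap_genMul_surjective (m + 2)), finrank_top, pi3] at h1
  rw [h3, pi3] at h2
  -- The shift k + 2 is the one in `sum_relMatrix_mul`, which puts the image in the kernel.
  -- Injectivity is all that is used, hence an inequality.
  let ι : F p q m →ₗ[ℂ] LinearMap.ker (relMap p q (genMul p q (m + 1))) :=
    (LinearMap.pi fun k : ZMod 3 => genMul p q m (k + 2)).codRestrict _ fun a => by
      rw [LinearMap.mem_ker]
      refine funext fun j => Subtype.ext ?_
      rw [coe_relMap_genMul, relMap_apply]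
      exact sum_relMatrix_genMulLeft_mul p q j a
  have hι : Function.Injective ι := by
    refine (injective_iff_map_eq_zero ι).2 fun a ha => hs a fun i => ?_
    have h := congrFun (congrArg Subtype.val ha) (i + 1)
    have e : i + 1 + 2 = i := by rw [add_assoc, show (1 : ZMod 3) + 2 = 0 from rfl, add_zero]
    have h' : genMul p q m (i + 1 + 2) a = 0 := h
    rwa [e] at h'
  have h4 := LinearMap.finrank_le_finrank_of_injective hι
  have h5 : Module.finrank ℂ (LinearMap.ker (sumMap (genMul p q (m + 2)))) +
      Module.finrank ℂ (LinearMap.ker (relMap p q (genMul p q (m + 1)))) =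
      3 * Module.finrank ℂ (F p q (m + 1)) := h2
  have h6 : Module.finrank ℂ (F p q (m + 3)) +
      Module.finrank ℂ (LinearMap.ker (sumMap (genMul p q (m + 2)))) =
      3 * Module.finrank ℂ (F p q (m + 2)) := h1
  omega

theorem shiftMul_injective {τ : ℂ} (hτ : 0 < τ.im) (η : ℂ) (n : ℕ) (i : ZMod 3) :
    Function.Injective (shiftMul hτ η n i) := by
  refine (injective_iff_map_eq_zero _).2 fun f hf => ?_
  obtain ⟨z, hz⟩ := exists_theta3_ne_zero hτ i
  have h := (entire_mul_eq_zero (theta3_mem hτ i).1 (g := fun u => (f : ℂ → ℂ) (u - η))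
    (f.2.1.comp (differentiable_id.sub_const _))
    (fun u => congrFun (congrArg Subtype.val hf) u)).resolve_left fun h => hz (h z)
  exact Subtype.ext (funext fun u => by simpa using h (u + η))

theorem mulCentral_injective {τ η : ℂ} (hτ : 0 < τ.im)
    (hη : ∀ a b : ℤ, 3 * η ≠ (a : ℂ) + (b : ℂ) * τ) (m : ℕ)
    (h0 : 2 * Module.finrank ℂ (F (paramP τ η) (paramQ τ η) m) = (m + 1) * (m + 2))
    (h3 : 2 * Module.finrank ℂ (F (paramP τ η) (paramQ τ η) (m + 3)) = (m + 4) * (m + 5)) :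
    Function.Injective (mulCentral (paramP τ η) (paramQ τ η) m) := by
  have h := finrank_F_add_three hτ hη m
  rw [← LinearMap.ker_eq_bot]
  refine Submodule.finrank_eq_zero.1 ?_
  nlinarith

/-- B has no element killed by θ_0, so an element a killed by all generators lies in ker φ and, from
degree three on, equals bC. Each x_i b is killed by C in degree m - 2, where C is regular because
the dimensions in degrees m - 2 and m + 1 are known. Hence all x_i b = 0, and b vanishes by
induction. -/
theorem eq_zero_of_genMul_eq_zero {τ η : ℂ} (hτ : 0 < τ.im)
    (hη : ∀ a b : ℤ, 3 * η ≠ (a : ℂ) + (b : ℂ) * τ) (m : ℕ)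
    (h : ∀ k ≤ m + 1, 2 * Module.finrank ℂ (F (paramP τ η) (paramQ τ η) k) = (k + 1) * (k + 2))
    (a : F (paramP τ η) (paramQ τ η) m) (ha : ∀ i, genMul _ _ m i a = 0) : a = 0 := by
  induction m using Nat.strong_induction_on with
  | _ m ih =>
    have hφ : toThetaDeg hτ hη m a = 0 := by
      refine (injective_iff_map_eq_zero _).1 (shiftMul_injective hτ η m 0) _ ?_
      rw [← toThetaDeg_genMul, ha, map_zero]
    match m with
    | 0 => exact (injective_iff_map_eq_zero _).1 (toThetaDeg_zero_injective hτ hη) _ hφ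
    | 1 => exact (injective_iff_map_eq_zero _).1 (toThetaDeg_one_injective hτ hη) _ hφ
    | 2 => exact (injective_iff_map_eq_zero _).1 (toThetaDeg_two_injective hτ hη) _ hφ
    | l + 3 =>
      obtain ⟨b, rfl⟩ := ker_toThetaDeg_add_three hτ hη l hφ
      have hb : b = 0 := ih l (by omega) (fun k hk => h k (by omega)) b fun i => by
        refine (injective_iff_map_eq_zero _).1
          (mulCentral_injective hτ hη (l + 1) (h _ (by omega)) (h _ (by omega))) _
          (Subtype.ext ?_)
        have := congrArg Subtype.val (ha i)
        rw [coe_genMul, coe_mulCentral, ← mul_assoc] at this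
        exact this
      rw [hb, map_zero]

/-- For a_k = (k + 1)(k + 2)/2 the upper bound a_m + 3(m + 3) and the Koszul bound 3a_{m+2} -
3a_{m+1} + a_m agree. The latter needs the formula only below degree m + 3, so the induction closes.
-/
theorem two_mul_finrank_F {τ η : ℂ} (hτ : 0 < τ.im)
    (hη : ∀ a b : ℤ, 3 * η ≠ (a : ℂ) + (b : ℂ) * τ) (n : ℕ) :
    2 * Module.finrank ℂ (F (paramP τ η) (paramQ τ η) n) = (n + 1) * (n + 2) := by
  induction n using Nat.strong_induction_on with
  | _ n ih =>
    match n with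
    | 0 => rw [finrank_F_zero hτ hη]
    | 1 => rw [finrank_F_one hτ hη]
    | 2 => rw [finrank_F_two hτ hη]
    | m + 3 =>
      have h0 := ih m (by omega)
      have h1 := ih (m + 1) (by omega)
      have h2 := ih (m + 2) (by omega)
      have hu := finrank_F_add_three hτ hη m
      have hl := finrank_F_koszul m
        (eq_zero_of_genMul_eq_zero hτ hη m fun k hk => ih k (by omega))
      apply le_antisymm
      · nlinarith
      · nlinarith

end EllipticAlgebra

end

theorem proposition3 (τ η : ℂ) (hτ : 0 < τ.im)
    (hη : ∀ a b : ℤ, 3 * η ≠ (a : ℂ) + (b : ℂ) * τ) :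
    (∃ C : EllipticAlgebra.Q3 τ η,
      C ∈ EllipticAlgebra.F (EllipticAlgebra.paramP τ η) (EllipticAlgebra.paramQ τ η) 3 ∧
      C ≠ 0 ∧
      C ∈ Subalgebra.center ℂ (EllipticAlgebra.Q3 τ η) ∧
      ∃ Ψ : EllipticAlgebra.QuotBy C ≃ₐ[ℂ] EllipticAlgebra.ThetaAlgebra τ η,
        ∀ i : ZMod 3, ∃ f : EllipticAlgebra.TwistedTheta τ η 1,
          (f : ℂ → ℂ) = EllipticAlgebra.theta3 τ i ∧
          Ψ ((TwoSidedIdeal.span {C}).ringCon.mk' (EllipticAlgebra.gen _ _ i)) =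
            DirectSum.of (fun α => EllipticAlgebra.TwistedTheta τ η α) 1 f) ∧
    ∀ α : ℕ, Module.finrank ℂ
      (EllipticAlgebra.F (EllipticAlgebra.paramP τ η) (EllipticAlgebra.paramQ τ η) α) =
        (α + 1) * (α + 2) / 2 := by
  refine ⟨⟨EllipticAlgebra.centralElt _ _, EllipticAlgebra.centralElt_mem _ _,
    EllipticAlgebra.centralElt_param_ne_zero hτ hη,
    Subalgebra.mem_center_iff.2 fun a => EllipticAlgebra.mul_centralElt a,
    EllipticAlgebra.quotEquiv hτ hη, fun i =>
      ⟨⟨_, EllipticAlgebra.theta3_mem_twisted hτ η i⟩, rfl, ?_⟩⟩, fun α => ?_⟩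
  · exact (EllipticAlgebra.quotEquiv_mk hτ hη _).trans (EllipticAlgebra.toTheta_gen hτ hη i)
  · have h := EllipticAlgebra.two_mul_finrank_F hτ hη α
    omega
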